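/- Let $a_+,a$ be nonzero real numbers. Let $gl(2)$ be the real Lie algebra with basis $J_3,J_+,J_-,I$ and brackets $[J_3,J_\pm]=\pm 2J_\pm$, $[J_+,J_-]=J_3$, $[I,\cdot\,]=0$, and let $\delta$ be the cocommutator of the standard Lie bialgebra of family $\mathrm{I}_+$ with $a_-=b_+=0$ (hence $b_-=b=0$): $$\delta(J_3)=a_+J_3\wedge J_+,\quad \delta(J_+)=a\,J_3\wedge J_+,\quad \delta(J_-)=a\,J_3\wedge J_- -a_+J_+\wedge J_-,\quad \delta(I)=0,$$ where $x\wedge y=x\otimes y-y\otimes x$. Put $J_3'=J_3-\frac{a_+}{a}J_+$. Work over $\mathbb R[[\hbar]]$. In the formulas marked $(*)$, $a$ and $a_+$ stand for $\hbar a$ and $\hbar a_+$, and all functions are expanded as power series in $\hbar$ (no negative powers of $\hbar$ occur). Let $U=U_{a_+,a}(gl(2))$ be the $\hbar$-adically complete $\mathbb R[[\hbar]]$-algebra topologically generated by $J_3',J_+,J_-,I$ with the defining relations $$(*)\quad [J_3',J_+]=2J_+,\qquad [J_3',J_-]=-2J_--\frac{a_+}{a}\,\frac{\sinh(aJ_3'/2)}{a/2}-\frac{a_+^2}{a^2}J_+,\qquad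 [I,\cdot\,]=0,$$ $$(*)\quad [J_+,J_-]=\frac{\sinh(aJ_3')}{a}+\frac{a_+}{a}\Big(\frac{e^a-1}{2a}\Big)\big(e^{-aJ_3'/2}J_++J_+e^{aJ_3'/2}\big).$$ Let $U_{a_+,a}(sl(2,\mathbb R))$ be the complete algebra topologically generated by $J_3',J_+,J_-$ with the same relations among these three generators. Then the following hold. 1. There is a topological Hopf algebra structure on $U$ (with coproduct in the $\hbar$-adically completed tensor product) such that the counit vanishes on the generators, $J_3'$ and $I$ are primitive, and $$(*)\quad \Delta(J_\pm)=e^{aJ_3'/2}\otimes J_\pm+J_\pm\otimes e^{-aJ_3'/2}.$$ 2. This Hopf algebra quantizes $(gl(2),\delta)$. That is, $U$ is topologically free over $\mathbb R[[\hbar]]$ ($\hbar$-adically complete and without $\hbar$-torsion). Sending the generators to $J_3-\frac{a_+}{a}J_+,\,J_+,\,J_-,\,I$ induces an isomorphism of bialgebras $U/\hbar U\cong U(gl(2))$ onto the universal enveloping algebra. Finally, if $x\in U$ reduces modulo $\hbar$ to $y\in gl(2)$, then $\frac{\Delta(x)-\Delta^{\rm op}(x)}{\hbar}$ reduces to $\delta(y)$.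 3. $U_{a_+,a}(gl(2))=U_{a_+,a}(sl(2,\mathbb R))\oplus u(1)$ in the following sense. $U_{a_+,a}(sl(2,\mathbb R))$ is a topological Hopf algebra with the same formulas for the coproduct and counit on its generators. $U(u(1))[[\hbar]]$, the complete algebra on one generator $I$, is a topological Hopf algebra with $I$ primitive. There is an isomorphism of topological Hopf algebras from the completed tensor product $U_{a_+,a}(sl(2,\mathbb R))\,\widehat\otimes\,U(u(1))[[\hbar]]$ onto $U_{a_+,a}(gl(2))$ that sends generators to the generators of the same name. 4. The element $$(*)\quad \mathcal C=\frac{2}{a\tanh a}\big(\cosh(aJ_3')-1\big)+\frac{a_+}{a}\Big(\frac{\sinh(aJ_3'/2)}{a/2}J_++J_+\frac{\sinh(aJ_3'/2)}{a/2}\Big)+\frac{a_+^2}{a^2}J_+^2+2(J_+J_-+J_-J_+)$$ is central in $U$, and it reduces modulo $\hbar$ to the Casimir $J_3^2+2J_+J_-+2J_-J_+$ of $gl(2)$. -/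

import Mathlib

open scoped TensorProduct

attribute [local instance 100] LieRing.ofAssociativeRing

noncomputable section

/-! ## Power series in the formal parameter

`PowerSeries ℝ = ℝ⟦ħ⟧` is the ground ring; its variable `PowerSeries.X` is written `ħ` in comments. -/

/-- The ground ring `ℝ⟦ħ⟧`. -/
abbrev HRing : Type := PowerSeries ℝ

/-- The free topological algebra `ℝ⟨ι⟩⟦ħ⟧`: power series in `ħ`, whose coefficients are
noncommutative polynomials in the generators `ι`. -/
abbrev FreeSeries (ι : Type) : Type := PowerSeries (FreeAlgebra ℝ ι)

/-- `ℝ⟨ι⟩⟦ħ⟧` is an algebra over `ℝ⟦ħ⟧` (multiplication of power series). -/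
instance FreeSeries.algebra (ι : Type) : Algebra HRing (FreeSeries ι) :=
  RingHom.toAlgebra' (PowerSeries.map (algebraMap ℝ (FreeAlgebra ℝ ι))) (by
    intro c x
    ext n
    rw [PowerSeries.coeff_mul, PowerSeries.coeff_mul, ← Finset.Nat.sum_antidiagonal_swap]
    refine Finset.sum_congr rfl fun p _ => ?_
    simp only [PowerSeries.coeff_map, Prod.fst_swap, Prod.snd_swap]
    exact Algebra.commutes _ _)

/-- The exponential `e^{tħx} = ∑ₙ (tⁿ/n!) xⁿ ħⁿ`. -/
def hExp {T : Type} [Ring T] [Algebra ℝ T] (t : ℝ) (x : T) : PowerSeries T :=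
  PowerSeries.mk fun n => (t ^ n / (n.factorial : ℝ)) • x ^ n

/-- `sinh (tħx)`. -/
def hSinh {T : Type} [Ring T] [Algebra ℝ T] (t : ℝ) (x : T) : PowerSeries T :=
  (1 / 2 : ℝ) • (hExp t x - hExp (-t) x)

/-- `cosh (tħx)`. -/
def hCosh {T : Type} [Ring T] [Algebra ℝ T] (t : ℝ) (x : T) : PowerSeries T :=
  (1 / 2 : ℝ) • (hExp t x + hExp (-t) x)

/-- `f / ħ`, for a power series `f` without constant term. -/
def hDiv {T : Type} [Ring T] (f : PowerSeries T) : PowerSeries T :=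
  PowerSeries.mk fun n => PowerSeries.coeff (n + 1) f

/-- The scalar power series `tanh (tħ)`. -/
def hTanh (t : ℝ) : HRing := hSinh t (1 : ℝ) * (hCosh t (1 : ℝ))⁻¹

/-! ## `ħ`-adic completion -/

section Completion

variable (B : Type) [Ring B] [Algebra HRing B]

/-- The two-sided ideal `ħⁿ B`. -/
def hIdeal (n : ℕ) : Ideal B where
  carrier := {x | ∃ y : B, (PowerSeries.X : HRing) ^ n • y = x}
  zero_mem' := ⟨0, smul_zero _⟩
  add_mem' := by
    rintro _ _ ⟨y, rfl⟩ ⟨z, rfl⟩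
    exact ⟨y + z, smul_add _ _ _⟩
  smul_mem' := by
    rintro c _ ⟨y, rfl⟩
    exact ⟨c * y, by simp⟩

instance hIdeal.isTwoSided (n : ℕ) : (hIdeal B n).IsTwoSided :=
  ⟨by
    rintro _ b ⟨y, rfl⟩
    exact ⟨y * b, by simp⟩⟩

theorem hIdeal_succ_le (n : ℕ) : hIdeal B (n + 1) ≤ hIdeal B n := by
  rintro _ ⟨y, rfl⟩
  exact ⟨(PowerSeries.X : HRing) • y, by rw [pow_succ, mul_smul]⟩

/-- The class of `b` in `B / ħⁿ B`. -/
def hMk (n : ℕ) : B →ₐ[HRing] B ⧸ hIdeal B n := Ideal.Quotient.mkₐ HRing (hIdeal B n)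

/-- The `ħ`-adic completion `lim B / ħⁿ B`, as an algebra over `ℝ⟦ħ⟧`. -/
def HCompl : Subalgebra HRing (∀ n : ℕ, B ⧸ hIdeal B n) where
  carrier := {f | ∀ n, Ideal.Quotient.factorₐ HRing (hIdeal_succ_le B n) (f (n + 1)) = f n}
  mul_mem' := by
    intro f g hf hg n
    simp only [Pi.mul_apply, map_mul, hf n, hg n]
  add_mem' := by
    intro f g hf hg n
    simp only [Pi.add_apply, map_add, hf n, hg n]
  algebraMap_mem' := by
    intro r n
    simp only [Pi.algebraMap_apply, AlgHom.commutes]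

/-- The canonical map `B → lim B / ħⁿ B`. -/
def HCompl.of : B →ₐ[HRing] HCompl B :=
  AlgHom.codRestrict (AlgHom.pi fun n => hMk B n) (HCompl B)
    fun _ _ => rfl

variable {B}

theorem hMk_surjective (n : ℕ) : Function.Surjective (hMk B n) :=
  Ideal.Quotient.mkₐ_surjective HRing _

variable {C : Type} [Ring C] [Algebra HRing C]

theorem HCompl.congr_of_hMk_eq (f : B →ₗ[HRing] HCompl C) {n : ℕ} {x y : B}
    (h : hMk B n x = hMk B n y) : (f x).1 n = (f y).1 n := by
  have h1 : x - y ∈ hIdeal B n := Ideal.Quotient.eq.1 h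
  obtain ⟨z, hz⟩ := h1
  rw [← sub_eq_zero]
  have h2 : (f x).1 n - (f y).1 n = (f (x - y)).1 n := by rw [map_sub]; rfl
  rw [h2, ← hz, map_smul]
  change (PowerSeries.X : HRing) ^ n • (f z).1 n = 0
  obtain ⟨w, hw⟩ := hMk_surjective n ((f z).1 n)
  rw [← hw, ← map_smul]
  exact Ideal.Quotient.eq_zero_iff_mem.2 ⟨w, rfl⟩

/-- The unique `ħ`-adically continuous extension of a linear map `f : B → Ĉ` to `B̂ → Ĉ`: modulo
`ħⁿ`, its value at `z` is `f b`, where `b : B` represents `z` modulo `ħⁿ`. -/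
def HCompl.extend (f : B →ₗ[HRing] HCompl C) : HCompl B →ₗ[HRing] HCompl C where
  toFun z := ⟨fun n => (f (Function.surjInv (hMk_surjective n) (z.1 n))).1 n, by
    intro n
    rw [(f _).2 n]
    apply HCompl.congr_of_hMk_eq
    rw [Function.surjInv_eq (hMk_surjective (B := B) n), ← z.2 n]
    have := Function.surjInv_eq (hMk_surjective (B := B) (n + 1)) (z.1 (n + 1))
    conv_rhs => rw [← this]
    rfl⟩
  map_add' z w := by
    ext n
    change _ = (f _).1 n + (f _).1 n
    have h : ∀ x y : B, (f x).1 n + (f y).1 n = (f (x + y)).1 n := by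
      intro x y
      rw [map_add]
      rfl
    rw [h]
    apply HCompl.congr_of_hMk_eq
    simp only [map_add, Function.surjInv_eq]
    rfl
  map_smul' c z := by
    ext n
    change _ = c • (f _).1 n
    have h : ∀ x : B, c • (f x).1 n = (f (c • x)).1 n := by
      intro x
      rw [map_smul]
      rfl
    rw [h]
    apply HCompl.congr_of_hMk_eq
    simp only [map_smul, Function.surjInv_eq]
    rfl

theorem HCompl.extend_apply (f : B →ₗ[HRing] HCompl C) (z : HCompl B) (n : ℕ) (b : B)
    (h : hMk B n b = z.1 n) : (HCompl.extend f z).1 n = (f b).1 n :=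
  HCompl.congr_of_hMk_eq f ((Function.surjInv_eq _ _).trans h.symm)

/-- Functoriality of the completion: the linear map `B̂ → Ĉ` induced by `f : B → C`. -/
def HCompl.map (f : B →ₗ[HRing] C) : HCompl B →ₗ[HRing] HCompl C :=
  HCompl.extend ((HCompl.of C).toLinearMap ∘ₗ f)

theorem HCompl.map_apply (f : B →ₗ[HRing] C) (z : HCompl B) (n : ℕ) (b : B)
    (h : hMk B n b = z.1 n) : (HCompl.map f z).1 n = hMk C n (f b) :=
  HCompl.extend_apply _ z n b h

theorem HCompl.map_add_left (f g : B →ₗ[HRing] C) (z : HCompl B) :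
    HCompl.map (f + g) z = HCompl.map f z + HCompl.map g z := by
  ext n
  obtain ⟨t, ht⟩ := hMk_surjective n (z.1 n)
  change _ = (HCompl.map f z).1 n + (HCompl.map g z).1 n
  rw [HCompl.map_apply _ _ n t ht, HCompl.map_apply _ _ n t ht, HCompl.map_apply _ _ n t ht,
    LinearMap.add_apply, map_add]

theorem HCompl.map_smul_left (c : HRing) (f : B →ₗ[HRing] C) (z : HCompl B) :
    HCompl.map (c • f) z = c • HCompl.map f z := by
  ext n
  obtain ⟨t, ht⟩ := hMk_surjective n (z.1 n)
  change _ = c • (HCompl.map f z).1 n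
  rw [HCompl.map_apply _ _ n t ht, HCompl.map_apply _ _ n t ht, LinearMap.smul_apply, map_smul]

end Completion

/-! ## Topological Hopf algebras over `ℝ⟦ħ⟧` -/

section Hopf

variable {A : Type} [Ring A] [Algebra HRing A]

/-- `Δ ⊗̂ id : A ⊗ A → A ⊗̂ A ⊗̂ A`, `a ⊗ b ↦ Δ(a) ⊗ b`. -/
def comulLeft (Δ : A →ₗ[HRing] HCompl (A ⊗[HRing] A)) :
    A ⊗[HRing] A →ₗ[HRing] HCompl (A ⊗[HRing] (A ⊗[HRing] A)) :=
  TensorProduct.lift (LinearMap.mk₂ HRing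
    (fun a b => HCompl.map
      ((TensorProduct.assoc HRing A A A).toLinearMap ∘ₗ
        (TensorProduct.mk HRing (A ⊗[HRing] A) A).flip b) (Δ a))
    (fun a a' b => by rw [map_add, map_add])
    (fun c a b => by rw [map_smul, map_smul])
    (fun a b b' => by rw [map_add, LinearMap.comp_add, HCompl.map_add_left])
    (fun c a b => by rw [map_smul, LinearMap.comp_smul, HCompl.map_smul_left]))

/-- `id ⊗̂ Δ : A ⊗ A → A ⊗̂ A ⊗̂ A`, `a ⊗ b ↦ a ⊗ Δ(b)`. -/
def comulRight (Δ : A →ₗ[HRing] HCompl (A ⊗[HRing] A)) :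
    A ⊗[HRing] A →ₗ[HRing] HCompl (A ⊗[HRing] (A ⊗[HRing] A)) :=
  TensorProduct.lift (LinearMap.mk₂ HRing
    (fun a b => HCompl.map (TensorProduct.mk HRing A (A ⊗[HRing] A) a) (Δ b))
    (fun a a' b => by rw [map_add, HCompl.map_add_left])
    (fun c a b => by rw [map_smul, HCompl.map_smul_left])
    (fun a b b' => by rw [map_add, map_add])
    (fun c a b => by rw [map_smul, map_smul]))

/-- `A ⊗ A → A`, `a ⊗ b ↦ f(a) g(b)`. -/
def mulMap (f g : A →ₗ[HRing] A) : A ⊗[HRing] A →ₗ[HRing] A :=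
  LinearMap.mul' HRing A ∘ₗ TensorProduct.map f g

/-- The linear endomorphism `x ↦ ε(x) 1` of `A`. -/
def unitCounit (ε : A →ₐ[HRing] HRing) : A →ₗ[HRing] A :=
  Algebra.linearMap HRing A ∘ₗ ε.toLinearMap

variable (A) in
/-- A topological Hopf algebra structure on an `ℝ⟦ħ⟧`-algebra `A`: the coproduct takes its values
in the completed tensor square `A ⊗̂ A`, and the axioms are the usual ones, between maps to
completed tensor powers (the completion of `A` is `A` itself when `A` is `ħ`-adically complete). -/
structure TopHopf where
  comul : A →ₐ[HRing] HCompl (A ⊗[HRing] A)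
  counit : A →ₐ[HRing] HRing
  antipode : A →ₗ[HRing] A
  coassoc : ∀ x, HCompl.extend (comulLeft comul.toLinearMap) (comul x) =
    HCompl.extend (comulRight comul.toLinearMap) (comul x)
  counit_left : ∀ x, HCompl.map (mulMap (unitCounit counit) LinearMap.id) (comul x) =
    HCompl.of A x
  counit_right : ∀ x, HCompl.map (mulMap LinearMap.id (unitCounit counit)) (comul x) =
    HCompl.of A x
  antipode_left : ∀ x, HCompl.map (mulMap antipode LinearMap.id) (comul x) =
    HCompl.of A (unitCounit counit x)
  antipode_right : ∀ x, HCompl.map (mulMap LinearMap.id antipode) (comul x) =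
    HCompl.of A (unitCounit counit x)

/-- Homomorphisms of topological Hopf algebras: algebra maps that respect coproduct and counit. -/
structure TopHopf.IsHom {B : Type} [Ring B] [Algebra HRing B] (HA : TopHopf A) (HB : TopHopf B)
    (f : A →ₐ[HRing] B) : Prop where
  comul : ∀ x, HB.comul (f x) =
    HCompl.map (TensorProduct.map f.toLinearMap f.toLinearMap) (HA.comul x)
  counit : ∀ x, HB.counit (f x) = HA.counit x

/-- `Δ(x) = 1 ⊗ x + x ⊗ 1`. -/
def TopHopf.IsPrimitive (H : TopHopf A) (x : A) : Prop :=
  H.comul x = HCompl.of (A ⊗[HRing] A) ((1 : A) ⊗ₜ[HRing] x + x ⊗ₜ[HRing] (1 : A))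

/-- `Δ(x) = k ⊗ x + x ⊗ l`. -/
def TopHopf.IsTwisted (H : TopHopf A) (k l x : A) : Prop :=
  H.comul x = HCompl.of (A ⊗[HRing] A) (k ⊗ₜ[HRing] x + x ⊗ₜ[HRing] l)

end Hopf

/-! ## Quantization of a Lie bialgebra -/

section Quantization

variable {g : Type} [LieRing g] [LieAlgebra ℝ g]

/-- The standard coproduct of `U(g)`, `Δ(x) = 1 ⊗ x + x ⊗ 1` for `x ∈ g`. -/
def ueaComul (g : Type) [LieRing g] [LieAlgebra ℝ g] : UniversalEnvelopingAlgebra ℝ g →ₐ[ℝ]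
    UniversalEnvelopingAlgebra ℝ g ⊗[ℝ] UniversalEnvelopingAlgebra ℝ g :=
  UniversalEnvelopingAlgebra.lift ℝ
    { toFun := fun x => 1 ⊗ₜ UniversalEnvelopingAlgebra.ι ℝ x +
        UniversalEnvelopingAlgebra.ι ℝ x ⊗ₜ 1
      map_add' := by
        intro x y
        simp only [map_add, TensorProduct.tmul_add, TensorProduct.add_tmul]
        abel
      map_smul' := by
        intro c x
        simp [TensorProduct.smul_tmul', smul_add]
      map_lie' := by
        intro x y
        simp only [LieHom.map_lie, Ring.lie_def, mul_add, add_mul,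
          Algebra.TensorProduct.tmul_mul_tmul, one_mul, mul_one, TensorProduct.tmul_sub,
          TensorProduct.sub_tmul]
        abel }

/-- The counit of `U(g)`, which vanishes on `g`. -/
def ueaCounit (g : Type) [LieRing g] [LieAlgebra ℝ g] :
    UniversalEnvelopingAlgebra ℝ g →ₐ[ℝ] ℝ :=
  UniversalEnvelopingAlgebra.lift ℝ 0

variable {A : Type} [Ring A] [Algebra HRing A]

/-- A ring homomorphism `A → U` that is linear over evaluation at `ħ = 0`, as a semilinear map. -/
def redLin {U : Type} [Ring U] [Algebra ℝ U] (π : A →+* U)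
    (h : ∀ (c : HRing) (x : A), π (c • x) = PowerSeries.constantCoeff c • π x) :
    A →ₛₗ[(PowerSeries.constantCoeff : HRing →+* ℝ)] U where
  toFun := π
  map_add' := map_add π
  map_smul' := h

/-- The topological Hopf algebra `A` is a quantization of `(g, δ)` through the reduction map
`π : A → U(g)`: `A` is topologically free over `ℝ⟦ħ⟧` (complete and without `ħ`-torsion), `π`
identifies `A / ħA` with `U(g)` as bialgebras, and
`δ(y) = (Δ(x) - Δᵒᵖ(x)) / ħ` modulo `ħ` whenever `x` reduces to `y ∈ g`. -/
structure IsQuantization (H : TopHopf A) (δ : g →ₗ[ℝ] g ⊗[ℝ] g)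
    (π : A →+* UniversalEnvelopingAlgebra ℝ g) : Prop where
  complete : IsAdicComplete (Ideal.span {(PowerSeries.X : HRing)}) A
  torsion_free : ∀ x : A, (PowerSeries.X : HRing) • x = 0 → x = 0
  map_smul : ∀ (c : HRing) (x : A), π (c • x) = PowerSeries.constantCoeff c • π x
  surjective : Function.Surjective π
  ker : ∀ x : A, π x = 0 ↔ ∃ y : A, x = (PowerSeries.X : HRing) • y
  comul : ∀ (x : A) (t : A ⊗[HRing] A), (H.comul x).1 1 = hMk _ 1 t →
    TensorProduct.map (redLin π map_smul) (redLin π map_smul) t = ueaComul g (π x)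
  counit : ∀ x : A, ueaCounit g (π x) = PowerSeries.constantCoeff (H.counit x)
  cocommutator : ∀ (x : A) (y : g) (t : A ⊗[HRing] A),
    π x = UniversalEnvelopingAlgebra.ι ℝ y → (H.comul x).1 2 = hMk _ 2 t →
    ∃ s : A ⊗[HRing] A,
      hMk _ 2 (t - TensorProduct.comm HRing A A t) = hMk _ 2 ((PowerSeries.X : HRing) • s) ∧
      TensorProduct.map (redLin π map_smul) (redLin π map_smul) s =
        TensorProduct.map (UniversalEnvelopingAlgebra.ι ℝ : g →ₗ⁅ℝ⁆ _).toLinearMap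
          (UniversalEnvelopingAlgebra.ι ℝ : g →ₗ⁅ℝ⁆ _).toLinearMap (δ y)

end Quantization

/-! ## The Lie algebra `gl(2)` and its Lie bialgebras -/

/-- `gl(2)`: real `2 × 2` matrices with the commutator bracket. -/
abbrev GL2 : Type := Matrix (Fin 2) (Fin 2) ℝ

namespace GL2

/-- The generator `J₃`. -/
def J3 : GL2 := !![1, 0; 0, -1]

/-- The generator `J₊`. -/
def Jp : GL2 := !![0, 1; 0, 0]

/-- The generator `J₋`. -/
def Jm : GL2 := !![0, 0; 1, 0]

/-- The central generator `I`. -/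
def I : GL2 := !![1, 0; 0, 1]

/-- `x ∧ y = x ⊗ y - y ⊗ x`. -/
def wedge (x y : GL2) : GL2 ⊗[ℝ] GL2 := x ⊗ₜ y - y ⊗ₜ x

/-- The six-parameter cocommutator, given by its values on the basis `J₃, J₊, J₋, I`; the
coordinates of a matrix `m` in this basis are `(m₀₀ - m₁₁)/2, m₀₁, m₁₀, (m₀₀ + m₁₁)/2`. -/
def cocomm (ap am bp bm a b : ℝ) : GL2 →ₗ[ℝ] GL2 ⊗[ℝ] GL2 :=
  ((1 / 2 : ℝ) • (Matrix.entryLinearMap ℝ ℝ 0 0 - Matrix.entryLinearMap ℝ ℝ 1 1) :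
      GL2 →ₗ[ℝ] ℝ).smulRight
    (ap • wedge J3 Jp + am • wedge J3 Jm + bp • wedge Jp I + bm • wedge Jm I) +
  (Matrix.entryLinearMap ℝ ℝ 0 1 : GL2 →ₗ[ℝ] ℝ).smulRight
    (a • wedge J3 Jp - (bm / 2) • wedge J3 I + am • wedge Jp Jm + b • wedge Jp I) +
  (Matrix.entryLinearMap ℝ ℝ 1 0 : GL2 →ₗ[ℝ] ℝ).smulRight
    (a • wedge J3 Jm - (bp / 2) • wedge J3 I - ap • wedge Jp Jm - b • wedge Jm I)

/-- The cocommutator of the family `I₊`, with parameters `a₊ ≠ 0`, `a₋`, `b₊`, `a` and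
`b₋ = -a₋b₊/a₊`, `b = b₊a/a₊`; it is standard when `a² + a₊a₋ ≠ 0`. -/
def cocommIPlus (ap am bp a : ℝ) : GL2 →ₗ[ℝ] GL2 ⊗[ℝ] GL2 :=
  cocomm ap am bp (-(am * bp) / ap) a (bp * a / ap)

end GL2

/-! ## Algebras given by topological generators and relations -/

/-- The closed two-sided ideal of `ℝ⟨ι⟩⟦ħ⟧` generated by `rels`: the `ħ`-adic closure of the
two-sided ideal generated by `rels`. -/
def relIdeal {ι : Type} (rels : Set (FreeSeries ι)) : Ideal (FreeSeries ι) :=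
  ⨅ n : ℕ, (TwoSidedIdeal.span (rels ∪ {algebraMap HRing (FreeSeries ι) (PowerSeries.X ^ n)})).asIdeal

instance relIdeal.isTwoSided {ι : Type} (rels : Set (FreeSeries ι)) :
    (relIdeal rels).IsTwoSided :=
  inferInstanceAs (⨅ n : ℕ, (TwoSidedIdeal.span
    (rels ∪ {algebraMap HRing (FreeSeries ι) (PowerSeries.X ^ n)})).asIdeal).IsTwoSided

/-- The complete `ℝ⟦ħ⟧`-algebra topologically generated by `ι` with defining relations
`r = 0`, `r ∈ rels`. -/
abbrev PresentedAlg {ι : Type} (rels : Set (FreeSeries ι)) : Type := FreeSeries ι ⧸ relIdeal rels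

/-- The element of the presented algebra given by a power series in the generators. -/
def PresentedAlg.mk {ι : Type} (rels : Set (FreeSeries ι)) :
    FreeSeries ι →ₐ[HRing] PresentedAlg rels :=
  Ideal.Quotient.mkₐ HRing (relIdeal rels)

/-- A generator, as an element of `ℝ⟨ι⟩⟦ħ⟧`. -/
def fgen {ι : Type} (i : ι) : FreeSeries ι := PowerSeries.C (FreeAlgebra.ι ℝ i)

/-- A generator, as an element of the presented algebra. -/
def PresentedAlg.gen {ι : Type} (rels : Set (FreeSeries ι)) (i : ι) : PresentedAlg rels :=
  PresentedAlg.mk rels (fgen i)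

/-! ## The quantum algebras

The deformation parameters are `ħa₊` and `ħa`, with real numbers `a₊`, `a`. -/

section Relations

variable {ι : Type}

/-- `sinh(aJ/2)/(a/2)`, with `ħa` for `a`. -/
def qHalf (a : ℝ) (J : ι) : FreeSeries ι := (2 / a) • hDiv (hSinh (a / 2) (FreeAlgebra.ι ℝ J))

/-- `sinh(aJ)/a`, with `ħa` for `a`. -/
def qFull (a : ℝ) (J : ι) : FreeSeries ι := (1 / a) • hDiv (hSinh a (FreeAlgebra.ι ℝ J))

/-- The scalar `(eᵃ - 1)/(2a)`, with `ħa` for `a`. -/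
def qScalar (a : ℝ) : HRing := (1 / (2 * a)) • hDiv (hExp a (1 : ℝ) - 1)

/-- The commutator `[x, y] = x y - y x`. -/
def qComm (x y : FreeSeries ι) : FreeSeries ι := x * y - y * x

/-- The deformed commutation rules of the generators `J₃', J₊, J₋` (in this order), each written
as left-hand side minus right-hand side. -/
def slRels (ap a : ℝ) (J P M : ι) : Set (FreeSeries ι) :=
  {qComm (fgen J) (fgen P) - (2 : ℝ) • fgen P,
   qComm (fgen J) (fgen M) -
    (-((2 : ℝ) • fgen M) - (ap / a) • qHalf a J - (ap ^ 2 / a ^ 2) • fgen P),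
   qComm (fgen P) (fgen M) -
    (qFull a J + (ap / a) • qScalar a •
      (hExp (-(a / 2)) (FreeAlgebra.ι ℝ J) * fgen P +
        fgen P * hExp (a / 2) (FreeAlgebra.ι ℝ J)))}

/-- The deformed Casimir
`2/(a tanh a) (cosh(aJ₃') - 1) + (a₊/a)(S J₊ + J₊ S) + (a₊²/a²) J₊² + 2 (J₊J₋ + J₋J₊)` with
`S = sinh(aJ₃'/2)/(a/2)` and `ħa`, `ħa₊` for `a`, `a₊`. The first coefficient is
`2/(ħa tanh(ħa)) = ħ⁻² (2/a) (tanh(ħa)/ħ)⁻¹`. -/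
def casimirSeries (ap a : ℝ) (J P M : ι) : FreeSeries ι :=
  ((2 / a) • (hDiv (hTanh a))⁻¹ : HRing) • hDiv (hDiv (hCosh a (FreeAlgebra.ι ℝ J) - 1)) +
  (ap / a) • (qHalf a J * fgen P + fgen P * qHalf a J) +
  (ap ^ 2 / a ^ 2) • fgen P ^ 2 +
  (2 : ℝ) • (fgen P * fgen M + fgen M * fgen P)

end Relations

/-- The generators `J₃', J₊, J₋` of the quantum `sl(2,ℝ)`. -/
inductive SlGen : Type
  | J3 | Jp | Jm

/-- The generators `J₃', J₊, J₋, I` of the quantum `gl(2)`. -/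
inductive GlGen : Type
  | J3 | Jp | Jm | I

/-- The defining relations of the quantum `gl(2)`: those of `J₃', J₊, J₋`, and `I` is central. -/
def glRels (ap a : ℝ) : Set (FreeSeries GlGen) :=
  slRels ap a GlGen.J3 GlGen.Jp GlGen.Jm ∪ Set.range fun x : GlGen => qComm (fgen GlGen.I) (fgen x)

/-- The quantum algebra of `gl(2)`, with parameters `ħa₊`, `ħa`. -/
abbrev QGl (ap a : ℝ) : Type := PresentedAlg (glRels ap a)

/-- The quantum algebra of `sl(2,ℝ)`, with parameters `ħa₊`, `ħa`. -/
abbrev QSl (ap a : ℝ) : Type := PresentedAlg (slRels ap a SlGen.J3 SlGen.Jp SlGen.Jm)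

/-- The undeformed `U(u(1))⟦ħ⟧`, with one generator and no relation. -/
abbrev QU1 : Type := PresentedAlg (∅ : Set (FreeSeries Unit))

namespace QGl

/-- The generators of the quantum `gl(2)`. -/
def gen (ap a : ℝ) (x : GlGen) : QGl ap a := PresentedAlg.gen (glRels ap a) x

/-- `e^{tħJ₃'}`. -/
def expJ (ap a t : ℝ) : QGl ap a :=
  PresentedAlg.mk (glRels ap a) (hExp t (FreeAlgebra.ι ℝ GlGen.J3))

/-- The deformed Casimir. -/
def casimir (ap a : ℝ) : QGl ap a :=
  PresentedAlg.mk (glRels ap a) (casimirSeries ap a GlGen.J3 GlGen.Jp GlGen.Jm)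

end QGl

namespace QSl

/-- The generators of the quantum `sl(2,ℝ)`. -/
def gen (ap a : ℝ) (x : SlGen) : QSl ap a :=
  PresentedAlg.gen (slRels ap a SlGen.J3 SlGen.Jp SlGen.Jm) x

/-- `e^{tħJ₃'}`. -/
def expJ (ap a t : ℝ) : QSl ap a :=
  PresentedAlg.mk (slRels ap a SlGen.J3 SlGen.Jp SlGen.Jm) (hExp t (FreeAlgebra.ι ℝ SlGen.J3))

end QSl

/-- The generator `I` of `U(u(1))⟦ħ⟧`. -/
def QU1.gen : QU1 := PresentedAlg.gen (∅ : Set (FreeSeries Unit)) ()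

/-- The generator `x ∈ gl(2)` as an element of `U(gl(2))`. -/
def ugl (x : GL2) : UniversalEnvelopingAlgebra ℝ GL2 := UniversalEnvelopingAlgebra.ι ℝ x

/-- The coproduct and the trivial counit of the quantum `gl(2)` on the generators. -/
structure IsGlHopf (ap a : ℝ) (H : TopHopf (QGl ap a)) : Prop where
  comul_J3 : H.IsPrimitive (QGl.gen ap a GlGen.J3)
  comul_I : H.IsPrimitive (QGl.gen ap a GlGen.I)
  comul_Jp : H.IsTwisted (QGl.expJ ap a (a / 2)) (QGl.expJ ap a (-(a / 2)))
    (QGl.gen ap a GlGen.Jp)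
  comul_Jm : H.IsTwisted (QGl.expJ ap a (a / 2)) (QGl.expJ ap a (-(a / 2)))
    (QGl.gen ap a GlGen.Jm)
  counit : ∀ x, H.counit (QGl.gen ap a x) = 0

/-- The coproduct and the trivial counit of the quantum `sl(2,ℝ)` on the generators. -/
structure IsSlHopf (ap a : ℝ) (H : TopHopf (QSl ap a)) : Prop where
  comul_J3 : H.IsPrimitive (QSl.gen ap a SlGen.J3)
  comul_Jp : H.IsTwisted (QSl.expJ ap a (a / 2)) (QSl.expJ ap a (-(a / 2)))
    (QSl.gen ap a SlGen.Jp)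
  comul_Jm : H.IsTwisted (QSl.expJ ap a (a / 2)) (QSl.expJ ap a (-(a / 2)))
    (QSl.gen ap a SlGen.Jm)
  counit : ∀ x, H.counit (QSl.gen ap a x) = 0

/-- The values on generators of the reduction map `QGl → U(gl(2))` at `ħ = 0`, where
`J₃' = J₃ - (a₊/a) J₊` in `gl(2)`. -/
structure IsGlReduction (ap a : ℝ) (π : QGl ap a →+* UniversalEnvelopingAlgebra ℝ GL2) :
    Prop where
  J3 : π (QGl.gen ap a GlGen.J3) = ugl (GL2.J3 - (ap / a) • GL2.Jp)
  Jp : π (QGl.gen ap a GlGen.Jp) = ugl GL2.Jp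
  Jm : π (QGl.gen ap a GlGen.Jm) = ugl GL2.Jm
  I : π (QGl.gen ap a GlGen.I) = ugl GL2.I

/-- The algebra isomorphism `Φ : QSl ⊗̂ U(u(1))⟦ħ⟧ ≃ QGl` maps generators to generators and its
restrictions to both tensor factors are homomorphisms of topological Hopf algebras, that is, `Φ` is
an isomorphism of topological Hopf algebras for the tensor product structure. -/
structure IsHopfSplitting (ap a : ℝ) (H : TopHopf (QGl ap a)) (Hs : TopHopf (QSl ap a))
    (Hu : TopHopf QU1) (Φ : HCompl (QSl ap a ⊗[HRing] QU1) ≃ₐ[HRing] QGl ap a) : Prop where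
  J3 : Φ (HCompl.of _ (QSl.gen ap a SlGen.J3 ⊗ₜ 1)) = QGl.gen ap a GlGen.J3
  Jp : Φ (HCompl.of _ (QSl.gen ap a SlGen.Jp ⊗ₜ 1)) = QGl.gen ap a GlGen.Jp
  Jm : Φ (HCompl.of _ (QSl.gen ap a SlGen.Jm ⊗ₜ 1)) = QGl.gen ap a GlGen.Jm
  I : Φ (HCompl.of _ (1 ⊗ₜ QU1.gen)) = QGl.gen ap a GlGen.I
  hom_sl : TopHopf.IsHom Hs H ((Φ.toAlgHom.comp (HCompl.of (QSl ap a ⊗[HRing] QU1))).comp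
    Algebra.TensorProduct.includeLeft)
  hom_u1 : TopHopf.IsHom Hu H ((Φ.toAlgHom.comp (HCompl.of (QSl ap a ⊗[HRing] QU1))).comp
    Algebra.TensorProduct.includeRight)

end

/-! The presentation is the Drinfeld-Jimbo one in disguise. Put r = a₊/a, s = sinh(aJ₃'/2)/(a/2) and
n = J₋ + (r/2) s + (r/2)² J₊. Since s commutes with J₃' and (r/2)[J₊, s] cancels the a₊-term of [J₊,
J₋], the relations become [J₃', J₊] = 2J₊, [J₃', n] = -2n, [J₊, n] = sinh(aJ₃')/a
(`IsQTriple.isDJTriple`). The element s obeys the same twisted coproduct rule as J₊ and J₋, hence so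
does n. Compatibility of Δ with the relations (`IsDJTriple.coproduct`) and centrality of the Casimir
(`IsDJTriple.casimir_commute`) are therefore Drinfeld-Jimbo computations.

A presented algebra is universal among complete algebras (`PresentedAlg.lift`), so structure maps
are given by images of generators: Δ takes values in the completed tensor square, ε in the scalars,
and x ↦ -x in the opposite algebra. Conjugating the last map by an exponential of J₃' gives the
antipode, and the Hopf axioms are verified on generators (`exists_topHopf`).

The elements s and sinh(aJ₃')/a are determined by exponentials only after multiplication by ħ, so
these arguments need algebras without ħ-torsion. Torsion-freeness is proved first, without a PBW
basis, by mapping the quantum algebra to U(gl(2))⟦ħ⟧. For an undeformed triple h, e, f the element z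
= 4fe + (h+1)² commutes with the triple, and n = f · 2/(a sinh a) · (cosh(a√z) - cosh(a(h-1)))/(z -
(h-1)²), suitably normalized by powers of ħ, completes h, e to a Drinfeld-Jimbo triple with n ≡ f
modulo ħ (`exists_isDJTriple`). In the other direction, the relations reduce modulo ħ to those of
gl(2), so U(gl(2)) maps to the quantum algebra modulo ħ (`exists_ringHom_hMk_one`). Hence the
reduction π has kernel exactly ħ times the algebra. If the lift of π to U(gl(2))⟦ħ⟧ kills x, then x
= ħy and the lift kills y as well; iterating, x lies in all multiples of ħⁿ and vanishes. So the
lift is injective and its torsion-free target forces `QGl.hTorsionFree`. Tensor squares stay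
torsion-free by flatness over the principal ideal domain ℝ⟦ħ⟧.

For the cocommutator, an element reducing to gl(2) is a combination of generators plus ħz. The
generators are read off from their coproducts, and ħz contributes nothing because U(gl(2)) is
cocommutative. The splitting is an instance of the universal property in both directions, I being
central. -/

noncomputable section

/-! ## Convergent series in complete algebras -/

/-- The formal parameter. -/
local notation "ħ" => (PowerSeries.X : HRing)

/-- An `ℝ⟦ħ⟧`-algebra that is `ħ`-adically separated and in which all series `∑ ħⁿ fₙ` converge. -/
class HComplete (T : Type) [Ring T] [Algebra HRing T] : Prop where
  sep : ∀ x : T, (∀ n : ℕ, ∃ y : T, x = ħ ^ n • y) → x = 0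
  sum : ∀ f : ℕ → T, ∃ s : T, ∀ n : ℕ, ∃ y : T,
    s = ∑ i ∈ Finset.range n, ħ ^ i • f i + ħ ^ n • y

/-- An `ℝ⟦ħ⟧`-algebra without `ħ`-torsion. -/
class HTorsionFree (T : Type) [Ring T] [Algebra HRing T] : Prop where
  eq_zero : ∀ x : T, ħ • x = 0 → x = 0

section Series

variable {T : Type} [Ring T] [Algebra HRing T] {T' : Type} [Ring T'] [Algebra HRing T']

theorem HTorsionFree.cancel [HTorsionFree T] {x y : T} (h : ħ • x = ħ • y) : x = y :=
  sub_eq_zero.1 (HTorsionFree.eq_zero _ (by rw [smul_sub, h, sub_self]))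

/-- The quotients sinh(aj/2)/(a/2) and sinh(aj)/a are accessible only through their multiples by ħ
and a real constant. Identities about them are proved by this cancellation. -/
theorem HTorsionFree.smul_cancel [HTorsionFree T] {t : ℝ} (ht : t ≠ 0) {x y : T}
    (h : (ħ * PowerSeries.C t) • x = (ħ * PowerSeries.C t) • y) : x = y := by
  rw [mul_smul, mul_smul] at h
  have h2 := congrArg (fun w => PowerSeries.C t⁻¹ • w) (HTorsionFree.cancel h)
  simpa [← mul_smul, ← map_mul, ht] using h2

theorem HTorsionFree.of_injective [HTorsionFree T'] (f : T →ₗ[HRing] T')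
    (hf : Function.Injective f) : HTorsionFree T :=
  ⟨fun x hx => hf (by
    rw [map_zero]
    exact HTorsionFree.eq_zero _ (by rw [← map_smul, hx, map_zero]))⟩

/-- Two elements are equal if their difference is divisible by all powers of `ħ`. -/
theorem HComplete.eq_of_forall [HComplete T] {x y : T}
    (h : ∀ n : ℕ, ∃ z : T, x = y + ħ ^ n • z) : x = y :=
  sub_eq_zero.1 (HComplete.sep _ fun n => by
    obtain ⟨z, hz⟩ := h n
    exact ⟨z, by rw [hz, add_sub_cancel_left]⟩)

/-- The sum of the series `∑ ħⁿ fₙ`. -/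
def hSum [HComplete T] (f : ℕ → T) : T := Classical.choose (HComplete.sum f)

theorem hSum_spec [HComplete T] (f : ℕ → T) (n : ℕ) : ∃ y : T,
    hSum f = ∑ i ∈ Finset.range n, ħ ^ i • f i + ħ ^ n • y :=
  Classical.choose_spec (HComplete.sum f) n

theorem eq_hSum [HComplete T] {f : ℕ → T} {s : T}
    (h : ∀ n : ℕ, ∃ y : T, s = ∑ i ∈ Finset.range n, ħ ^ i • f i + ħ ^ n • y) : s = hSum f := by
  refine HComplete.eq_of_forall fun n => ?_
  obtain ⟨y, hy⟩ := h n
  obtain ⟨z, hz⟩ := hSum_spec f n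
  exact ⟨y - z, by rw [hy, hz, smul_sub]; abel⟩

/-- A linear map sends multiples of ħⁿ to multiples of ħⁿ, so it is automatically continuous and no
topology has to be mentioned. -/
theorem map_hSum [HComplete T] [HComplete T'] (g : T →ₗ[HRing] T') (f : ℕ → T) :
    g (hSum f) = hSum fun n => g (f n) := by
  refine eq_hSum fun n => ?_
  obtain ⟨y, hy⟩ := hSum_spec f n
  exact ⟨g y, by rw [hy]; simp only [map_add, map_sum, map_smul]⟩

theorem hSum_add [HComplete T] (f g : ℕ → T) :
    hSum f + hSum g = hSum fun n => f n + g n := by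
  refine eq_hSum fun n => ?_
  obtain ⟨y, hy⟩ := hSum_spec f n
  obtain ⟨z, hz⟩ := hSum_spec g n
  exact ⟨y + z, by rw [hy, hz]; simp only [smul_add, Finset.sum_add_distrib]; abel⟩

theorem smul_hSum [HComplete T] (c : HRing) (f : ℕ → T) :
    c • hSum f = hSum fun n => c • f n :=
  map_hSum (LinearMap.lsmul HRing T c) f

theorem mul_hSum [HComplete T] (c : T) (f : ℕ → T) : c * hSum f = hSum fun n => c * f n :=
  map_hSum (LinearMap.mulLeft HRing c) f

theorem hSum_mul [HComplete T] (c : T) (f : ℕ → T) : hSum f * c = hSum fun n => f n * c :=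
  map_hSum (LinearMap.mulRight HRing c) f

theorem hSum_succ [HComplete T] (f : ℕ → T) :
    hSum f = f 0 + ħ • hSum fun n => f (n + 1) := by
  symm
  refine eq_hSum fun n => ?_
  cases n with
  | zero => exact ⟨_, by rw [Finset.sum_range_zero, pow_zero, one_smul, zero_add]⟩
  | succ n =>
    obtain ⟨y, hy⟩ := hSum_spec (fun n => f (n + 1)) n
    refine ⟨y, ?_⟩
    rw [hy, Finset.sum_range_succ', smul_add, Finset.smul_sum]
    simp only [← mul_smul, ← pow_succ', pow_zero, one_smul]
    abel

/-- The discrepancy between the two sides for f equals ħ times the discrepancy for the shifted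
sequence. Iterating makes it divisible by every power of ħ, and separatedness concludes. -/
theorem hSum_mul_hSum [HComplete T] (f g : ℕ → T) :
    hSum f * hSum g = hSum fun n => ∑ p ∈ Finset.HasAntidiagonal.antidiagonal n, f p.1 * g p.2 := by
  have step : ∀ f : ℕ → T,
      hSum f * hSum g - hSum (fun n => ∑ p ∈ Finset.HasAntidiagonal.antidiagonal n, f p.1 * g p.2) =
      ħ • (hSum (fun n => f (n + 1)) * hSum g -
        hSum fun n => ∑ p ∈ Finset.HasAntidiagonal.antidiagonal n, f (p.1 + 1) * g p.2) := by
    intro f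
    have h1 : hSum (fun n => ∑ p ∈ Finset.HasAntidiagonal.antidiagonal n, f p.1 * g p.2) =
        f 0 * hSum g + ħ • hSum fun n => ∑ p ∈ Finset.HasAntidiagonal.antidiagonal n, f (p.1 + 1) * g p.2 := by
      rw [hSum_succ g, hSum_succ (fun n => ∑ p ∈ Finset.HasAntidiagonal.antidiagonal n, f p.1 * g p.2)]
      simp only [Finset.Nat.sum_antidiagonal_succ]
      rw [← hSum_add, ← mul_hSum]
      simp only [Finset.Nat.antidiagonal_zero, Finset.sum_singleton, mul_add, smul_add,
        mul_smul_comm]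
      abel
    rw [h1]
    conv_lhs => rw [hSum_succ f]
    rw [add_mul, smul_sub, smul_mul_assoc]
    abel
  refine HComplete.eq_of_forall fun n => ?_
  have key : ∀ n : ℕ, ∀ f : ℕ → T, ∃ z : T,
      hSum f * hSum g - hSum (fun n => ∑ p ∈ Finset.HasAntidiagonal.antidiagonal n, f p.1 * g p.2) = ħ ^ n • z := by
    intro n
    induction n with
    | zero => exact fun f => ⟨_, by rw [pow_zero, one_smul]⟩
    | succ n ih =>
      intro f
      obtain ⟨z, hz⟩ := ih fun n => f (n + 1)
      exact ⟨z, by rw [step, hz, ← mul_smul, ← pow_succ']⟩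
  obtain ⟨z, hz⟩ := key n f
  exact ⟨z, by rw [← hz]; abel⟩

theorem hSum_eq_sum [HComplete T] (f : ℕ → T) (N : ℕ) (h : ∀ n, N ≤ n → f n = 0) :
    hSum f = ∑ i ∈ Finset.range N, ħ ^ i • f i := by
  symm
  refine eq_hSum fun n => ?_
  rcases le_total n N with hn | hn
  · refine ⟨∑ i ∈ Finset.range (N - n), ħ ^ i • f (n + i), ?_⟩
    obtain ⟨m, rfl⟩ := Nat.exists_eq_add_of_le hn
    rw [Finset.sum_range_add, Finset.smul_sum, Nat.add_sub_cancel_left]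
    simp only [← mul_smul, ← pow_add]
  · refine ⟨0, ?_⟩
    obtain ⟨m, rfl⟩ := Nat.exists_eq_add_of_le hn
    rw [Finset.sum_range_add, smul_zero, add_zero, left_eq_add]
    exact Finset.sum_eq_zero fun i _ => by rw [h _ (Nat.le_add_right _ _), smul_zero]

end Series

/-! ## Complete algebras -/

section PowerSeriesComplete

variable {B : Type} [Ring B] [Algebra HRing (PowerSeries B)]

/-- The hypothesis `h` is all that is needed about the scalar action. In this form the results apply
to ℝ⟦ħ⟧ itself, to the free series and to U(gl(2))⟦ħ⟧. -/
theorem pow_smul_powerSeries (h : ∀ f : PowerSeries B, ħ • f = PowerSeries.X * f) (n : ℕ)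
    (f : PowerSeries B) : ħ ^ n • f = PowerSeries.X ^ n * f := by
  induction n with
  | zero => simp
  | succ n ih => rw [pow_succ', mul_smul, ih, h, ← mul_assoc, ← pow_succ']

theorem powerSeries_eq_sum (h : ∀ f : PowerSeries B, ħ • f = PowerSeries.X * f)
    (f : ℕ → PowerSeries B) (n : ℕ) : ∃ y : PowerSeries B,
    (PowerSeries.mk fun k => ∑ p ∈ Finset.HasAntidiagonal.antidiagonal k, PowerSeries.coeff p.2 (f p.1)) =
      ∑ i ∈ Finset.range n, ħ ^ i • f i + ħ ^ n • y := by
  induction n generalizing f with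
  | zero => exact ⟨_, by rw [Finset.sum_range_zero, pow_zero, one_smul, zero_add]⟩
  | succ n ih =>
    obtain ⟨y, hy⟩ := ih fun n => f (n + 1)
    refine ⟨y, ?_⟩
    have h1 : (PowerSeries.mk fun k => ∑ p ∈ Finset.HasAntidiagonal.antidiagonal k, PowerSeries.coeff p.2 (f p.1)) =
      f 0 + ħ • PowerSeries.mk fun k =>
        ∑ p ∈ Finset.HasAntidiagonal.antidiagonal k, PowerSeries.coeff p.2 (f (p.1 + 1)) := by
      ext k
      rw [h, map_add]
      cases k with
      | zero => simp
      | succ k =>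
        rw [PowerSeries.coeff_succ_X_mul]
        simp [Finset.Nat.sum_antidiagonal_succ]
    rw [h1, hy, Finset.sum_range_succ', smul_add, Finset.smul_sum]
    simp only [← mul_smul, ← pow_succ', pow_zero, one_smul]
    abel

theorem hComplete_powerSeries (h : ∀ f : PowerSeries B, ħ • f = PowerSeries.X * f) :
    HComplete (PowerSeries B) where
  sep x hx := by
    ext n
    obtain ⟨y, rfl⟩ := hx (n + 1)
    rw [pow_smul_powerSeries h, PowerSeries.coeff_X_pow_mul', if_neg (by omega), map_zero]
  sum f := ⟨_, powerSeries_eq_sum h f⟩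

theorem hTorsionFree_powerSeries (h : ∀ f : PowerSeries B, ħ • f = PowerSeries.X * f) :
    HTorsionFree (PowerSeries B) :=
  ⟨fun x hx => by
    ext n
    rw [h] at hx
    rw [← PowerSeries.coeff_succ_X_mul n x, hx, map_zero, map_zero]⟩

theorem eq_hSum_coeff [HComplete (PowerSeries B)]
    (h : ∀ f : PowerSeries B, ħ • f = PowerSeries.X * f) (f : PowerSeries B) :
    f = hSum fun n => PowerSeries.C (PowerSeries.coeff n f) := by
  refine eq_hSum fun n => ?_
  obtain ⟨y, hy⟩ := powerSeries_eq_sum h (fun n => PowerSeries.C (PowerSeries.coeff n f)) n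
  refine ⟨y, ?_⟩
  rw [← hy]
  ext k
  rw [PowerSeries.coeff_mk, Finset.sum_eq_single (k, 0)]
  · simp
  · rintro ⟨i, j⟩ hij hne
    rw [PowerSeries.coeff_C, if_neg]
    rintro rfl
    simp at hij hne
    exact hne hij
  · simp

end PowerSeriesComplete

instance HRing.hComplete : HComplete HRing := hComplete_powerSeries fun _ => rfl

instance HRing.hTorsionFree : HTorsionFree HRing := hTorsionFree_powerSeries fun _ => rfl

theorem FreeSeries.X_smul {ι : Type} (f : FreeSeries ι) : ħ • f = PowerSeries.X * f := by
  rw [Algebra.smul_def]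
  congr 1
  exact PowerSeries.map_X _

instance FreeSeries.hComplete (ι : Type) : HComplete (FreeSeries ι) :=
  hComplete_powerSeries FreeSeries.X_smul

theorem FreeSeries.C_smul {ι : Type} (t : ℝ) (f : FreeSeries ι) :
    (PowerSeries.C t : HRing) • f = t • f := by
  rw [Algebra.smul_def]
  change PowerSeries.map _ (PowerSeries.C t) * f = _
  rw [PowerSeries.map_C]
  ext n
  rw [PowerSeries.coeff_C_mul, PowerSeries.coeff_smul, Algebra.smul_def]

/-- The antipode is built from an algebra homomorphism into the opposite algebra, which must be
complete for the universal property to apply. -/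
instance MulOpposite.hComplete (T : Type) [Ring T] [Algebra HRing T] [HComplete T] :
    HComplete Tᵐᵒᵖ where
  sep x hx := MulOpposite.unop_injective (HComplete.sep _ fun n => by
    obtain ⟨y, rfl⟩ := hx n
    exact ⟨y.unop, rfl⟩)
  sum f := by
    obtain ⟨s, hs⟩ := HComplete.sum fun n => (f n).unop
    refine ⟨MulOpposite.op s, fun n => ?_⟩
    obtain ⟨y, hy⟩ := hs n
    exact ⟨MulOpposite.op y, by rw [hy]; simp⟩

instance MulOpposite.hTorsionFree (T : Type) [Ring T] [Algebra HRing T] [HTorsionFree T] :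
    HTorsionFree Tᵐᵒᵖ :=
  ⟨fun x hx => MulOpposite.unop_injective
    (HTorsionFree.eq_zero _ (by rw [← MulOpposite.unop_smul, hx, MulOpposite.unop_zero]))⟩

/-! ### Completeness and torsion-freeness of ħ-adic completions -/

section HComplComplete

variable (B : Type) [Ring B] [Algebra HRing B]

variable {B} in
theorem HCompl.smul_val_eq_zero {n k : ℕ} (h : n ≤ k) (z : HCompl B) :
    (ħ ^ k • z).1 n = 0 := by
  obtain ⟨b, hb⟩ := hMk_surjective n (z.1 n)
  change ħ ^ k • z.1 n = 0
  rw [← hb, ← map_smul]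
  obtain ⟨m, rfl⟩ := Nat.exists_eq_add_of_le h
  exact Ideal.Quotient.eq_zero_iff_mem.2 ⟨ħ ^ m • b, by rw [← mul_smul, ← pow_add]⟩

variable {B} in
theorem HCompl.ext_val {z w : HCompl B} (h : ∀ n, z.1 n = w.1 n) : z = w :=
  Subtype.ext (funext h)

variable {B} in
theorem HCompl.sum_val {n N k : ℕ} (h1 : n ≤ N) (h2 : n ≤ k) (f : ℕ → HCompl B) :
    (∑ i ∈ Finset.range N, ħ ^ i • f i).1 n = (∑ i ∈ Finset.range k, ħ ^ i • f i).1 n := by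
  have key : ∀ m, (∑ i ∈ Finset.range (n + m), ħ ^ i • f i).1 n =
      (∑ i ∈ Finset.range n, ħ ^ i • f i).1 n := by
    intro m
    induction m with
    | zero => rfl
    | succ m ih =>
      rw [← add_assoc, Finset.sum_range_succ]
      change _ + (ħ ^ (n + m) • f (n + m)).1 n = _
      rw [HCompl.smul_val_eq_zero (Nat.le_add_right _ _), add_zero, ih]
  obtain ⟨m, rfl⟩ := Nat.exists_eq_add_of_le h1
  obtain ⟨m', rfl⟩ := Nat.exists_eq_add_of_le h2
  rw [key, key]

variable {B} in
/-- The sum of a series in the completion. -/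
def HCompl.series (f : ℕ → HCompl B) : HCompl B :=
  ⟨fun n => (∑ i ∈ Finset.range n, ħ ^ i • f i).1 n, fun n => by
    rw [(∑ i ∈ Finset.range (n + 1), ħ ^ i • f i).2 n]
    exact HCompl.sum_val (Nat.le_succ n) le_rfl f⟩

instance HCompl.hComplete : HComplete (HCompl B) where
  sep x hx := HCompl.ext_val fun n => by
    obtain ⟨y, rfl⟩ := hx n
    exact HCompl.smul_val_eq_zero le_rfl y
  sum f := by
    refine ⟨HCompl.series f, fun n => ⟨HCompl.series fun k => f (n + k), ?_⟩⟩
    refine HCompl.ext_val fun k => ?_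
    have h : ħ ^ n • ∑ i ∈ Finset.range k, ħ ^ i • f (n + i) =
        ∑ i ∈ Finset.range k, ħ ^ (n + i) • f (n + i) := by
      rw [Finset.smul_sum]
      simp only [← mul_smul, ← pow_add]
    change (∑ i ∈ Finset.range k, ħ ^ i • f i).1 k = (∑ i ∈ Finset.range n, ħ ^ i • f i).1 k +
      (ħ ^ n • ∑ i ∈ Finset.range k, ħ ^ i • f (n + i)).1 k
    rw [h]
    change _ = (∑ i ∈ Finset.range n, ħ ^ i • f i +
      ∑ i ∈ Finset.range k, ħ ^ (n + i) • f (n + i)).1 k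
    rw [← Finset.sum_range_add (fun i => ħ ^ i • f i) n k]
    exact HCompl.sum_val le_rfl (Nat.le_add_left _ _) f

instance HCompl.hTorsionFree [HTorsionFree B] : HTorsionFree (HCompl B) :=
  ⟨fun z hz => HCompl.ext_val fun n => by
    rw [← z.2 n]
    -- The representative is taken one level higher, because cancelling ħ loses one order of
    -- precision.
    obtain ⟨b, hb⟩ := hMk_surjective (n + 1) (z.1 (n + 1))
    have h1 : hMk B (n + 1) (ħ • b) = 0 := by
      rw [map_smul, hb]
      exact congrArg (fun w : HCompl B => w.1 (n + 1)) hz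
    obtain ⟨y, hy⟩ := Ideal.Quotient.eq_zero_iff_mem.1 h1
    have h2 : b = ħ ^ n • y := HTorsionFree.cancel (by rw [← hy, ← mul_smul, ← pow_succ'])
    rw [← hb]
    exact Ideal.Quotient.eq_zero_iff_mem.2 ⟨y, h2.symm⟩⟩

end HComplComplete

/-- A product of algebras without torsion over the principal ideal domain `ℝ⟦ħ⟧` is torsion-free. -/
instance TensorProduct.hTorsionFree (A B : Type) [Ring A] [Algebra HRing A] [Ring B]
    [Algebra HRing B] [HTorsionFree A] [HTorsionFree B] : HTorsionFree (A ⊗[HRing] B) := by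
  -- A nonzero power series is a power of ħ times a unit, so absence of ħ-torsion is absence of all
  -- torsion. Over a principal ideal domain this gives flatness.
  have tf : Module.IsTorsionFree HRing A := by
    refine ⟨fun c hc x y hxy => ?_⟩
    have hc0 : c ≠ 0 := hc.ne_zero
    have h1 : c • (x - y) = 0 := by
      rw [smul_sub, sub_eq_zero]
      exact hxy
    have h2 : ∀ (n : ℕ) (w : A), ħ ^ n • w = 0 → w = 0 := by
      intro n
      induction n with
      | zero => exact fun w hw => by rwa [pow_zero, one_smul] at hw
      | succ n ih => exact fun w hw => ih w (HTorsionFree.eq_zero _ (by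
          rwa [← mul_smul, ← pow_succ']))
    rw [← sub_eq_zero]
    refine h2 c.order.toNat _ ?_
    rw [← PowerSeries.X_pow_order_mul_divXPowOrder (f := c), mul_comm, mul_smul] at h1
    have h3 := congrArg (fun w => PowerSeries.Inv_divided_by_X_pow_order hc0 • w) h1
    simpa only [← mul_smul, ← mul_assoc, PowerSeries.Inv_divided_by_X_pow_order_leftInv, one_mul,
      smul_zero] using h3
  have : Module.Flat HRing A := inferInstance
  refine ⟨fun z hz => ?_⟩
  -- Multiplication by ħ is injective on `B`, and tensoring with the flat module `A` keeps it
  -- injective.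
  have hinj : Function.Injective (LinearMap.lsmul HRing B ħ) := fun x y hxy =>
    HTorsionFree.cancel hxy
  have := Module.Flat.lTensor_preserves_injective_linearMap (M := A) _ hinj
  refine this ?_
  rw [map_zero, ← hz]
  have h2 : LinearMap.lTensor A (LinearMap.lsmul HRing B ħ) =
      LinearMap.lsmul HRing (A ⊗[HRing] B) ħ := by
    ext a b
    simp
  rw [h2]
  rfl

/-! ## Evaluation of power series in the generators -/

section Eval

variable {T : Type} [Ring T] [Algebra HRing T] {T' : Type} [Ring T'] [Algebra HRing T']
  {ι : Type}

/-- The evaluation of a noncommutative polynomial with real coefficients. -/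
def evalFree (v : ι → T) : FreeAlgebra ℝ ι →+* T :=
  -- The reals act through constant power series. The structure stays local, so that statements only
  -- involve scalars from ℝ⟦ħ⟧.
  letI : Algebra ℝ T := Algebra.compHom T (PowerSeries.C : ℝ →+* HRing)
  (FreeAlgebra.lift ℝ v).toRingHom

theorem evalFree_ι (v : ι → T) (i : ι) : evalFree v (FreeAlgebra.ι ℝ i) = v i :=
  letI : Algebra ℝ T := Algebra.compHom T (PowerSeries.C : ℝ →+* HRing)
  FreeAlgebra.lift_ι_apply v i

theorem evalFree_algebraMap (v : ι → T) (c : ℝ) :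
    evalFree v (algebraMap ℝ _ c) = algebraMap HRing T (PowerSeries.C c) :=
  letI : Algebra ℝ T := Algebra.compHom T (PowerSeries.C : ℝ →+* HRing)
  (FreeAlgebra.lift ℝ v).commutes c

theorem evalFree_smul (v : ι → T) (c : ℝ) (x : FreeAlgebra ℝ ι) :
    evalFree v (c • x) = (PowerSeries.C c : HRing) • evalFree v x := by
  rw [Algebra.smul_def, map_mul, evalFree_algebraMap, ← Algebra.smul_def]

theorem algebraMap_eq_hSum [HComplete T] (c : HRing) : algebraMap HRing T c =
    hSum fun n => algebraMap HRing T (PowerSeries.C (PowerSeries.coeff n c)) := by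
  conv_lhs => rw [eq_hSum_coeff (B := ℝ) (fun _ => rfl) c]
  exact map_hSum (Algebra.linearMap HRing T) _

/-- The evaluation of a power series whose coefficients are noncommutative polynomials. -/
def evalSeries [HComplete T] (v : ι → T) : FreeSeries ι →ₐ[HRing] T where
  toFun f := hSum fun n => evalFree v (PowerSeries.coeff n f)
  map_one' := by
    rw [← map_one (algebraMap HRing T), algebraMap_eq_hSum]
    congr 1
    funext n
    rw [PowerSeries.coeff_one, PowerSeries.coeff_one]
    split_ifs <;> simp
  map_mul' f g := by
    rw [hSum_mul_hSum]
    congr 1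
    funext n
    rw [PowerSeries.coeff_mul, map_sum]
    simp only [map_mul]
  map_zero' := by
    rw [← map_zero (algebraMap HRing T), algebraMap_eq_hSum]
    congr 1
    funext n
    simp
  map_add' f g := by
    rw [hSum_add]
    congr 1
    funext n
    rw [map_add, map_add]
  commutes' c := by
    rw [algebraMap_eq_hSum (T := T)]
    congr 1
    funext n
    rw [← evalFree_algebraMap v]
    congr 1

theorem evalSeries_apply [HComplete T] (v : ι → T) (f : FreeSeries ι) :
    evalSeries v f = hSum fun n => evalFree v (PowerSeries.coeff n f) := rfl

theorem evalSeries_C [HComplete T] (v : ι → T) (x : FreeAlgebra ℝ ι) :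
    evalSeries v (PowerSeries.C x) = evalFree v x := by
  rw [evalSeries_apply, hSum_eq_sum _ 1]
  · simp
  · intro n hn
    rw [PowerSeries.coeff_C, if_neg (by omega), map_zero]

theorem evalSeries_fgen [HComplete T] (v : ι → T) (i : ι) : evalSeries v (fgen i) = v i := by
  rw [fgen, evalSeries_C, evalFree_ι]

theorem evalSeries_smul [HComplete T] (v : ι → T) (c : ℝ) (f : FreeSeries ι) :
    evalSeries v (c • f) = (PowerSeries.C c : HRing) • evalSeries v f := by
  rw [← FreeSeries.C_smul, map_smul]

/-- Two linear maps on power series in the generators, with values in a complete algebra,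
agree if they agree on polynomials. -/
theorem FreeSeries.linearMap_ext [HComplete T] {f g : FreeSeries ι →ₗ[HRing] T}
    (h : ∀ x : FreeAlgebra ℝ ι, f (PowerSeries.C x) = g (PowerSeries.C x)) : f = g := by
  ext x
  rw [eq_hSum_coeff FreeSeries.X_smul x, map_hSum, map_hSum]
  simp only [h]

theorem FreeSeries.algHom_ext [HComplete T] {f g : FreeSeries ι →ₐ[HRing] T}
    (h : ∀ i, f (fgen i) = g (fgen i)) : f = g := by
  have h1 : f.toLinearMap = g.toLinearMap := by
    refine FreeSeries.linearMap_ext fun x => ?_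
    change f (PowerSeries.C x) = g (PowerSeries.C x)
    induction x using FreeAlgebra.induction with
    | grade0 r =>
      have h2 : PowerSeries.C (algebraMap ℝ (FreeAlgebra ℝ ι) r) =
          algebraMap HRing (FreeSeries ι) (PowerSeries.C r) :=
        (PowerSeries.map_C (algebraMap ℝ (FreeAlgebra ℝ ι)) r).symm
      rw [h2, AlgHom.commutes, AlgHom.commutes]
    | grade1 i => exact h i
    | mul x y hx hy => rw [map_mul, map_mul, map_mul, hx, hy]
    | add x y hx hy => rw [map_add, map_add, map_add, hx, hy]
  exact AlgHom.ext fun x => LinearMap.congr_fun h1 x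

end Eval

/-! ## Presented algebras -/

namespace PresentedAlg

variable {T : Type} [Ring T] [Algebra HRing T] {ι : Type} {rels : Set (FreeSeries ι)}

theorem mk_surjective : Function.Surjective (mk rels) := Ideal.Quotient.mkₐ_surjective HRing _

theorem mk_eq_zero_iff (f : FreeSeries ι) : mk rels f = 0 ↔ ∀ n : ℕ, f ∈ TwoSidedIdeal.span
    (rels ∪ {algebraMap HRing (FreeSeries ι) (PowerSeries.X ^ n)}) := by
  refine Ideal.Quotient.eq_zero_iff_mem.trans ?_
  rw [relIdeal, Ideal.mem_iInf]
  rfl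

theorem mk_rel {f : FreeSeries ι} (h : f ∈ rels) : mk rels f = 0 :=
  (mk_eq_zero_iff f).2 fun _ => TwoSidedIdeal.subset_span (Or.inl h)

/-- Separatedness is what taking the closed ideal provides: a class divisible by ħⁿ lies in the n-th
of the intersected ideals, which contains ħⁿ. Series are summed by lifting their terms to the free
algebra. -/
instance hComplete : HComplete (PresentedAlg rels) where
  sep x hx := by
    obtain ⟨f, rfl⟩ := mk_surjective x
    rw [mk_eq_zero_iff]
    intro n
    obtain ⟨y, hy⟩ := hx n
    obtain ⟨g, rfl⟩ := mk_surjective y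
    rw [← map_smul, ← sub_eq_zero, ← map_sub] at hy
    rw [← sub_add_cancel f (ħ ^ n • g)]
    refine TwoSidedIdeal.add_mem _ ((mk_eq_zero_iff _).1 hy n) ?_
    rw [Algebra.smul_def]
    exact TwoSidedIdeal.mul_mem_right _ _ _ (TwoSidedIdeal.subset_span (Or.inr rfl))
  sum f := by
    choose g hg using fun n => mk_surjective (rels := rels) (f n)
    refine ⟨mk rels (hSum g), fun n => ?_⟩
    obtain ⟨y, hy⟩ := hSum_spec g n
    refine ⟨mk rels y, ?_⟩
    rw [hy]
    simp only [map_add, map_sum, map_smul, hg]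

/-- The universal property of a presented algebra. -/
def lift [HComplete T] (v : ι → T) (h : ∀ f ∈ rels, evalSeries v f = 0) :
    PresentedAlg rels →ₐ[HRing] T :=
  Ideal.Quotient.liftₐ _ (evalSeries v) (by
    intro f hf
    refine HComplete.sep _ fun n => ?_
    have h1 := (mk_eq_zero_iff f).1 (Ideal.Quotient.eq_zero_iff_mem.2 hf) n
    -- Modulo ħⁿ the evaluation kills the relations as well as ħⁿ itself, hence the whole n-th
    -- ideal. Thus the value is divisible by ħⁿ for all n.
    have h2 : TwoSidedIdeal.span (rels ∪ {algebraMap HRing (FreeSeries ι) (PowerSeries.X ^ n)}) ≤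
        TwoSidedIdeal.ker ((hMk T n).comp (evalSeries v)) := by
      rw [TwoSidedIdeal.span_le]
      rintro g (hg | rfl)
      · refine (TwoSidedIdeal.mem_ker _).2 ?_
        rw [AlgHom.comp_apply, h g hg, map_zero]
      · refine (TwoSidedIdeal.mem_ker _).2 ?_
        rw [AlgHom.commutes]
        exact Ideal.Quotient.eq_zero_iff_mem.2 ⟨1, by rw [Algebra.smul_def, mul_one]⟩
    have h3 : hMk T n (evalSeries v f) = 0 := (TwoSidedIdeal.mem_ker ((hMk T n).comp (evalSeries v))).1 (h2 h1)
    obtain ⟨y, hy⟩ := Ideal.Quotient.eq_zero_iff_mem.1 h3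
    exact ⟨y, hy.symm⟩)

theorem lift_mk [HComplete T] (v : ι → T) (h : ∀ f ∈ rels, evalSeries v f = 0)
    (f : FreeSeries ι) : lift v h (mk rels f) = evalSeries v f := rfl

theorem lift_gen [HComplete T] (v : ι → T) (h : ∀ f ∈ rels, evalSeries v f = 0) (i : ι) :
    lift v h (gen rels i) = v i :=
  evalSeries_fgen v i

theorem map_mk [HComplete T] (g : PresentedAlg rels →ₐ[HRing] T) (f : FreeSeries ι) :
    g (mk rels f) = evalSeries (fun i => g (gen rels i)) f := by
  have : g.comp (mk rels) = evalSeries fun i => g (gen rels i) :=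
    FreeSeries.algHom_ext fun i => by rw [evalSeries_fgen]; rfl
  exact AlgHom.congr_fun this f

theorem mk_eq_evalSeries (f : FreeSeries ι) : mk rels f = evalSeries (gen rels) f :=
  map_mk (AlgHom.id HRing (PresentedAlg rels)) f

theorem algHom_ext [HComplete T] {f g : PresentedAlg rels →ₐ[HRing] T}
    (h : ∀ i, f (gen rels i) = g (gen rels i)) : f = g := by
  refine AlgHom.ext fun x => ?_
  obtain ⟨y, rfl⟩ := mk_surjective x
  rw [map_mk, map_mk]
  simp only [h]

/-- An induction principle: linear maps into a complete algebra agree if they agree on the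
generators and the set on which they agree contains the scalars and is closed under products. -/
theorem linearMap_ext [HComplete T] {f g : PresentedAlg rels →ₗ[HRing] T}
    (hone : f 1 = g 1) (hgen : ∀ i, f (gen rels i) = g (gen rels i))
    (hmul : ∀ x y, f x = g x → f y = g y → f (x * y) = g (x * y)) : f = g := by
  have h1 : f ∘ₗ (mk rels).toLinearMap = g ∘ₗ (mk rels).toLinearMap := by
    refine FreeSeries.linearMap_ext fun x => ?_
    change f (mk rels (PowerSeries.C x)) = g (mk rels (PowerSeries.C x))
    induction x using FreeAlgebra.induction with
    | grade0 r =>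
      have h2 : PowerSeries.C (algebraMap ℝ (FreeAlgebra ℝ ι) r) =
          algebraMap HRing (FreeSeries ι) (PowerSeries.C r) :=
        (PowerSeries.map_C (algebraMap ℝ (FreeAlgebra ℝ ι)) r).symm
      rw [h2, AlgHom.commutes, Algebra.algebraMap_eq_smul_one, map_smul, map_smul, hone]
    | grade1 i => exact hgen i
    | mul x y hx hy => rw [map_mul, map_mul]; exact hmul _ _ hx hy
    | add x y hx hy => rw [map_add, map_add, map_add, map_add, hx, hy]
  refine LinearMap.ext fun x => ?_
  obtain ⟨y, rfl⟩ := mk_surjective x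
  exact LinearMap.congr_fun h1 y

theorem mem_center_of_commute_gen {c : PresentedAlg rels}
    (h : ∀ i, gen rels i * c = c * gen rels i) : c ∈ Subalgebra.center HRing (PresentedAlg rels) := by
  rw [Subalgebra.mem_center_iff]
  intro x
  have : LinearMap.mulRight HRing c = LinearMap.mulLeft HRing c := by
    refine linearMap_ext (by simp) h fun x y hx hy => ?_
    simp only [LinearMap.mulRight_apply, LinearMap.mulLeft_apply] at *
    rw [mul_assoc, hy, ← mul_assoc, hx, mul_assoc]
  exact LinearMap.congr_fun this x

/-- A presented algebra is generated by its generators modulo `ħ`. -/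
theorem exists_eq_mk_C_add (f : FreeSeries ι) : ∃ y, mk rels f =
    mk rels (PowerSeries.C (PowerSeries.constantCoeff f)) + ħ • y := by
  refine ⟨mk rels (PowerSeries.mk fun n => PowerSeries.coeff (n + 1) f), ?_⟩
  rw [← map_smul, ← map_add, FreeSeries.X_smul, add_comm, ← PowerSeries.eq_X_mul_shift_add_const f]

end PresentedAlg

/-! ## Exponentials -/

section Exp

variable {T : Type} [Ring T] [Algebra HRing T] [HComplete T]
  {T' : Type} [Ring T'] [Algebra HRing T'] [HComplete T']

/-- The exponential `e^{tħx}`. -/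
def tExp (t : ℝ) (x : T) : T :=
  hSum fun n => (PowerSeries.C (t ^ n / (n.factorial : ℝ)) : HRing) • x ^ n

theorem evalSeries_hExp {ι : Type} (v : ι → T) (t : ℝ) (x : FreeAlgebra ℝ ι) :
    evalSeries v (hExp t x) = tExp t (evalFree v x) := by
  rw [evalSeries_apply, tExp]
  congr 1
  ext n
  rw [hExp, PowerSeries.coeff_mk, evalFree_smul, map_pow]

theorem hExp_one (t : ℝ) : (hExp t (1 : ℝ) : HRing) = tExp t (1 : HRing) := by
  rw [eq_hSum_coeff (B := ℝ) (fun _ => rfl) (hExp t (1 : ℝ)), tExp]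
  congr 1
  ext n : 1
  rw [hExp, PowerSeries.coeff_mk, one_pow, one_pow, smul_eq_mul, smul_eq_mul, mul_one, mul_one]

theorem map_tExp (g : T →ₐ[HRing] T') (t : ℝ) (x : T) : g (tExp t x) = tExp t (g x) := by
  refine (map_hSum g.toLinearMap _).trans ?_
  simp [tExp]

theorem tExp_op (t : ℝ) (x : T) : tExp t (MulOpposite.op x) = MulOpposite.op (tExp t x) := by
  refine Eq.symm ((map_hSum (MulOpposite.opLinearEquiv HRing : T ≃ₗ[HRing] Tᵐᵒᵖ).toLinearMap
    _).trans ?_)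
  simp [tExp]

theorem tExp_algebraMap (t : ℝ) (c : HRing) :
    tExp t (algebraMap HRing T c) = algebraMap HRing T (tExp t c) :=
  (map_tExp (Algebra.ofId HRing T) t c).symm

theorem tExp_smul (t s : ℝ) (x : T) : tExp t ((PowerSeries.C s : HRing) • x) = tExp (t * s) x := by
  rw [tExp, tExp]
  congr 1
  ext n
  rw [smul_pow, ← mul_smul, ← map_pow, ← map_mul]
  congr 2
  ring

theorem tExp_neg (t : ℝ) (x : T) : tExp t (-x) = tExp (-t) x := by
  have := tExp_smul t (-1) x
  rwa [map_neg, map_one, neg_smul, one_smul, mul_neg_one] at this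

theorem tExp_zero (x : T) : tExp 0 x = 1 := by
  rw [tExp, hSum_eq_sum _ 1]
  · simp
  · intro n hn
    rw [zero_pow (by omega), zero_div, map_zero, zero_smul]

theorem tExp_add {x y : T} (h : Commute x y) (t : ℝ) :
    tExp t (x + y) = tExp t x * tExp t y := by
  rw [tExp, tExp, tExp, hSum_mul_hSum]
  congr 1
  ext n
  rw [h.add_pow', Finset.smul_sum]
  refine Finset.sum_congr rfl fun p hp => ?_
  obtain ⟨i, j⟩ := p
  rw [Finset.HasAntidiagonal.mem_antidiagonal] at hp
  subst hp
  rw [smul_mul_smul_comm, ← map_mul, ← Nat.cast_smul_eq_nsmul HRing, ← mul_smul]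
  congr 1
  rw [← map_natCast (PowerSeries.C : ℝ →+* HRing), ← map_mul]
  congr 1
  simp only
  have h1 := Nat.add_choose_mul_factorial_mul_factorial i j
  have h2 : (((i + j).choose i : ℝ)) * i.factorial * j.factorial = (i + j).factorial := by
    rw [Nat.choose_symm_add]
    exact_mod_cast h1
  have := Nat.factorial_ne_zero i
  have := Nat.factorial_ne_zero j
  have := Nat.factorial_ne_zero (i + j)
  field_simp
  rw [← h2]
  ring

theorem tExp_mul_tExp (s t : ℝ) (x : T) : tExp s x * tExp t x = tExp (s + t) x := by
  have h := tExp_add (x := (PowerSeries.C s : HRing) • x) (y := (PowerSeries.C t : HRing) • x)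
    (((Commute.refl x).smul_left _).smul_right _) 1
  rwa [← add_smul, ← map_add, tExp_smul, tExp_smul, tExp_smul, one_mul, one_mul, one_mul,
    eq_comm] at h

/-- Two different exponents are allowed so that a weight vector can be moved past an exponential,
which shifts the exponent by a scalar. -/
theorem tExp_intertwine {x y p : T} (h : x * p = p * y) (t : ℝ) :
    tExp t x * p = p * tExp t y := by
  rw [tExp, tExp, hSum_mul, mul_hSum]
  congr 1
  ext n
  rw [smul_mul_assoc, mul_smul_comm]
  congr 1
  induction n with
  | zero => simp
  | succ n ih => rw [pow_succ, mul_assoc, h, ← mul_assoc, ih, mul_assoc, ← pow_succ]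

theorem tExp_commute {x p : T} (h : Commute x p) (t : ℝ) : Commute (tExp t x) p :=
  tExp_intertwine h t

/-- If `[x, p] = 2 s p`, then `e^{tħx} p = e^{2tsħ} p e^{tħx}`. -/
theorem tExp_mul_of_weight {x p : T} (s : ℝ)
    (h : x * p - p * x = (PowerSeries.C s : HRing) • p) (t : ℝ) :
    tExp t x * p = tExp (t * s) (1 : HRing) • (p * tExp t x) := by
  -- Moving p to the left of x shifts x by the scalar s. This scalar is central, so its exponential
  -- splits off.
  have h1 : x * p = p * (x + algebraMap HRing T (PowerSeries.C s)) := by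
    rw [mul_add, ← Algebra.commutes, ← Algebra.smul_def, ← h]
    abel
  rw [tExp_intertwine h1, tExp_add (Algebra.commutes _ _).symm, tExp_algebraMap, ← Algebra.commutes,
    ← Algebra.smul_def, mul_smul_comm]
  congr 1
  rw [← tExp_smul, smul_eq_mul, mul_one]

end Exp

/-! ## The relations of the quantum algebra -/

section Triples

attribute [local instance 2000] Semiring.toNatAlgebra Ring.toIntAlgebra
set_option linter.unusedSectionVars false

variable {T : Type} [Ring T] [Algebra HRing T] [HComplete T]

/-- The deformed relations among three elements of an algebra, with `s = sinh(aj/2)/(a/2)` and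
`f = sinh(aj)/a`. -/
structure IsQTriple (ap a : ℝ) (j p m s f : T) : Prop where
  half : (ħ * PowerSeries.C a) • s = tExp (a / 2) j - tExp (-(a / 2)) j
  full : (ħ * PowerSeries.C (2 * a)) • f = tExp a j - tExp (-a) j
  jp : j * p - p * j = (2 : HRing) • p
  jm : j * m - m * j = -((2 : HRing) • m) - (PowerSeries.C (ap / a) : HRing) • s -
    (PowerSeries.C (ap / a) ^ 2 : HRing) • p
  pm : p * m - m * p = f + (PowerSeries.C (ap / a) : HRing) • qScalar a •
    (tExp (-(a / 2)) j * p + p * tExp (a / 2) j)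

/-- The Drinfeld-Jimbo relations of the quantum `sl(2)`. -/
structure IsDJTriple (a : ℝ) (j p n f : T) : Prop where
  full : (ħ * PowerSeries.C (2 * a)) • f = tExp a j - tExp (-a) j
  jp : j * p - p * j = (2 : HRing) • p
  jn : j * n - n * j = -((2 : HRing) • n)
  pn : p * n - n * p = f

theorem X_mul_qScalar (a : ℝ) (ha : a ≠ 0) :
    ħ * PowerSeries.C (2 * a) * qScalar a = tExp a (1 : HRing) - 1 := by
  rw [← hExp_one]
  ext n
  rw [qScalar, mul_assoc]
  cases n with
  | zero => simp [hExp]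
  | succ n =>
    rw [PowerSeries.coeff_succ_X_mul, PowerSeries.coeff_C_mul, PowerSeries.coeff_smul, hDiv,
      PowerSeries.coeff_mk, smul_eq_mul, ← mul_assoc]
    field_simp

theorem FreeSeries.X_smul_hDiv {ι : Type} (f : FreeSeries ι) (h : PowerSeries.constantCoeff f = 0) :
    ħ • hDiv f = f := by
  ext n
  rw [FreeSeries.X_smul]
  cases n with
  | zero => simp [h]
  | succ n => rw [PowerSeries.coeff_succ_X_mul, hDiv, PowerSeries.coeff_mk]

theorem constantCoeff_hSinh {B : Type} [Ring B] [Algebra ℝ B] (t : ℝ) (x : B) :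
    PowerSeries.constantCoeff (hSinh t x) = 0 := by
  rw [← PowerSeries.coeff_zero_eq_constantCoeff_apply]
  simp [hSinh, hExp, -PowerSeries.coeff_zero_eq_constantCoeff]

theorem constantCoeff_hCosh_sub_one {B : Type} [Ring B] [Algebra ℝ B] (t : ℝ) (x : B) :
    PowerSeries.constantCoeff (hCosh t x - 1) = 0 := by
  rw [← PowerSeries.coeff_zero_eq_constantCoeff_apply]
  simp only [hCosh, hExp, map_sub, PowerSeries.coeff_smul, map_add, PowerSeries.coeff_mk,
    PowerSeries.coeff_zero_one, pow_zero, Nat.factorial_zero, Nat.cast_one, div_one, one_smul,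
    ← two_smul ℝ (1 : B), ← mul_smul]
  norm_num

theorem coeff_one_hCosh_sub_one {B : Type} [Ring B] [Algebra ℝ B] (t : ℝ) (x : B) :
    PowerSeries.coeff 1 (hCosh t x - 1) = 0 := by
  simp [hCosh, hExp, PowerSeries.coeff_one]

variable {ι : Type}

theorem evalSeries_hSinh (v : ι → T) (t : ℝ) (J : ι) :
    (PowerSeries.C 2 : HRing) • evalSeries v (hSinh t (FreeAlgebra.ι ℝ J)) =
      tExp t (v J) - tExp (-t) (v J) := by
  rw [hSinh, evalSeries_smul, ← mul_smul, ← map_mul, map_sub, evalSeries_hExp, evalSeries_hExp,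
    evalFree_ι]
  norm_num

theorem evalSeries_hCosh (v : ι → T) (t : ℝ) (J : ι) :
    (PowerSeries.C 2 : HRing) • evalSeries v (hCosh t (FreeAlgebra.ι ℝ J)) =
      tExp t (v J) + tExp (-t) (v J) := by
  rw [hCosh, evalSeries_smul, ← mul_smul, ← map_mul, map_add, evalSeries_hExp, evalSeries_hExp,
    evalFree_ι]
  norm_num

theorem evalSeries_qHalf (v : ι → T) {a : ℝ} (ha : a ≠ 0) (J : ι) :
    (ħ * PowerSeries.C a) • evalSeries v (qHalf a J) =
      tExp (a / 2) (v J) - tExp (-(a / 2)) (v J) := by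
  rw [← evalSeries_hSinh, qHalf, evalSeries_smul, ← mul_smul, mul_assoc, ← map_mul, mul_comm ħ,
    mul_smul, ← map_smul (evalSeries v), FreeSeries.X_smul_hDiv _ (constantCoeff_hSinh _ _),
    mul_div_cancel₀ _ ha]

theorem evalSeries_qFull (v : ι → T) {a : ℝ} (ha : a ≠ 0) (J : ι) :
    (ħ * PowerSeries.C (2 * a)) • evalSeries v (qFull a J) =
      tExp a (v J) - tExp (-a) (v J) := by
  rw [← evalSeries_hSinh, qFull, evalSeries_smul, ← mul_smul, mul_assoc, ← map_mul, mul_comm ħ,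
    mul_smul, ← map_smul (evalSeries v), FreeSeries.X_smul_hDiv _ (constantCoeff_hSinh _ _)]
  congr 2
  field_simp

theorem evalSeries_jp (v : ι → T) (J P : ι) :
    evalSeries v (qComm (fgen J) (fgen P) - (2 : ℝ) • fgen P) =
      v J * v P - v P * v J - (2 : HRing) • v P := by
  rw [qComm, map_sub, map_sub, map_mul, map_mul, evalSeries_smul, evalSeries_fgen, evalSeries_fgen,
    map_ofNat]

theorem evalSeries_jm (ap a : ℝ) (v : ι → T) (J P M : ι) :
    evalSeries v (qComm (fgen J) (fgen M) -
      (-((2 : ℝ) • fgen M) - (ap / a) • qHalf a J - (ap ^ 2 / a ^ 2) • fgen P)) =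
      v J * v M - v M * v J - (-((2 : HRing) • v M) -
        (PowerSeries.C (ap / a) : HRing) • evalSeries v (qHalf a J) -
        (PowerSeries.C (ap / a) ^ 2 : HRing) • v P) := by
  simp only [qComm, map_sub, map_mul, map_neg, evalSeries_smul, evalSeries_fgen, map_ofNat,
    ← div_pow, map_pow]

theorem evalSeries_pm (ap a : ℝ) (v : ι → T) (J P M : ι) :
    evalSeries v (qComm (fgen P) (fgen M) -
      (qFull a J + (ap / a) • qScalar a •
        (hExp (-(a / 2)) (FreeAlgebra.ι ℝ J) * fgen P +
          fgen P * hExp (a / 2) (FreeAlgebra.ι ℝ J)))) =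
      v P * v M - v M * v P - (evalSeries v (qFull a J) +
        (PowerSeries.C (ap / a) : HRing) • qScalar a •
          (tExp (-(a / 2)) (v J) * v P + v P * tExp (a / 2) (v J))) := by
  simp only [qComm, map_sub, map_mul, map_add, evalSeries_smul, evalSeries_fgen, map_smul,
    evalSeries_hExp, evalFree_ι]

/-- Elements that satisfy the defining relations. -/
theorem isQTriple_of_slRels {ap a : ℝ} (ha : a ≠ 0) (v : ι → T) (J P M : ι)
    (h : ∀ r ∈ slRels ap a J P M, evalSeries v r = 0) :
    IsQTriple ap a (v J) (v P) (v M) (evalSeries v (qHalf a J)) (evalSeries v (qFull a J)) where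
  half := evalSeries_qHalf v ha J
  full := evalSeries_qFull v ha J
  jp := sub_eq_zero.1 (by rw [← evalSeries_jp]; exact h _ (Or.inl rfl))
  jm := sub_eq_zero.1 (by rw [← evalSeries_jm]; exact h _ (Or.inr (Or.inl rfl)))
  pm := sub_eq_zero.1 (by rw [← evalSeries_pm]; exact h _ (Or.inr (Or.inr rfl)))

/-- Without torsion, s and f are determined by the equations `half` and `full`. Any pair satisfying
these can therefore replace the evaluated series, which makes the relations checkable with whichever
form is convenient. -/
theorem IsQTriple.slRels [HTorsionFree T] {ap a : ℝ} (ha : a ≠ 0) (v : ι → T) (J P M : ι)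
    {s f : T} (h : IsQTriple ap a (v J) (v P) (v M) s f) :
    ∀ r ∈ slRels ap a J P M, evalSeries v r = 0 := by
  have hs : evalSeries v (qHalf a J) = s :=
    HTorsionFree.smul_cancel ha ((evalSeries_qHalf v ha J).trans h.half.symm)
  have hf : evalSeries v (qFull a J) = f :=
    HTorsionFree.smul_cancel (mul_ne_zero two_ne_zero ha)
      ((evalSeries_qFull v ha J).trans h.full.symm)
  rintro r (rfl | rfl | rfl)
  · rw [evalSeries_jp, h.jp, sub_self]
  · rw [evalSeries_jm, hs, h.jm, sub_self]
  · rw [evalSeries_pm, hf, h.pm, sub_self]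

/-- Commutation of a weight vector with `sinh(aj/2)/(a/2)`. -/
theorem comm_half [HTorsionFree T] {a : ℝ} (ha : a ≠ 0) {j p s : T}
    (half : (ħ * PowerSeries.C a) • s = tExp (a / 2) j - tExp (-(a / 2)) j)
    (jp : j * p - p * j = (2 : HRing) • p) :
    p * s - s * p = -((2 : HRing) • qScalar a •
      (tExp (-(a / 2)) j * p + p * tExp (a / 2) j)) := by
  have jp' : j * p - p * j = (PowerSeries.C 2 : HRing) • p := by rw [jp, map_ofNat]
  have e1 := tExp_mul_of_weight 2 jp' (a / 2)
  have e2 := tExp_mul_of_weight 2 jp' (-(a / 2))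
  rw [div_mul_cancel₀ _ two_ne_zero] at e1
  rw [neg_mul, div_mul_cancel₀ _ two_ne_zero] at e2
  have hq : tExp a (1 : HRing) * tExp (-a) (1 : HRing) = 1 := by
    rw [tExp_mul_tExp, add_neg_cancel, tExp_zero]
  -- Of the four products in ħa[p, s], those of the wrong order are rewritten through E⁻p and pE⁺,
  -- where E⁺ and E⁻ are the exponentials of ±aj/2. The result is -(eᵃ - 1)(E⁻p + pE⁺), and eᵃ - 1
  -- is 2aħ times `qScalar a`.
  have e3 : p * tExp (-(a / 2)) j = tExp a (1 : HRing) • (tExp (-(a / 2)) j * p) := by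
    rw [e2, ← mul_smul, hq, one_smul]
  refine HTorsionFree.smul_cancel ha ?_
  have hk := X_mul_qScalar a ha
  rw [map_mul, map_ofNat] at hk
  rw [smul_sub, ← mul_smul_comm, ← smul_mul_assoc, half, mul_sub, sub_mul, e1, e3]
  have h4 : (ħ * (2 * PowerSeries.C a) * qScalar a) •
      (tExp (-(a / 2)) j * p + p * tExp (a / 2) j) =
      (tExp a (1 : HRing) - 1) • (tExp (-(a / 2)) j * p + p * tExp (a / 2) j) := by rw [hk]
  linear_combination (norm := module) h4

theorem commute_of_smul [HTorsionFree T] {t : ℝ} (ht : t ≠ 0) {x y : T}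
    (h : Commute ((ħ * PowerSeries.C t) • x) y) : Commute x y :=
  HTorsionFree.smul_cancel ht (by rw [← smul_mul_assoc, ← mul_smul_comm]; exact h)

theorem commute_half [HTorsionFree T] {a : ℝ} (ha : a ≠ 0) {j s y : T}
    (half : (ħ * PowerSeries.C a) • s = tExp (a / 2) j - tExp (-(a / 2)) j) (h : Commute j y) :
    Commute s y :=
  commute_of_smul ha (by
    rw [half]
    exact (tExp_commute h _).sub_left (tExp_commute h _))

/-- In the computations with `module`, `PowerSeries.C (1 / 2)` is an opaque scalar; this is the only
property of it that they use. -/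
theorem two_mul_C_half : (2 : HRing) * PowerSeries.C (1 / 2 : ℝ) = 1 := by
  rw [← map_ofNat (PowerSeries.C : ℝ →+* HRing) 2, ← map_mul]
  norm_num

/-- The change of generator `m ↦ m + (r/2) s + (r/2)² p`, with `r = a₊/a`. -/
def shiftGen (ap a : ℝ) (p m s : T) : T :=
  m + (PowerSeries.C (1 / 2) * PowerSeries.C (ap / a) : HRing) • s +
    (PowerSeries.C (1 / 2) * PowerSeries.C (ap / a) : HRing) ^ 2 • p

variable {ap a : ℝ} {j p m n s f : T}

theorem shiftGen_eq_iff : shiftGen ap a p m s = n ↔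
    m = n - (PowerSeries.C (1 / 2) * PowerSeries.C (ap / a) : HRing) • s -
      (PowerSeries.C (1 / 2) * PowerSeries.C (ap / a) : HRing) ^ 2 • p := by
  rw [shiftGen, sub_sub, eq_sub_iff_add_eq, add_assoc]

/-- In terms of the shifted generator, the relations are those of Drinfeld and Jimbo. -/
theorem IsQTriple.isDJTriple [HTorsionFree T] (ha : a ≠ 0) (h : IsQTriple ap a j p m s f) :
    IsDJTriple a j p (shiftGen ap a p m s) f where
  full := h.full
  jp := h.jp
  jn := by
    -- As s commutes with j and p has weight 2, the bracket [j, n] is -2m - rs - r²p + (r²/2)p,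
    -- which is -2n. This fixes the coefficients r/2 and (r/2)².
    have h1 := (commute_half ha h.half (Commute.refl j)).eq
    have h2 := h.jm
    have h3 := h.jp
    have h4 := two_mul_C_half
    have h5 : (2 * PowerSeries.C (1 / 2 : ℝ) : HRing) • PowerSeries.C (ap / a) • s =
      (1 : HRing) • PowerSeries.C (ap / a) • s := by rw [h4]
    have h6 : (2 * PowerSeries.C (1 / 2 : ℝ) : HRing) ^ 2 • PowerSeries.C (ap / a) ^ 2 • p =
      (1 : HRing) ^ 2 • PowerSeries.C (ap / a) ^ 2 • p := by rw [h4]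
    simp only [shiftGen, mul_add, add_mul, mul_smul_comm, smul_mul_assoc]
    linear_combination (norm := module) h2 - (PowerSeries.C (1 / 2) * PowerSeries.C (ap / a) : HRing) • h1
      + (PowerSeries.C (1 / 2) * PowerSeries.C (ap / a) : HRing) ^ 2 • h3 + h5 + h6
  pn := by
    -- The contribution (r/2)[p, s] is the opposite of the a₊-term of [p, m], so only f survives.
    have h1 := comm_half ha h.half h.jp
    have h2 := h.pm
    have h5 : (2 * PowerSeries.C (1 / 2 : ℝ) : HRing) • PowerSeries.C (ap / a) • qScalar a •
        (tExp (-(a / 2)) j * p + p * tExp (a / 2) j) =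
      (1 : HRing) • PowerSeries.C (ap / a) • qScalar a •
        (tExp (-(a / 2)) j * p + p * tExp (a / 2) j) := by rw [two_mul_C_half]
    simp only [shiftGen, mul_add, add_mul, mul_smul_comm, smul_mul_assoc]
    linear_combination (norm := module) h2 + (PowerSeries.C (1 / 2) * PowerSeries.C (ap / a) : HRing) • h1
      - h5

/-- The change of generator is invertible because s is a function of j alone. It is used to return
to the original relations for coproducts and for the realization in U(gl(2))⟦ħ⟧. -/
theorem IsDJTriple.isQTriple [HTorsionFree T] (ha : a ≠ 0) (h : IsDJTriple a j p n f)
    (half : (ħ * PowerSeries.C a) • s = tExp (a / 2) j - tExp (-(a / 2)) j)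
    (hn : shiftGen ap a p m s = n) : IsQTriple ap a j p m s f where
  half := half
  full := h.full
  jp := h.jp
  jm := by
    have h1 := (commute_half ha half (Commute.refl j)).eq
    have h2 := h.jn
    have h3 := h.jp
    have h4 := two_mul_C_half
    have h5 : (2 * PowerSeries.C (1 / 2 : ℝ) : HRing) • PowerSeries.C (ap / a) • s =
      (1 : HRing) • PowerSeries.C (ap / a) • s := by rw [h4]
    have h6 : (2 * PowerSeries.C (1 / 2 : ℝ) : HRing) ^ 2 • PowerSeries.C (ap / a) ^ 2 • p =
      (1 : HRing) ^ 2 • PowerSeries.C (ap / a) ^ 2 • p := by rw [h4]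
    subst hn
    simp only [shiftGen, mul_add, add_mul, mul_smul_comm, smul_mul_assoc] at h2
    linear_combination (norm := module) h2 + (PowerSeries.C (1 / 2) * PowerSeries.C (ap / a) : HRing) • h1
      - (PowerSeries.C (1 / 2) * PowerSeries.C (ap / a) : HRing) ^ 2 • h3 - h5 - h6
  pm := by
    have h1 := comm_half ha half h.jp
    have h2 := h.pn
    have h5 : (2 * PowerSeries.C (1 / 2 : ℝ) : HRing) • PowerSeries.C (ap / a) • qScalar a •
        (tExp (-(a / 2)) j * p + p * tExp (a / 2) j) =
      (1 : HRing) • PowerSeries.C (ap / a) • qScalar a •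
        (tExp (-(a / 2)) j * p + p * tExp (a / 2) j) := by rw [two_mul_C_half]
    subst hn
    simp only [shiftGen, mul_add, add_mul, mul_smul_comm, smul_mul_assoc] at h2
    linear_combination (norm := module) h2 - (PowerSeries.C (1 / 2) * PowerSeries.C (ap / a) : HRing) • h1
      + h5

theorem IsDJTriple.pn_weights (h : IsDJTriple a j p n f) (t : ℝ) :
    tExp t j * p = tExp (t * 2) (1 : HRing) • (p * tExp t j) ∧
      tExp t j * n = tExp (-(t * 2)) (1 : HRing) • (n * tExp t j) := by
  constructor
  · exact tExp_mul_of_weight 2 (by rw [h.jp, map_ofNat]) t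
  · rw [← mul_neg]
    exact tExp_mul_of_weight (-2) (by rw [h.jn, map_neg, map_ofNat, neg_smul]) t

/-- The coproduct of a Drinfeld-Jimbo triple. -/
theorem IsDJTriple.coproduct {j₁ p₁ n₁ f₁ j₂ p₂ n₂ f₂ : T}
    (h₁ : IsDJTriple a j₁ p₁ n₁ f₁) (h₂ : IsDJTriple a j₂ p₂ n₂ f₂)
    (jj : Commute j₁ j₂) (jp : Commute j₁ p₂) (jn : Commute j₁ n₂) (pj : Commute p₁ j₂)
    (pn : Commute p₁ n₂) (nj : Commute n₁ j₂) (np : Commute n₁ p₂) :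
    IsDJTriple a (j₁ + j₂) (tExp (a / 2) j₁ * p₂ + p₁ * tExp (-(a / 2)) j₂)
      (tExp (a / 2) j₁ * n₂ + n₁ * tExp (-(a / 2)) j₂)
      (tExp a j₁ * f₂ + f₁ * tExp (-a) j₂) where
  full := by
    rw [smul_add, ← mul_smul_comm, ← smul_mul_assoc, h₁.full, h₂.full, tExp_add jj, tExp_add jj]
    noncomm_ring
  jp := by
    have e1 : Commute (tExp (a / 2) j₁) j₁ := tExp_commute (Commute.refl j₁) _
    have e2 : Commute (tExp (-(a / 2)) j₂) j₂ := tExp_commute (Commute.refl j₂) _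
    have e3 : Commute (tExp (a / 2) j₁) j₂ := tExp_commute jj _
    have e4 : Commute (tExp (-(a / 2)) j₂) j₁ := tExp_commute jj.symm _
    have e5 := (e1.mul_left jp.symm).eq
    have e6 := (pj.mul_left e2).eq
    have e7 : j₂ * (tExp (a / 2) j₁ * p₂) = tExp (a / 2) j₁ * (j₂ * p₂) := e3.symm.left_comm p₂
    have e8 : p₁ * tExp (-(a / 2)) j₂ * j₁ = p₁ * j₁ * tExp (-(a / 2)) j₂ := e4.right_comm p₁
    have e9 := congrArg (fun w => tExp (a / 2) j₁ * w) h₂.jp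
    have e10 := congrArg (fun w => w * tExp (-(a / 2)) j₂) h₁.jp
    simp only [mul_sub, sub_mul, mul_smul_comm, smul_mul_assoc, ← mul_assoc] at e5 e6 e7 e8 e9 e10
    simp only [mul_add, add_mul, ← mul_assoc]
    linear_combination (norm := module) e7 - e8 + e9 + e10 - e5 - e6
  jn := by
    have e1 : Commute (tExp (a / 2) j₁) j₁ := tExp_commute (Commute.refl j₁) _
    have e2 : Commute (tExp (-(a / 2)) j₂) j₂ := tExp_commute (Commute.refl j₂) _
    have e3 : Commute (tExp (a / 2) j₁) j₂ := tExp_commute jj _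
    have e4 : Commute (tExp (-(a / 2)) j₂) j₁ := tExp_commute jj.symm _
    have e5 := (e1.mul_left jn.symm).eq
    have e6 := (nj.mul_left e2).eq
    have e7 : j₂ * (tExp (a / 2) j₁ * n₂) = tExp (a / 2) j₁ * (j₂ * n₂) := e3.symm.left_comm n₂
    have e8 : n₁ * tExp (-(a / 2)) j₂ * j₁ = n₁ * j₁ * tExp (-(a / 2)) j₂ := e4.right_comm n₁
    have e9 := congrArg (fun w => tExp (a / 2) j₁ * w) h₂.jn
    have e10 := congrArg (fun w => w * tExp (-(a / 2)) j₂) h₁.jn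
    simp only [mul_sub, sub_mul, mul_smul_comm, smul_mul_assoc, ← mul_assoc, mul_neg, neg_mul]
      at e5 e6 e7 e8 e9 e10
    simp only [mul_add, add_mul, ← mul_assoc]
    linear_combination (norm := module) e7 - e8 + e9 + e10 - e5 - e6
  pn := by
    have k1 : tExp a j₁ = tExp (a / 2) j₁ * tExp (a / 2) j₁ := by rw [tExp_mul_tExp, add_halves]
    have k2 : tExp (-a) j₂ = tExp (-(a / 2)) j₂ * tExp (-(a / 2)) j₂ := by
      rw [tExp_mul_tExp, ← neg_add, add_halves]
    -- With L = `tExp (a / 2) j₁` and R = `tExp (-(a / 2)) j₂`, moving L past n₁ and R past p₂ gives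
    -- the same factor e⁻ᵃ, and L past p₁ and R past n₂ the same factor eᵃ. So the mixed terms of
    -- the commutator cancel, leaving L²[p₂, n₂] + [p₁, n₁]R².
    obtain ⟨w1, w2⟩ := h₁.pn_weights (a / 2)
    obtain ⟨w3, w4⟩ := h₂.pn_weights (-(a / 2))
    rw [neg_mul, div_mul_cancel₀ _ two_ne_zero] at w3 w4
    rw [div_mul_cancel₀ _ two_ne_zero] at w1 w2
    rw [neg_neg] at w4
    have cp : Commute p₂ (tExp (a / 2) j₁) := (tExp_commute jp _).symm
    have cn : Commute n₂ (tExp (a / 2) j₁) := (tExp_commute jn _).symm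
    have cp' : Commute (tExp (-(a / 2)) j₂) p₁ := tExp_commute pj.symm _
    have cn' : Commute (tExp (-(a / 2)) j₂) n₁ := tExp_commute nj.symm _
    have cL : Commute (tExp (-(a / 2)) j₂) (tExp (a / 2) j₁) :=
      tExp_commute (tExp_commute jj _).symm _
    rw [k1, k2, ← h₁.pn, ← h₂.pn]
    simp only [mul_add, add_mul, mul_sub, sub_mul]
    rw [cp.mul_mul_mul_comm, cn.mul_mul_mul_comm, cn'.mul_mul_mul_comm, cp'.mul_mul_mul_comm,
      np.symm.mul_mul_mul_comm, cL.mul_mul_mul_comm, cL.mul_mul_mul_comm,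
      pn.symm.mul_mul_mul_comm, w1, w2, w3, w4]
    simp only [mul_smul_comm, smul_mul_assoc]
    abel

/-- The coproduct of a triple that satisfies the deformed relations. -/
theorem IsQTriple.coproduct [HTorsionFree T] (ha : a ≠ 0) {j₁ p₁ m₁ s₁ f₁ j₂ p₂ m₂ s₂ f₂ : T}
    (h₁ : IsQTriple ap a j₁ p₁ m₁ s₁ f₁) (h₂ : IsQTriple ap a j₂ p₂ m₂ s₂ f₂)
    (jj : Commute j₁ j₂) (jp : Commute j₁ p₂) (jm : Commute j₁ m₂) (pj : Commute p₁ j₂)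
    (pp : Commute p₁ p₂) (pm : Commute p₁ m₂) (mj : Commute m₁ j₂) (mp : Commute m₁ p₂) :
    IsQTriple ap a (j₁ + j₂) (tExp (a / 2) j₁ * p₂ + p₁ * tExp (-(a / 2)) j₂)
      (tExp (a / 2) j₁ * m₂ + m₁ * tExp (-(a / 2)) j₂)
      (tExp (a / 2) j₁ * s₂ + s₁ * tExp (-(a / 2)) j₂)
      (tExp a j₁ * f₂ + f₁ * tExp (-a) j₂) := by
  have sj : Commute s₁ j₂ := commute_half ha h₁.half jj
  have sp : Commute s₁ p₂ := commute_half ha h₁.half jp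
  have js : Commute j₁ s₂ := (commute_half ha h₂.half jj.symm).symm
  have ps : Commute p₁ s₂ := (commute_half ha h₂.half pj.symm).symm
  have hl : ∀ x : T, Commute x m₂ → Commute x s₂ → Commute x p₂ →
      Commute x (shiftGen ap a p₂ m₂ s₂) := fun x hm hs hp =>
    (hm.add_right (hs.smul_right _)).add_right (hp.smul_right _)
  have hr : ∀ x : T, Commute m₁ x → Commute s₁ x → Commute p₁ x →
      Commute (shiftGen ap a p₁ m₁ s₁) x := fun x hm hs hp =>
    (hm.add_left (hs.smul_left _)).add_left (hp.smul_left _)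
  refine ((h₁.isDJTriple ha).coproduct (h₂.isDJTriple ha) jj jp (hl _ jm js jp) pj
    (hl _ pm ps pp) (hr _ mj sj pj) (hr _ mp sp pp)).isQTriple ha ?_ ?_
  -- The difference of the exponentials of ±a(j₁ + j₂)/2 telescopes, so s obeys the same twisted
  -- rule as p and m.
  · rw [smul_add, ← mul_smul_comm, ← smul_mul_assoc, h₁.half, h₂.half, tExp_add jj, tExp_add jj]
    noncomm_ring
  -- The twisted rule is linear in the element, and the shifted generator is a fixed linear
  -- combination of m, s and p.
  · simp only [shiftGen, mul_add, add_mul, mul_smul_comm, smul_mul_assoc]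
    module

/-- The negatives of a triple satisfy the relations in the opposite algebra. -/
theorem IsQTriple.neg_op (h : IsQTriple ap a j p m s f) :
    IsQTriple ap a (MulOpposite.op (-j)) (MulOpposite.op (-p)) (MulOpposite.op (-m))
      (MulOpposite.op (-s)) (MulOpposite.op (-f)) where
  half := by
    rw [tExp_op, tExp_op, ← MulOpposite.op_smul, ← MulOpposite.op_sub, smul_neg, h.half, tExp_neg,
      tExp_neg, neg_neg, neg_sub]
  full := by
    rw [tExp_op, tExp_op, ← MulOpposite.op_smul, ← MulOpposite.op_sub, smul_neg, h.full, tExp_neg,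
      tExp_neg, neg_neg, neg_sub]
  jp := by
    refine MulOpposite.unop_injective ?_
    simp only [MulOpposite.unop_sub, MulOpposite.unop_mul, MulOpposite.unop_op,
      MulOpposite.unop_smul, neg_mul_neg]
    linear_combination (norm := module) -h.jp
  jm := by
    refine MulOpposite.unop_injective ?_
    simp only [MulOpposite.unop_sub, MulOpposite.unop_mul, MulOpposite.unop_op,
      MulOpposite.unop_smul, MulOpposite.unop_neg, neg_mul_neg]
    linear_combination (norm := module) -h.jm
  -- Reversing products interchanges the two orders in E⁻p + pE⁺ and j ↦ -j interchanges the
  -- exponents, so the sum merely changes sign with p.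
  pm := by
    refine MulOpposite.unop_injective ?_
    simp only [tExp_op, MulOpposite.unop_sub, MulOpposite.unop_add, MulOpposite.unop_mul,
      MulOpposite.unop_op, MulOpposite.unop_smul, tExp_neg, neg_neg, neg_mul, mul_neg]
    linear_combination (norm := module) -h.pm

end Triples

/-! ## The Casimir element -/

section Casimir

theorem evalSeries_casimir {T : Type} [Ring T] [Algebra HRing T] [HComplete T] {ι : Type}
    (v : ι → T) (ap a : ℝ) (J P M : ι) :
    evalSeries v (casimirSeries ap a J P M) = ((2 / a) • (hDiv (hTanh a))⁻¹ : HRing) •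
      evalSeries v (hDiv (hDiv (hCosh a (FreeAlgebra.ι ℝ J) - 1))) +
      (PowerSeries.C (ap / a) : HRing) • (evalSeries v (qHalf a J) * v P +
        v P * evalSeries v (qHalf a J)) + (PowerSeries.C (ap / a) : HRing) ^ 2 • v P ^ 2 +
      (2 : HRing) • (v P * v M + v M * v P) := by
  rw [casimirSeries]
  generalize ((2 / a) • (hDiv (hTanh a))⁻¹ : HRing) = c
  simp only [map_add, map_mul, map_smul, evalSeries_smul, evalSeries_fgen, map_pow, map_ofNat,
    ← div_pow]

attribute [local instance 2000] Semiring.toNatAlgebra Ring.toIntAlgebra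

variable {T : Type} [Ring T] [Algebra HRing T] [HTorsionFree T]
  {ap a : ℝ} {j p n f y : T} {c : HRing}

theorem hTorsionFree_smul_eq_zero {u : HRing} {t : ℝ} (ht : t ≠ 0) {x : T} {k : ℕ}
    (hu : u = ħ ^ k * PowerSeries.C t) (h : u • x = 0) : x = 0 := by
  subst hu
  induction k with
  | zero =>
    rw [pow_zero, one_mul] at h
    exact HTorsionFree.smul_cancel ht (by rw [mul_smul, h, smul_zero, smul_zero])
  | succ k ih =>
    refine ih (HTorsionFree.eq_zero _ ?_)
    rw [← mul_smul, ← mul_assoc, ← pow_succ', h]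

/-- In a Drinfeld-Jimbo triple, the element `c y + 2 (p n + n p)` with `y = (cosh(aj) - 1)/ħ²` and
`c = (2ħ/a) cosh a / sinh a` commutes with the triple. -/
theorem IsDJTriple.casimir_commute [HComplete T] (ha : a ≠ 0) (h : IsDJTriple a j p n f)
    (hy : (ħ ^ 2 * PowerSeries.C 2) • y = tExp a j + tExp (-a) j - (2 : HRing) • (1 : T))
    (hc : c * (PowerSeries.C a * (tExp a (1 : HRing) - tExp (-a) (1 : HRing))) =
      2 * ħ * (tExp a (1 : HRing) + tExp (-a) (1 : HRing))) :
    Commute (c • y + (2 : HRing) • (p * n + n * p)) j ∧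
    Commute (c • y + (2 : HRing) • (p * n + n * p)) p ∧
    Commute (c • y + (2 : HRing) • (p * n + n * p)) n := by
  obtain ⟨w1, w2⟩ := h.pn_weights a
  obtain ⟨w3, w4⟩ := h.pn_weights (-a)
  have hq : tExp a (1 : HRing) * tExp (-a) (1 : HRing) = 1 := by
    rw [tExp_mul_tExp, add_neg_cancel, tExp_zero]
  have hq2 : tExp (a * 2) (1 : HRing) = tExp a (1 : HRing) ^ 2 := by
    rw [pow_two, tExp_mul_tExp, mul_two]
  have hq3 : tExp (-(a * 2)) (1 : HRing) = tExp (-a) (1 : HRing) ^ 2 := by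
    rw [pow_two, tExp_mul_tExp, mul_two, neg_add]
  rw [neg_mul, hq3] at w3
  rw [neg_mul, neg_neg, hq2] at w4
  rw [hq2] at w1
  rw [hq3] at w2
  have hf := h.full
  generalize tExp a (1 : HRing) = q at *
  generalize tExp (-a) (1 : HRing) = q' at *
  have hE := (tExp_commute (Commute.refl j) a).eq
  have hE' := (tExp_commute (Commute.refl j) (-a)).eq
  generalize tExp a j = E at *
  generalize tExp (-a) j = E' at *
  refine ⟨?_, ?_, ?_⟩
  · have h1 : Commute y j := by
      refine sub_eq_zero.1 (hTorsionFree_smul_eq_zero two_ne_zero (k := 2) rfl ?_)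
      rw [smul_sub, ← smul_mul_assoc, ← mul_smul_comm, hy]
      simp only [add_mul, sub_mul, mul_add, mul_sub, smul_mul_assoc, mul_smul_comm, one_mul,
        mul_one]
      rw [hE, hE']
      abel
    have h2 : Commute (p * n + n * p) j := by
      have e1 := congrArg (fun w => w * n) h.jp
      have e2 := congrArg (fun w => p * w) h.jn
      have e3 := congrArg (fun w => w * p) h.jn
      have e4 := congrArg (fun w => n * w) h.jp
      simp only [mul_sub, sub_mul, mul_neg, neg_mul, smul_mul_assoc, mul_smul_comm, ← mul_assoc]
        at e1 e2 e3 e4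
      change _ = _
      simp only [mul_add, add_mul, ← mul_assoc]
      linear_combination (norm := module) -e1 - e2 - e3 - e4
    exact (h1.smul_left _).add_left (h2.smul_left _)
  -- Write u = q pE - q' pE'. Up to explicit factors, [y, p] is (q - q')u, whereas [pn + np, p] =
  -- -(pf + fp) is -(q + q')u. The equation `hc` for c balances the two contributions. The case of n
  -- below is the same with q and q' exchanged inside u.
  · refine sub_eq_zero.1 (hTorsionFree_smul_eq_zero (mul_ne_zero two_ne_zero ha) (k := 2) rfl ?_)
    have k1 : (q * q') • (p * E) = (1 : HRing) • (p * E) := by rw [hq]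
    have k2 : (q * q') • (p * E') = (1 : HRing) • (p * E') := by rw [hq]
    have h1 : (ħ ^ 2 * PowerSeries.C 2) • (y * p - p * y) =
        (q - q') • (q • (p * E) - q' • (p * E')) := by
      rw [smul_sub, ← smul_mul_assoc, ← mul_smul_comm, hy]
      simp only [add_mul, sub_mul, mul_add, mul_sub, smul_mul_assoc, mul_smul_comm, one_mul,
        mul_one]
      rw [w1, w3]
      linear_combination (norm := module) k1 + k2
    have h2 : (ħ * PowerSeries.C (2 * a)) • (p * f + f * p) = (q + q') • (q • (p * E) - q' • (p * E')) := by
      rw [smul_add, ← smul_mul_assoc _ f p, ← mul_smul_comm _ p f, hf]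
      simp only [sub_mul, mul_sub]
      rw [w1, w3]
      linear_combination (norm := module) k2 - k1
    have h3 : (p * n + n * p) * p - p * (p * n + n * p) = -(p * f + f * p) := by
      rw [← h.pn]
      noncomm_ring
    have hc' : (c * (PowerSeries.C a * (q - q'))) • (q • (p * E) - q' • (p * E')) =
        (2 * ħ * (q + q')) • (q • (p * E) - q' • (p * E')) := by rw [hc]
    have h4 : (c • y + (2 : HRing) • (p * n + n * p)) * p -
        p * (c • y + (2 : HRing) • (p * n + n * p)) = c • (y * p - p * y) +
        (2 : HRing) • ((p * n + n * p) * p - p * (p * n + n * p)) := by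
      simp only [add_mul, mul_add, smul_mul_assoc, mul_smul_comm]
      module
    rw [h4, h3]
    rw [map_mul, map_ofNat] at h2 ⊢
    rw [map_ofNat] at h1
    linear_combination (norm := module) (c * PowerSeries.C a) • h1 - (2 * ħ) • h2 + hc'
  · refine sub_eq_zero.1 (hTorsionFree_smul_eq_zero (mul_ne_zero two_ne_zero ha) (k := 2) rfl ?_)
    have k1 : (q * q') • (n * E) = (1 : HRing) • (n * E) := by rw [hq]
    have k2 : (q * q') • (n * E') = (1 : HRing) • (n * E') := by rw [hq]
    have h1 : (ħ ^ 2 * PowerSeries.C 2) • (y * n - n * y) =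
        (q' - q) • (q' • (n * E) - q • (n * E')) := by
      rw [smul_sub, ← smul_mul_assoc, ← mul_smul_comm, hy]
      simp only [add_mul, sub_mul, mul_add, mul_sub, smul_mul_assoc, mul_smul_comm, one_mul,
        mul_one]
      rw [w2, w4]
      linear_combination (norm := module) k1 + k2
    have h2 : (ħ * PowerSeries.C (2 * a)) • (n * f + f * n) = (q + q') • (q' • (n * E) - q • (n * E')) := by
      rw [smul_add, ← smul_mul_assoc _ f n, ← mul_smul_comm _ n f, hf]
      simp only [sub_mul, mul_sub]
      rw [w2, w4]
      linear_combination (norm := module) k2 - k1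
    have h3 : (p * n + n * p) * n - n * (p * n + n * p) = n * f + f * n := by
      rw [← h.pn]
      noncomm_ring
    have hc' : (c * (PowerSeries.C a * (q - q'))) • (q' • (n * E) - q • (n * E')) =
        (2 * ħ * (q + q')) • (q' • (n * E) - q • (n * E')) := by rw [hc]
    have h4 : (c • y + (2 : HRing) • (p * n + n * p)) * n -
        n * (c • y + (2 : HRing) • (p * n + n * p)) = c • (y * n - n * y) +
        (2 : HRing) • ((p * n + n * p) * n - n * (p * n + n * p)) := by
      simp only [add_mul, mul_add, smul_mul_assoc, mul_smul_comm]
      module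
    rw [h4, h3]
    rw [map_mul, map_ofNat] at h2 ⊢
    rw [map_ofNat] at h1
    linear_combination (norm := module) (c * PowerSeries.C a) • h1 + (2 * ħ) • h2 - hc'

/-- The series tanh(aħ)/ħ has constant term a, which is nonzero, so it is invertible. Clearing
denominators with sinh = tanh · cosh leaves the normalization required by
`IsDJTriple.casimir_commute`. -/
theorem casimir_coeff (ha : a ≠ 0) :
    ((2 / a) • (hDiv (hTanh a))⁻¹ : HRing) *
      (PowerSeries.C a * (tExp a (1 : HRing) - tExp (-a) (1 : HRing))) =
      2 * ħ * (tExp a (1 : HRing) + tExp (-a) (1 : HRing)) := by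
  have hs : (PowerSeries.C 2 : HRing) * hSinh a (1 : ℝ) = tExp a 1 - tExp (-a) 1 := by
    rw [hSinh, ← hExp_one, ← hExp_one, PowerSeries.smul_eq_C_mul, ← mul_assoc, ← map_mul]
    norm_num
  have hc : (PowerSeries.C 2 : HRing) * hCosh a (1 : ℝ) = tExp a 1 + tExp (-a) 1 := by
    rw [hCosh, ← hExp_one, ← hExp_one, PowerSeries.smul_eq_C_mul, ← mul_assoc, ← map_mul]
    norm_num
  have hc0 : PowerSeries.constantCoeff (hCosh a (1 : ℝ)) = 1 := by
    have := constantCoeff_hCosh_sub_one a (1 : ℝ)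
    rwa [map_sub, map_one, sub_eq_zero] at this
  have hs1 : PowerSeries.coeff 1 (hSinh a (1 : ℝ)) = a := by
    simp [hSinh, hExp]
    ring
  have ht0 : PowerSeries.constantCoeff (hTanh a) = 0 := by
    rw [hTanh, map_mul, constantCoeff_hSinh, zero_mul]
  have ht1 : PowerSeries.constantCoeff (hDiv (hTanh a)) = a := by
    rw [← PowerSeries.coeff_zero_eq_constantCoeff_apply, hDiv, PowerSeries.coeff_mk, hTanh,
      PowerSeries.coeff_mul, Finset.Nat.antidiagonal_succ]
    simp [constantCoeff_hSinh, hs1, hc0]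
  have hX : ħ * hDiv (hTanh a) = hTanh a := by
    ext n
    cases n with
    | zero => simp [ht0]
    | succ n => rw [PowerSeries.coeff_succ_X_mul, hDiv, PowerSeries.coeff_mk]
  have h1 : (hDiv (hTanh a))⁻¹ * hDiv (hTanh a) = 1 :=
    PowerSeries.inv_mul_cancel _ (by rw [ht1]; exact ha)
  have h2 : (hCosh a (1 : ℝ))⁻¹ * hCosh a (1 : ℝ) = 1 :=
    PowerSeries.inv_mul_cancel _ (by rw [hc0]; exact one_ne_zero)
  have h3 : hSinh a (1 : ℝ) = ħ * hDiv (hTanh a) * hCosh a (1 : ℝ) := by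
    rw [hX, hTanh, mul_assoc, h2, mul_one]
  have h4 : (PowerSeries.C (2 / a) * PowerSeries.C a : HRing) = 2 := by
    rw [← map_mul, div_mul_cancel₀ _ ha, map_ofNat]
  rw [← hs, ← hc, h3, PowerSeries.smul_eq_C_mul, map_ofNat]
  linear_combination (2 * ħ * hCosh a (1 : ℝ) * (hDiv (hTanh a))⁻¹ * hDiv (hTanh a)) * h4 +
    (4 * ħ * hCosh a (1 : ℝ)) * h1

/-- The deformed Casimir commutes with the generators. -/
theorem commute_evalSeries_casimir [HComplete T] {ι : Type} (ha : a ≠ 0) (v : ι → T) (J P M : ι)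
    (h : ∀ r ∈ slRels ap a J P M, evalSeries v r = 0) :
    Commute (evalSeries v (casimirSeries ap a J P M)) (v J) ∧
    Commute (evalSeries v (casimirSeries ap a J P M)) (v P) ∧
    Commute (evalSeries v (casimirSeries ap a J P M)) (v M) := by
  have hQ := isQTriple_of_slRels ha v J P M h
  have hy : (ħ ^ 2 * PowerSeries.C 2) •
      evalSeries v (hDiv (hDiv (hCosh a (FreeAlgebra.ι ℝ J) - 1))) =
      tExp a (v J) + tExp (-a) (v J) - (2 : HRing) • (1 : T) := by
    rw [mul_comm, mul_smul, ← map_smul, pow_two, mul_smul, FreeSeries.X_smul_hDiv,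
      FreeSeries.X_smul_hDiv _ (constantCoeff_hCosh_sub_one _ _), map_sub, smul_sub,
      evalSeries_hCosh, map_one, map_ofNat]
    rw [← PowerSeries.coeff_zero_eq_constantCoeff_apply, hDiv, PowerSeries.coeff_mk]
    exact coeff_one_hCosh_sub_one _ _
  obtain ⟨c1, c2, c3⟩ := (hQ.isDJTriple ha).casimir_commute ha hy (casimir_coeff ha)
  -- Expanding 2(pn + np) for the shifted generator n produces exactly the terms of the Casimir with
  -- coefficients r and r², in addition to 2(pm + mp).
  have hC : ((2 / a) • (hDiv (hTanh a))⁻¹ : HRing) •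
      evalSeries v (hDiv (hDiv (hCosh a (FreeAlgebra.ι ℝ J) - 1))) + (2 : HRing) •
      (v P * shiftGen ap a (v P) (v M) (evalSeries v (qHalf a J)) +
        shiftGen ap a (v P) (v M) (evalSeries v (qHalf a J)) * v P) =
      evalSeries v (casimirSeries ap a J P M) := by
    rw [evalSeries_casimir]
    generalize ((2 / a) • (hDiv (hTanh a))⁻¹ : HRing) = c
    have h5 : (2 * PowerSeries.C (1 / 2 : ℝ) : HRing) • PowerSeries.C (ap / a) •
        (v P * evalSeries v (qHalf a J) + evalSeries v (qHalf a J) * v P) =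
      (1 : HRing) • PowerSeries.C (ap / a) •
        (v P * evalSeries v (qHalf a J) + evalSeries v (qHalf a J) * v P) := by
      rw [two_mul_C_half]
    have h6 : (2 * PowerSeries.C (1 / 2 : ℝ) : HRing) ^ 2 • PowerSeries.C (ap / a) ^ 2 •
        (v P * v P) = (1 : HRing) ^ 2 • PowerSeries.C (ap / a) ^ 2 • (v P * v P) := by
      rw [two_mul_C_half]
    simp only [shiftGen, mul_add, add_mul, smul_mul_assoc, mul_smul_comm, pow_two (v P)]
    linear_combination (norm := module) h5 + h6
  rw [hC] at c1 c2 c3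
  have hM : v M = shiftGen ap a (v P) (v M) (evalSeries v (qHalf a J)) -
      (PowerSeries.C (1 / 2) * PowerSeries.C (ap / a) : HRing) • evalSeries v (qHalf a J) -
      (PowerSeries.C (1 / 2) * PowerSeries.C (ap / a) : HRing) ^ 2 • v P :=
    shiftGen_eq_iff.1 rfl
  refine ⟨c1, c2, ?_⟩
  rw [hM]
  exact (c3.sub_right ((commute_half ha hQ.half c1.symm).symm.smul_right _)).sub_right
    (c2.smul_right _)

end Casimir

/-! ## Realization of the quantum algebra in the undeformed one -/

section Realization

attribute [local instance 2000] Semiring.toNatAlgebra Ring.toIntAlgebra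

variable {T : Type} [Ring T]

/-- The divided difference `(z^{n/2} - xⁿ)/(z - x²)` for even `n`, and `0` for odd `n`. -/
def dividedDiff (n : ℕ) (x z : T) : T :=
  if Even n then ∑ i ∈ Finset.range (n / 2), z ^ i * (x ^ 2) ^ (n / 2 - 1 - i) else 0

theorem dividedDiff_mul {x z : T} (h : Commute x z) (n : ℕ) :
    dividedDiff n x z * (z - x ^ 2) = if Even n then z ^ (n / 2) - x ^ n else 0 := by
  rw [dividedDiff]
  split_ifs with hn
  · rw [(h.symm.pow_right 2).geom_sum₂_mul, ← pow_mul, Nat.mul_div_cancel' hn.two_dvd]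
  · rw [zero_mul]

/-- Allowing x ≠ x' covers both uses: commutation with an element, and moving e past functions of h,
which exchanges h + 1 and h - 1. -/
theorem dividedDiff_semiconj {e x x' z : T} (hx : SemiconjBy e x' x) (hz : SemiconjBy e z z)
    (n : ℕ) : SemiconjBy e (dividedDiff n x' z) (dividedDiff n x z) := by
  rw [dividedDiff, dividedDiff]
  split_ifs
  · have : ∀ s : Finset ℕ, SemiconjBy e (∑ i ∈ s, z ^ i * (x' ^ 2) ^ (n / 2 - 1 - i))
        (∑ i ∈ s, z ^ i * (x ^ 2) ^ (n / 2 - 1 - i)) := by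
      intro s
      rw [SemiconjBy, Finset.mul_sum, Finset.sum_mul]
      exact Finset.sum_congr rfl fun i _ =>
        (hz.pow_right i).mul_right ((hx.pow_right 2).pow_right _)
    exact this _
  · exact SemiconjBy.zero_right _

variable [Algebra HRing T] [HComplete T]

theorem tExp_one (t : ℝ) : tExp t (1 : T) = algebraMap HRing T (tExp t (1 : HRing)) := by
  rw [← tExp_algebraMap, map_one]

/-- The series `(cosh(aħ√z) - cosh(aħx)) / (ħ²(z - x²))`. -/
def coshDiff (a : ℝ) (x z : T) : T := hSum fun n =>
  (PowerSeries.C (a ^ (n + 2) / ((n + 2).factorial : ℝ)) : HRing) • dividedDiff (n + 2) x z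

theorem coshDiff_semiconj (a : ℝ) {e x x' z : T} (hx : SemiconjBy e x' x) (hz : SemiconjBy e z z) :
    e * coshDiff a x' z = coshDiff a x z * e := by
  rw [coshDiff, coshDiff, mul_hSum, hSum_mul]
  congr 1
  funext n
  rw [mul_smul_comm, smul_mul_assoc, (dividedDiff_semiconj hx hz _).eq]

/-- No square root of z is needed: cosh(aħ√z) is the sum over even n, a series in z. The divided
differences of index 0 and 1 vanish, so the division by ħ² built into `coshDiff` loses nothing. -/
theorem coshDiff_mul (a : ℝ) {x z : T} (h : Commute x z) :
    (ħ ^ 2 * 2) • (coshDiff a x z * (z - x ^ 2)) = (2 : HRing) • (hSum fun n =>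
      if Even n then (PowerSeries.C (a ^ n / (n.factorial : ℝ)) : HRing) • z ^ (n / 2) else 0) -
      (tExp a x + tExp (-a) x) := by
  have h1 : ħ ^ 2 • coshDiff a x z = hSum fun n =>
      (PowerSeries.C (a ^ n / (n.factorial : ℝ)) : HRing) • dividedDiff n x z := by
    rw [hSum_succ, hSum_succ]
    simp [dividedDiff, pow_two ħ, mul_smul, coshDiff, add_assoc]
  rw [mul_comm, mul_smul, ← smul_mul_assoc, h1, hSum_mul, tExp, tExp, hSum_add, smul_hSum,
    smul_hSum, eq_sub_iff_add_eq, hSum_add]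
  congr 1
  funext n
  rw [smul_mul_assoc, dividedDiff_mul h]
  split_ifs with hn
  · rw [hn.neg_pow]
    module
  · rw [(Nat.not_even_iff_odd.1 hn).neg_pow, neg_div, map_neg]
    module

theorem coshDiff_eq_add (a : ℝ) (x z : T) :
    ∃ w : T, coshDiff a x z = (PowerSeries.C (a ^ 2 / 2) : HRing) • (1 : T) + ħ • w := by
  refine ⟨hSum fun n => (PowerSeries.C (a ^ (n + 3) / ((n + 3).factorial : ℝ)) : HRing) •
    dividedDiff (n + 3) x z, ?_⟩
  rw [coshDiff, hSum_succ]
  congr 1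
  simp [dividedDiff]

/-- The normalization `2/(a sinh a)`, divided by `ħ`-powers so that it is a unit. -/
def realizationCoeff (a : ℝ) : HRing := (2 / a) • (hDiv (hSinh a (1 : ℝ)))⁻¹

theorem constantCoeff_hDiv_hSinh (a : ℝ) :
    PowerSeries.constantCoeff (hDiv (hSinh a (1 : ℝ))) = a := by
  rw [← PowerSeries.coeff_zero_eq_constantCoeff_apply, hDiv, PowerSeries.coeff_mk]
  simp [hSinh, hExp]
  ring

theorem realizationCoeff_mul {a : ℝ} (ha : a ≠ 0) :
    realizationCoeff a * PowerSeries.C a * (tExp a (1 : HRing) - tExp (-a) (1 : HRing)) = 4 * ħ := by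
  have hs : (PowerSeries.C 2 : HRing) * hSinh a (1 : ℝ) = tExp a 1 - tExp (-a) 1 := by
    rw [hSinh, ← hExp_one, ← hExp_one, PowerSeries.smul_eq_C_mul, ← mul_assoc, ← map_mul]
    norm_num
  have hX : ħ * hDiv (hSinh a (1 : ℝ)) = hSinh a (1 : ℝ) := by
    ext n
    cases n with
    | zero => simp [constantCoeff_hSinh]
    | succ n => rw [PowerSeries.coeff_succ_X_mul, hDiv, PowerSeries.coeff_mk]
  have h1 : (hDiv (hSinh a (1 : ℝ)))⁻¹ * hDiv (hSinh a (1 : ℝ)) = 1 :=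
    PowerSeries.inv_mul_cancel _ (by rw [constantCoeff_hDiv_hSinh]; exact ha)
  have h4 : (PowerSeries.C (2 / a) * PowerSeries.C a : HRing) = 2 := by
    rw [← map_mul, div_mul_cancel₀ _ ha, map_ofNat]
  rw [← hs, ← hX, realizationCoeff, PowerSeries.smul_eq_C_mul, map_ofNat]
  linear_combination (2 * ħ * hDiv (hSinh a (1 : ℝ)) * (hDiv (hSinh a (1 : ℝ)))⁻¹) * h4 +
    (4 * ħ) * h1

theorem realizationCoeff_eq_add (a : ℝ) :
    ∃ c : HRing, realizationCoeff a = PowerSeries.C (2 / a * a⁻¹) + ħ * c := by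
  refine ⟨PowerSeries.mk fun n => PowerSeries.coeff (n + 1) (realizationCoeff a), ?_⟩
  conv_lhs => rw [PowerSeries.eq_X_mul_shift_add_const (realizationCoeff a)]
  rw [add_comm]
  congr 2
  rw [realizationCoeff, PowerSeries.smul_eq_C_mul, map_mul, PowerSeries.constantCoeff_C,
    PowerSeries.constantCoeff_inv, constantCoeff_hDiv_hSinh]

/-- An undeformed `sl(2)`-triple gives rise to a Drinfeld-Jimbo triple, which agrees with it modulo
`ħ`. -/
theorem exists_isDJTriple [HTorsionFree T] {a : ℝ} (ha : a ≠ 0) {h e f : T}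
    (he : h * e - e * h = (2 : HRing) • e) (hf : h * f - f * h = -((2 : HRing) • f))
    (ef : e * f - f * e = h) :
    ∃ n s w : T, IsDJTriple a h e n s ∧ n = f + ħ • w ∧
      ∀ y, Commute y h → Commute y e → Commute y f → Commute y n := by
  -- This is the Casimir of the triple plus 1. It commutes with h and e and is chosen so that 4fe =
  -- z - (h+1)² and 4ef = z - (h-1)², the denominators occurring in `coshDiff`.
  set z : T := (4 : HRing) • (f * e) + (h + 1) ^ 2 with hz
  have he' : h * e = e * h + (2 : HRing) • e := by rw [← he]; abel
  have hf' : h * f = f * h - (2 : HRing) • f := by rw [sub_eq_add_neg, ← hf]; abel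
  have hx : SemiconjBy e (h + 1) (h - 1) := by
    rw [SemiconjBy, mul_add, sub_mul, he']
    simp only [mul_one, one_mul]
    module
  have hzh : Commute z h := by
    have h1 : Commute (f * e) h := by
      change f * e * h = h * (f * e)
      rw [← mul_assoc, hf', sub_mul, mul_assoc, mul_assoc, he']
      simp only [mul_add, smul_mul_assoc, mul_smul_comm]
      module
    exact (h1.smul_left _).add_left (((Commute.refl h).add_left (Commute.one_left h)).pow_left 2)
  have hze : SemiconjBy e z z := by
    have h1 : e * (h + 1) ^ 2 = (h - 1) ^ 2 * e := (hx.pow_right 2).eq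
    have h2 : e * (f * e) = f * e * e + h * e := by rw [← mul_assoc, ← ef, sub_mul]; abel
    have h3 : (h + 1) ^ 2 * e = (h - 1) ^ 2 * e + (4 : HRing) • (h * e) := by
      simp only [pow_two, add_mul, mul_add, sub_mul, mul_sub, one_mul, mul_one]
      module
    rw [SemiconjBy, hz, mul_add, add_mul, mul_smul_comm, smul_mul_assoc, h1, h2, h3]
    module
  have hz1 : (4 : HRing) • (f * e) = z - (h + 1) ^ 2 := by rw [hz]; abel
  have hz2 : (4 : HRing) • (e * f) = z - (h - 1) ^ 2 := by
    have : e * f = f * e + h := by rw [← ef]; abel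
    rw [hz, this]
    simp only [pow_two, add_mul, mul_add, sub_mul, mul_sub, one_mul, mul_one]
    module
  have c1 : Commute (h - 1) z := (hzh.sub_right (Commute.one_right z)).symm
  have c2 : Commute (h + 1) z := (hzh.add_right (Commute.one_right z)).symm
  have c3 : Commute (h - 1) h := (Commute.refl h).sub_left (Commute.one_left h)
  have k0 : h * coshDiff a (h - 1) z = coshDiff a (h - 1) z * h :=
    coshDiff_semiconj a c3.symm hzh.symm
  have k1 : (z - (h - 1) ^ 2) * coshDiff a (h - 1) z = coshDiff a (h - 1) z * (z - (h - 1) ^ 2) :=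
    coshDiff_semiconj a ((c1.symm.sub_left ((Commute.refl _).pow_left 2)))
      ((Commute.refl z).sub_left (c1.pow_left 2))
  have k2 : (z - (h + 1) ^ 2) * coshDiff a (h + 1) z = coshDiff a (h + 1) z * (z - (h + 1) ^ 2) :=
    coshDiff_semiconj a ((c2.symm.sub_left ((Commute.refl _).pow_left 2)))
      ((Commute.refl z).sub_left (c2.pow_left 2))
  have k3 : e * coshDiff a (h + 1) z = coshDiff a (h - 1) z * e := coshDiff_semiconj a hx hze
  have k4 := coshDiff_mul a c1
  have k5 := coshDiff_mul a c2
  rw [← k1] at k4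
  rw [← k2] at k5
  obtain ⟨c, hc⟩ := realizationCoeff_eq_add a
  obtain ⟨w, hw⟩ := coshDiff_eq_add a (h - 1) z
  -- The second witness is the commutator [e, n] itself; that it equals sinh(ah)/a is the content of
  -- `full`. The third collects the ħ-corrections of the two factors multiplying f.
  refine ⟨f * (realizationCoeff a • coshDiff a (h - 1) z),
    e * (f * (realizationCoeff a • coshDiff a (h - 1) z)) -
      f * (realizationCoeff a • coshDiff a (h - 1) z) * e,
    f * ((PowerSeries.C (2 / a * a⁻¹) : HRing) • w + c • coshDiff a (h - 1) z), ⟨?_, he, ?_, rfl⟩,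
    ?_, fun y yh ye yf => ?_⟩
  · have hp : ∀ t : ℝ, tExp t (h + 1) = tExp t (1 : HRing) • tExp t h := fun t => by
      rw [tExp_add (Commute.one_right h), tExp_one, ← Algebra.commutes, ← Algebra.smul_def]
    have hm : ∀ t : ℝ, tExp t (h - 1) = tExp (-t) (1 : HRing) • tExp t h := fun t => by
      rw [sub_eq_add_neg, tExp_add (Commute.one_right h).neg_right, tExp_neg, tExp_one,
        ← Algebra.commutes, ← Algebra.smul_def]
    refine HTorsionFree.smul_cancel (four_ne_zero (α := ℝ)) ?_
    have hr := realizationCoeff_mul ha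
    rw [hp, hp] at k5
    rw [hm, hm, neg_neg] at k4
    have e1 : f * (realizationCoeff a • coshDiff a (h - 1) z) * e =
        realizationCoeff a • (f * e * coshDiff a (h + 1) z) := by
      rw [mul_smul_comm, smul_mul_assoc, mul_assoc, ← k3, mul_assoc]
    have e2 : e * (f * (realizationCoeff a • coshDiff a (h - 1) z)) =
        realizationCoeff a • (e * f * coshDiff a (h - 1) z) := by
      rw [mul_smul_comm, mul_smul_comm, mul_assoc]
    rw [← hz2, smul_mul_assoc] at k4
    rw [← hz1, smul_mul_assoc] at k5
    rw [e1, e2]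
    rw [map_mul, map_ofNat, map_ofNat]
    have e3 : (realizationCoeff a * PowerSeries.C a *
        (tExp a (1 : HRing) - tExp (-a) (1 : HRing))) • (tExp a h - tExp (-a) h) =
        (4 * ħ) • (tExp a h - tExp (-a) h) := by rw [hr]
    -- In en - ne the terms cosh(a√z) cancel. What remains is cosh(a(h+1)) - cosh(a(h-1)) = 2
    -- sinh(a) sinh(ah), and the normalization removes sinh(a).
    linear_combination (norm := module) (realizationCoeff a * PowerSeries.C a) • k4 -
      (realizationCoeff a * PowerSeries.C a) • k5 + e3
  · rw [← mul_assoc, hf', mul_smul_comm, mul_smul_comm, smul_mul_assoc, sub_mul,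
      mul_assoc f h, k0, mul_assoc f, smul_mul_assoc]
    module
  -- The leading terms 2/a² of the normalization and a²/2 of the divided difference are inverse to
  -- each other, hence n ≡ f modulo ħ.
  · have h1 : (PowerSeries.C (2 / a * a⁻¹) * PowerSeries.C (a ^ 2 / 2) : HRing) = 1 := by
      rw [← map_mul, ← map_one PowerSeries.C]
      congr 1
      field_simp
    have h2 : (PowerSeries.C (2 / a * a⁻¹) * PowerSeries.C (a ^ 2 / 2) : HRing) • f =
      (1 : HRing) • f := by rw [h1]
    rw [hc]
    nth_rw 1 [add_smul, hw]
    simp only [mul_add, smul_add, mul_smul_comm, mul_one]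
    linear_combination (norm := module) h2
  · have h1 : Commute y (h + 1) := yh.add_right (Commute.one_right y)
    have h2 : Commute y (h - 1) := yh.sub_right (Commute.one_right y)
    have h3 : Commute y z := ((yf.mul_right ye).smul_right _).add_right (h1.pow_right 2)
    exact yf.mul_right (Commute.smul_right (coshDiff_semiconj a h2 h3) _)

end Realization

/-! ## Maps between completions -/

section Completions

variable {B : Type} [Ring B] [Algebra HRing B] {C : Type} [Ring C] [Algebra HRing C]
  {T : Type} [Ring T] [Algebra HRing T]

theorem HCompl.hMk_eq_of_le {z : HCompl B} {m n : ℕ} (hmn : m ≤ n) {b : B}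
    (h : hMk B n b = z.1 n) : hMk B m b = z.1 m := by
  induction n, hmn using Nat.le_induction with
  | base => exact h
  | succ n _ ih =>
    refine ih ?_
    rw [← z.2 n, ← h]
    rfl

/-- Every element of the completion is the sum of a series with terms in `B`. -/
theorem HCompl.exists_eq_hSum (z : HCompl B) {n : ℕ} {b : B} (h : hMk B n b = z.1 n) :
    ∃ c : ℕ → B, z = HCompl.of B b + ħ ^ n • hSum fun k => HCompl.of B (c k) := by
  have hr : ∀ k, ∃ r : B, hMk B (n + k) r = z.1 (n + k) ∧ (k = 0 → r = b) := by
    intro k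
    cases k with
    | zero => exact ⟨b, h, fun _ => rfl⟩
    | succ k =>
      obtain ⟨r, hr⟩ := hMk_surjective (n + (k + 1)) (z.1 (n + (k + 1)))
      exact ⟨r, hr, fun h => by omega⟩
  choose r hr hr0 using hr
  -- Successive representatives differ by multiples of growing powers of ħ; the cofactors are the
  -- terms of the series and its partial sums telescope.
  have hc : ∀ k, ∃ c : B, r (k + 1) = r k + ħ ^ (n + k) • c := by
    intro k
    have h1 : hMk B (n + k) (r (k + 1)) = hMk B (n + k) (r k) :=
      (HCompl.hMk_eq_of_le (Nat.le_succ (n + k)) (hr (k + 1))).trans (hr k).symm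
    obtain ⟨c, hc⟩ := Ideal.Quotient.eq.1 h1
    exact ⟨c, by rw [hc]; abel⟩
  choose c hc using hc
  refine ⟨c, HCompl.ext_val fun m => ?_⟩
  have hsum : ∀ k, HCompl.of B b + ħ ^ n • ∑ i ∈ Finset.range k, ħ ^ i • HCompl.of B (c i) =
      HCompl.of B (r k) := by
    intro k
    induction k with
    | zero => rw [Finset.sum_range_zero, smul_zero, add_zero, hr0 0 rfl]
    | succ k ih =>
      rw [Finset.sum_range_succ, smul_add, ← add_assoc, ih, hc, map_add, map_smul, ← mul_smul,
        pow_add]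
  obtain ⟨y, hy⟩ := hSum_spec (fun k => HCompl.of B (c k)) m
  rw [hy, smul_add, ← add_assoc, hsum, ← mul_smul, mul_comm, mul_smul]
  change z.1 m = hMk B m (r m) + (ħ ^ m • (ħ ^ n • y)).1 m
  rw [HCompl.smul_val_eq_zero le_rfl, add_zero,
    HCompl.hMk_eq_of_le (Nat.le_add_left m n) (hr m)]

theorem HCompl.exists_eq_of_add (z : HCompl B) {n : ℕ} {b : B} (h : hMk B n b = z.1 n) :
    ∃ y, z = HCompl.of B b + ħ ^ n • y :=
  let ⟨_, hc⟩ := HCompl.exists_eq_hSum z h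
  ⟨_, hc⟩

theorem HCompl.linearMap_ext [HComplete T] {f g : HCompl B →ₗ[HRing] T}
    (h : ∀ b, f (HCompl.of B b) = g (HCompl.of B b)) : f = g := by
  refine LinearMap.ext fun z => HComplete.eq_of_forall fun n => ?_
  obtain ⟨b, hb⟩ := hMk_surjective n (z.1 n)
  obtain ⟨y, rfl⟩ := HCompl.exists_eq_of_add z hb
  refine ⟨f y - g y, ?_⟩
  rw [map_add, map_add, map_smul, map_smul, h, smul_sub]
  abel

theorem HCompl.extend_of (f : B →ₗ[HRing] HCompl C) (b : B) :
    HCompl.extend f (HCompl.of B b) = f b :=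
  HCompl.ext_val fun n => HCompl.extend_apply f _ n b rfl

theorem HCompl.map_of (f : B →ₗ[HRing] C) (b : B) :
    HCompl.map f (HCompl.of B b) = HCompl.of C (f b) :=
  HCompl.extend_of _ b

/-- The continuous extension of an algebra homomorphism is an algebra homomorphism. -/
def HCompl.extendAlg (f : B →ₐ[HRing] HCompl C) : HCompl B →ₐ[HRing] HCompl C :=
  AlgHom.ofLinearMap (HCompl.extend f.toLinearMap)
    (by
      rw [← map_one (HCompl.of B), HCompl.extend_of]
      exact map_one f)
    (by
      intro z w
      refine HCompl.ext_val fun n => ?_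
      obtain ⟨b, hb⟩ := hMk_surjective n (z.1 n)
      obtain ⟨c, hc⟩ := hMk_surjective n (w.1 n)
      rw [HCompl.extend_apply _ (z * w) n (b * c)
        (by rw [map_mul, hb, hc]; rfl)]
      change _ = (HCompl.extend f.toLinearMap z).1 n * (HCompl.extend f.toLinearMap w).1 n
      rw [HCompl.extend_apply _ z n b hb, HCompl.extend_apply _ w n c hc]
      change (f (b * c)).1 n = _
      rw [map_mul]
      rfl)

theorem HCompl.extendAlg_apply (f : B →ₐ[HRing] HCompl C) (z : HCompl B) :
    HCompl.extendAlg f z = HCompl.extend f.toLinearMap z := rfl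

/-- Functoriality of the completion for algebra homomorphisms. -/
def HCompl.mapAlg (f : B →ₐ[HRing] C) : HCompl B →ₐ[HRing] HCompl C :=
  HCompl.extendAlg ((HCompl.of C).comp f)

theorem HCompl.mapAlg_of (f : B →ₐ[HRing] C) (b : B) :
    HCompl.mapAlg f (HCompl.of B b) = HCompl.of C (f b) :=
  HCompl.map_of f.toLinearMap b

/-- The maps Δ ⊗̂ id and id ⊗̂ Δ are defined slice by slice. Writing a slice as an algebra
homomorphism times a fixed element shows that they are algebra homomorphisms. -/
theorem HCompl.map_eq_mapAlg_mul {g : B →ₗ[HRing] C} {f : B →ₐ[HRing] C} {c : C}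
    (h : ∀ b, g b = f b * c) (u : HCompl B) :
    HCompl.map g u = HCompl.mapAlg f u * HCompl.of C c := by
  have : HCompl.map g = LinearMap.mulRight HRing (HCompl.of C c) ∘ₗ
      (HCompl.mapAlg f).toLinearMap := by
    refine HCompl.linearMap_ext fun b => ?_
    rw [HCompl.map_of, h, map_mul, ← HCompl.mapAlg_of]
    rfl
  exact LinearMap.congr_fun this u

theorem HCompl.map_eq_mul_mapAlg {g : B →ₗ[HRing] C} {f : B →ₐ[HRing] C} {c : C}
    (h : ∀ b, g b = c * f b) (u : HCompl B) :
    HCompl.map g u = HCompl.of C c * HCompl.mapAlg f u := by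
  have : HCompl.map g = LinearMap.mulLeft HRing (HCompl.of C c) ∘ₗ
      (HCompl.mapAlg f).toLinearMap := by
    refine HCompl.linearMap_ext fun b => ?_
    rw [HCompl.map_of, h, map_mul, ← HCompl.mapAlg_of]
    rfl
  exact LinearMap.congr_fun this u

theorem HCompl.commute_mapAlg {f : B →ₐ[HRing] C} {c : C} (h : ∀ b, Commute (f b) c)
    (u : HCompl B) : Commute (HCompl.mapAlg f u) (HCompl.of C c) :=
  (HCompl.map_eq_mapAlg_mul (g := LinearMap.mulRight HRing c ∘ₗ f.toLinearMap)
    (fun _ => rfl) u).symm.trans (HCompl.map_eq_mul_mapAlg (fun b => (h b).eq) u)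

variable (B) in
theorem HCompl.of_bijective [HComplete B] : Function.Bijective (HCompl.of B) := by
  constructor
  · rw [injective_iff_map_eq_zero]
    intro b hb
    refine HComplete.sep b fun n => ?_
    have h1 : hMk B n b = 0 := congrArg (fun w : HCompl B => w.1 n) hb
    obtain ⟨y, hy⟩ := Ideal.Quotient.eq_zero_iff_mem.1 h1
    exact ⟨y, hy.symm⟩
  · intro z
    obtain ⟨b, hb⟩ := hMk_surjective 0 (z.1 0)
    obtain ⟨c, hc⟩ := HCompl.exists_eq_hSum z hb
    refine ⟨b + hSum c, ?_⟩
    rw [map_add, hc, pow_zero, one_smul]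
    congr 1
    exact map_hSum (HCompl.of B).toLinearMap c

/-- A complete algebra is its own completion. -/
def HCompl.ofEquiv [HComplete B] : B ≃ₐ[HRing] HCompl B :=
  AlgEquiv.ofBijective (HCompl.of B) (HCompl.of_bijective B)

end Completions

/-! ## Construction of topological Hopf algebras from their generators -/

section Construction

variable {A : Type} [Ring A] [Algebra HRing A]

variable (A) in
/-- `x ⊗ y ↦ x ⊗ y ⊗ 1`. -/
def inclLeft : A ⊗[HRing] A →ₐ[HRing] A ⊗[HRing] (A ⊗[HRing] A) :=
  (Algebra.TensorProduct.assoc HRing HRing HRing A A A).toAlgHom.comp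
    Algebra.TensorProduct.includeLeft

variable (A) in
/-- `x ⊗ y ↦ 1 ⊗ x ⊗ y`. -/
def inclRight : A ⊗[HRing] A →ₐ[HRing] A ⊗[HRing] (A ⊗[HRing] A) :=
  Algebra.TensorProduct.includeRight

theorem inclLeft_tmul (x y : A) : inclLeft A (x ⊗ₜ y) = x ⊗ₜ (y ⊗ₜ 1) := rfl

theorem inclRight_tmul (x y : A) : inclRight A (x ⊗ₜ y) = 1 ⊗ₜ (x ⊗ₜ y) := rfl

theorem inclLeft_mul (t : A ⊗[HRing] A) (b : A) :
    TensorProduct.assoc HRing A A A (t ⊗ₜ b) = inclLeft A t * (1 ⊗ₜ (1 ⊗ₜ b)) := by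
  induction t using TensorProduct.induction_on with
  | zero => simp
  | tmul x y => simp [inclLeft_tmul]
  | add x y hx hy => rw [map_add, add_mul, TensorProduct.add_tmul, map_add, hx, hy]

theorem inclLeft_commute (t : A ⊗[HRing] A) (b : A) :
    Commute (inclLeft A t) (1 ⊗ₜ (1 ⊗ₜ b)) := by
  induction t using TensorProduct.induction_on with
  | zero => rw [map_zero]; exact Commute.zero_left _
  | tmul x y => simp [inclLeft_tmul, Commute, SemiconjBy]
  | add x y hx hy => rw [map_add]; exact hx.add_left hy

theorem inclRight_mul (t : A ⊗[HRing] A) (a : A) : a ⊗ₜ t = (a ⊗ₜ 1) * inclRight A t := by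
  rw [inclRight, Algebra.TensorProduct.includeRight_apply, Algebra.TensorProduct.tmul_mul_tmul,
    mul_one, one_mul]

theorem inclRight_commute (t : A ⊗[HRing] A) (a : A) : Commute (inclRight A t) (a ⊗ₜ 1) := by
  rw [inclRight, Algebra.TensorProduct.includeRight_apply, Commute, SemiconjBy,
    Algebra.TensorProduct.tmul_mul_tmul, Algebra.TensorProduct.tmul_mul_tmul,
    mul_one, one_mul, one_mul, mul_one]

/-- `Δ ⊗̂ id` as an algebra homomorphism. -/
def comulLeftAlg (Δ : A →ₐ[HRing] HCompl (A ⊗[HRing] A)) :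
    A ⊗[HRing] A →ₐ[HRing] HCompl (A ⊗[HRing] (A ⊗[HRing] A)) :=
  Algebra.TensorProduct.lift ((HCompl.mapAlg (inclLeft A)).comp Δ)
    ((HCompl.of (A ⊗[HRing] (A ⊗[HRing] A))).comp
      ((inclRight A).comp Algebra.TensorProduct.includeRight))
    (fun a b => HCompl.commute_mapAlg (fun t => inclLeft_commute t b) (Δ a))

theorem comulLeftAlg_toLinearMap (Δ : A →ₐ[HRing] HCompl (A ⊗[HRing] A)) :
    (comulLeftAlg Δ).toLinearMap = comulLeft Δ.toLinearMap := by
  refine TensorProduct.ext' fun a b => ?_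
  exact (HCompl.map_eq_mapAlg_mul (fun t => inclLeft_mul t b) (Δ a)).symm

/-- `id ⊗̂ Δ` as an algebra homomorphism. -/
def comulRightAlg (Δ : A →ₐ[HRing] HCompl (A ⊗[HRing] A)) :
    A ⊗[HRing] A →ₐ[HRing] HCompl (A ⊗[HRing] (A ⊗[HRing] A)) :=
  Algebra.TensorProduct.lift
    ((HCompl.of (A ⊗[HRing] (A ⊗[HRing] A))).comp Algebra.TensorProduct.includeLeft)
    ((HCompl.mapAlg (inclRight A)).comp Δ)
    (fun a b => (HCompl.commute_mapAlg (fun t => inclRight_commute t a) (Δ b)).symm)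

theorem comulRightAlg_toLinearMap (Δ : A →ₐ[HRing] HCompl (A ⊗[HRing] A)) :
    (comulRightAlg Δ).toLinearMap = comulRight Δ.toLinearMap := by
  refine TensorProduct.ext' fun a b => ?_
  exact (HCompl.map_eq_mul_mapAlg (fun t => inclRight_mul t a) (Δ b)).symm

/-- As k and l are group-like, both sides equal k ⊗ k ⊗ x + k ⊗ x ⊗ l + x ⊗ l ⊗ l. -/
theorem coassoc_twisted {Δ : A →ₐ[HRing] HCompl (A ⊗[HRing] A)} {k l x : A}
    (hk : Δ k = HCompl.of _ (k ⊗ₜ k)) (hl : Δ l = HCompl.of _ (l ⊗ₜ l))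
    (hx : Δ x = HCompl.of _ (k ⊗ₜ x + x ⊗ₜ l)) :
    HCompl.extendAlg (comulLeftAlg Δ) (Δ x) = HCompl.extendAlg (comulRightAlg Δ) (Δ x) := by
  have hL : ∀ (a b : A) (t : A ⊗[HRing] A), Δ a = HCompl.of _ t →
      comulLeftAlg Δ (a ⊗ₜ b) = HCompl.of _ (inclLeft A t * inclRight A (1 ⊗ₜ b)) := by
    intro a b t ht
    rw [map_mul, ← HCompl.mapAlg_of (inclLeft A), ← ht]
    rfl
  have hR : ∀ (a b : A) (t : A ⊗[HRing] A), Δ b = HCompl.of _ t →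
      comulRightAlg Δ (a ⊗ₜ b) = HCompl.of _ (a ⊗ₜ 1 * inclRight A t) := by
    intro a b t ht
    rw [map_mul, ← HCompl.mapAlg_of (inclRight A), ← ht]
    rfl
  rw [hx, HCompl.extendAlg_apply, HCompl.extendAlg_apply, HCompl.extend_of, HCompl.extend_of,
    map_add, map_add, AlgHom.toLinearMap_apply, AlgHom.toLinearMap_apply,
    AlgHom.toLinearMap_apply, AlgHom.toLinearMap_apply, hL k x _ hk, hL x l _ hx, hR k x _ hx,
    hR x l _ hl, ← map_add, ← map_add]
  congr 1
  simp only [map_add, inclLeft_tmul, inclRight_tmul, mul_add, add_mul,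
    Algebra.TensorProduct.tmul_mul_tmul, mul_one, one_mul]
  abel

/-- `a ⊗ b ↦ ε(a) b` as an algebra homomorphism. -/
def counitLeftAlg (ε : A →ₐ[HRing] HRing) : A ⊗[HRing] A →ₐ[HRing] A :=
  Algebra.TensorProduct.lift ((Algebra.ofId HRing A).comp ε) (AlgHom.id HRing A)
    (fun a _ => Algebra.commutes (ε a) _)

theorem counitLeftAlg_toLinearMap (ε : A →ₐ[HRing] HRing) :
    (counitLeftAlg ε).toLinearMap = mulMap (unitCounit ε) LinearMap.id :=
  TensorProduct.ext' fun _ _ => rfl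

/-- `a ⊗ b ↦ a ε(b)` as an algebra homomorphism. -/
def counitRightAlg (ε : A →ₐ[HRing] HRing) : A ⊗[HRing] A →ₐ[HRing] A :=
  Algebra.TensorProduct.lift (AlgHom.id HRing A) ((Algebra.ofId HRing A).comp ε)
    (fun _ b => (Algebra.commutes (ε b) _).symm)

theorem counitRightAlg_toLinearMap (ε : A →ₐ[HRing] HRing) :
    (counitRightAlg ε).toLinearMap = mulMap LinearMap.id (unitCounit ε) :=
  TensorProduct.ext' fun _ _ => rfl

/-- Contraction with S is not multiplicative. But S(aa')bb' = S(a')(S(a)b)b', so once u contracts to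
a scalar, this scalar comes out. Hence the elements satisfying the antipode axiom are closed under
products, and generators suffice. -/
theorem mulMap_antipode_left {S : A →ₗ[HRing] A} (hS : ∀ x y, S (x * y) = S y * S x)
    {u v : HCompl (A ⊗[HRing] A)} {c : HRing}
    (hu : HCompl.map (mulMap S LinearMap.id) u = HCompl.of A (algebraMap HRing A c)) :
    HCompl.map (mulMap S LinearMap.id) (u * v) = c • HCompl.map (mulMap S LinearMap.id) v := by
  have key : ∀ (t : A ⊗[HRing] A) (a b : A), mulMap S LinearMap.id (t * a ⊗ₜ b) =
      S a * mulMap S LinearMap.id t * b := by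
    intro t a b
    induction t using TensorProduct.induction_on with
    | zero => simp
    | tmul x y => simp [mulMap, hS, mul_assoc]
    | add x y hx hy => rw [add_mul, map_add, hx, hy, map_add, mul_add, add_mul]
  refine HCompl.ext_val fun n => ?_
  obtain ⟨s, hs⟩ := hMk_surjective n (u.1 n)
  obtain ⟨t, ht⟩ := hMk_surjective n (v.1 n)
  have h1 : hMk A n (mulMap S LinearMap.id s) = hMk A n (algebraMap HRing A c) := by
    rw [← HCompl.map_apply _ u n s hs, hu]
    rfl
  rw [HCompl.map_apply _ (u * v) n (s * t) (by rw [map_mul, hs, ht]; rfl)]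
  change _ = c • (HCompl.map (mulMap S LinearMap.id) v).1 n
  rw [HCompl.map_apply _ v n t ht]
  clear ht
  induction t using TensorProduct.induction_on with
  | zero => simp
  | tmul a b =>
    rw [key, map_mul, map_mul, h1, AlgHom.commutes, ← Algebra.commutes, mul_assoc,
      ← Algebra.smul_def, ← map_mul]
    rfl
  | add x y hx hy => rw [mul_add, map_add, map_add, hx, hy, map_add, map_add, smul_add]

theorem mulMap_antipode_right {S : A →ₗ[HRing] A} (hS : ∀ x y, S (x * y) = S y * S x)
    {u v : HCompl (A ⊗[HRing] A)} {c : HRing}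
    (hv : HCompl.map (mulMap LinearMap.id S) v = HCompl.of A (algebraMap HRing A c)) :
    HCompl.map (mulMap LinearMap.id S) (u * v) = c • HCompl.map (mulMap LinearMap.id S) u := by
  have key : ∀ (t : A ⊗[HRing] A) (a b : A), mulMap LinearMap.id S (a ⊗ₜ b * t) =
      a * mulMap LinearMap.id S t * S b := by
    intro t a b
    induction t using TensorProduct.induction_on with
    | zero => simp
    | tmul x y => simp [mulMap, hS, mul_assoc]
    | add x y hx hy => rw [mul_add, map_add, hx, hy, map_add, mul_add, add_mul]
  refine HCompl.ext_val fun n => ?_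
  obtain ⟨s, hs⟩ := hMk_surjective n (u.1 n)
  obtain ⟨t, ht⟩ := hMk_surjective n (v.1 n)
  have h1 : hMk A n (mulMap LinearMap.id S t) = hMk A n (algebraMap HRing A c) := by
    rw [← HCompl.map_apply _ v n t ht, hv]
    rfl
  rw [HCompl.map_apply _ (u * v) n (s * t) (by rw [map_mul, hs, ht]; rfl)]
  change _ = c • (HCompl.map (mulMap LinearMap.id S) u).1 n
  rw [HCompl.map_apply _ u n s hs]
  clear hs
  induction s using TensorProduct.induction_on with
  | zero => simp
  | tmul a b =>
    rw [key, map_mul, map_mul, h1, AlgHom.commutes, ← Algebra.commutes, mul_assoc,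
      ← Algebra.smul_def, ← map_mul]
    rfl
  | add x y hx hy => rw [add_mul, map_add, map_add, hx, hy, map_add, map_add, smul_add]

theorem counitLeftAlg_twisted {ε : A →ₐ[HRing] HRing} {k l x : A} (hk : ε k = 1) (hx : ε x = 0) :
    counitLeftAlg ε (k ⊗ₜ x + x ⊗ₜ l) = x := by
  rw [map_add]
  change algebraMap HRing A (ε k) * x + algebraMap HRing A (ε x) * l = x
  rw [hk, hx, map_one, map_zero, one_mul, zero_mul, add_zero]

theorem counitRightAlg_twisted {ε : A →ₐ[HRing] HRing} {k l x : A} (hl : ε l = 1) (hx : ε x = 0) :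
    counitRightAlg ε (k ⊗ₜ x + x ⊗ₜ l) = x := by
  rw [map_add]
  change k * algebraMap HRing A (ε x) + x * algebraMap HRing A (ε l) = x
  rw [hl, hx, map_one, map_zero, mul_one, mul_zero, zero_add]

theorem unitCounit_eq_zero {ε : A →ₐ[HRing] HRing} {x : A} (hx : ε x = 0) :
    unitCounit ε x = 0 := by
  simp [unitCounit, hx]

theorem unitCounit_one (ε : A →ₐ[HRing] HRing) : unitCounit ε 1 = 1 := by
  simp [unitCounit]

theorem smul_unitCounit (ε : A →ₐ[HRing] HRing) (x y : A) :
    ε x • unitCounit ε y = unitCounit ε (x * y) := by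
  simp [unitCounit, Algebra.smul_def]

theorem smul_unitCounit' (ε : A →ₐ[HRing] HRing) (x y : A) :
    ε y • unitCounit ε x = unitCounit ε (x * y) := by
  rw [← smul_unitCounit]
  change ε y • algebraMap HRing A (ε x) = ε x • algebraMap HRing A (ε y)
  rw [Algebra.smul_def, Algebra.smul_def, ← map_mul (algebraMap HRing A),
    ← map_mul (algebraMap HRing A), mul_comm]

theorem mulMap_one (f g : A →ₗ[HRing] A) (hf : f 1 = 1) (hg : g 1 = 1) : mulMap f g 1 = 1 := by
  simp [mulMap, Algebra.TensorProduct.one_def, hf, hg]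

theorem mulMap_antipode_left_twisted {S : A →ₗ[HRing] A} {k l x : A} (hl : S l * l = 1)
    (hx : S x = -(S k * x * S l)) : mulMap S LinearMap.id (k ⊗ₜ x + x ⊗ₜ l) = 0 := by
  simp [mulMap, hx, mul_assoc, hl]

theorem mulMap_antipode_right_twisted {S : A →ₗ[HRing] A} {k l x : A} (hk : k * S k = 1)
    (hx : S x = -(S k * x * S l)) : mulMap LinearMap.id S (k ⊗ₜ x + x ⊗ₜ l) = 0 := by
  simp [mulMap, hx, ← mul_assoc, hk]

variable {ι : Type} {rels : Set (FreeSeries ι)}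

theorem PresentedAlg.antipode_left
    {Δ : PresentedAlg rels →ₐ[HRing] HCompl (PresentedAlg rels ⊗[HRing] PresentedAlg rels)}
    {ε : PresentedAlg rels →ₐ[HRing] HRing} {S : PresentedAlg rels →ₗ[HRing] PresentedAlg rels}
    (hS1 : S 1 = 1) (hSm : ∀ x y, S (x * y) = S y * S x)
    (hg : ∀ i, HCompl.map (mulMap S LinearMap.id) (Δ (gen rels i)) =
      HCompl.of _ (unitCounit ε (gen rels i))) (x : PresentedAlg rels) :
    HCompl.map (mulMap S LinearMap.id) (Δ x) = HCompl.of _ (unitCounit ε x) := by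
  have h : HCompl.map (mulMap S LinearMap.id) ∘ₗ Δ.toLinearMap =
      (HCompl.of (PresentedAlg rels)).toLinearMap ∘ₗ unitCounit ε := by
    refine linearMap_ext ?_ hg fun x y hx hy => ?_
    · change HCompl.map _ (Δ 1) = HCompl.of _ (unitCounit ε 1)
      rw [map_one, ← map_one (HCompl.of _), HCompl.map_of, mulMap_one _ _ hS1 rfl, unitCounit_one]
    · change HCompl.map _ (Δ x) = HCompl.of _ (unitCounit ε x) at hx
      change HCompl.map _ (Δ y) = HCompl.of _ (unitCounit ε y) at hy
      change HCompl.map _ (Δ (x * y)) = HCompl.of _ (unitCounit ε (x * y))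
      rw [map_mul, mulMap_antipode_left hSm hx, hy, ← map_smul, ← smul_unitCounit]
      rfl
  exact LinearMap.congr_fun h x

theorem PresentedAlg.antipode_right
    {Δ : PresentedAlg rels →ₐ[HRing] HCompl (PresentedAlg rels ⊗[HRing] PresentedAlg rels)}
    {ε : PresentedAlg rels →ₐ[HRing] HRing} {S : PresentedAlg rels →ₗ[HRing] PresentedAlg rels}
    (hS1 : S 1 = 1) (hSm : ∀ x y, S (x * y) = S y * S x)
    (hg : ∀ i, HCompl.map (mulMap LinearMap.id S) (Δ (gen rels i)) =
      HCompl.of _ (unitCounit ε (gen rels i))) (x : PresentedAlg rels) :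
    HCompl.map (mulMap LinearMap.id S) (Δ x) = HCompl.of _ (unitCounit ε x) := by
  have h : HCompl.map (mulMap LinearMap.id S) ∘ₗ Δ.toLinearMap =
      (HCompl.of (PresentedAlg rels)).toLinearMap ∘ₗ unitCounit ε := by
    refine linearMap_ext ?_ hg fun x y hx hy => ?_
    · change HCompl.map _ (Δ 1) = HCompl.of _ (unitCounit ε 1)
      rw [map_one, ← map_one (HCompl.of _), HCompl.map_of, mulMap_one _ _ rfl hS1, unitCounit_one]
    · change HCompl.map _ (Δ x) = HCompl.of _ (unitCounit ε x) at hx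
      change HCompl.map _ (Δ y) = HCompl.of _ (unitCounit ε y) at hy
      change HCompl.map _ (Δ (x * y)) = HCompl.of _ (unitCounit ε (x * y))
      rw [map_mul, mulMap_antipode_right hSm hy, hx, ← map_smul, ← smul_unitCounit']
      rfl
  exact LinearMap.congr_fun h x

/-- A topological Hopf algebra structure on a presented algebra, for a coproduct such that each
generator `x` satisfies `Δ(x) = k ⊗ x + x ⊗ l` with group-like elements `k`, `l`. -/
def TopHopf.ofGenerators
    (Δ : PresentedAlg rels →ₐ[HRing] HCompl (PresentedAlg rels ⊗[HRing] PresentedAlg rels))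
    (ε : PresentedAlg rels →ₐ[HRing] HRing) (S : PresentedAlg rels →ₗ[HRing] PresentedAlg rels)
    (k l : ι → PresentedAlg rels)
    (hk : ∀ i, Δ (k i) = HCompl.of _ (k i ⊗ₜ k i)) (hl : ∀ i, Δ (l i) = HCompl.of _ (l i ⊗ₜ l i))
    (hg : ∀ i, Δ (PresentedAlg.gen rels i) =
      HCompl.of _ (k i ⊗ₜ PresentedAlg.gen rels i + PresentedAlg.gen rels i ⊗ₜ l i))
    (hεk : ∀ i, ε (k i) = 1) (hεl : ∀ i, ε (l i) = 1)
    (hεg : ∀ i, ε (PresentedAlg.gen rels i) = 0)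
    (hS1 : S 1 = 1) (hSm : ∀ x y, S (x * y) = S y * S x)
    (hSk : ∀ i, k i * S (k i) = 1) (hSl : ∀ i, S (l i) * l i = 1)
    (hSg : ∀ i, S (PresentedAlg.gen rels i) =
      -(S (k i) * PresentedAlg.gen rels i * S (l i))) :
    TopHopf (PresentedAlg rels) where
  comul := Δ
  counit := ε
  antipode := S
  coassoc x := by
    have h : (HCompl.extendAlg (comulLeftAlg Δ)).comp Δ =
        (HCompl.extendAlg (comulRightAlg Δ)).comp Δ :=
      PresentedAlg.algHom_ext fun i => coassoc_twisted (hk i) (hl i) (hg i)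
    rw [← comulLeftAlg_toLinearMap, ← comulRightAlg_toLinearMap]
    exact AlgHom.congr_fun h x
  counit_left x := by
    have h : (HCompl.mapAlg (counitLeftAlg ε)).comp Δ = HCompl.of _ :=
      PresentedAlg.algHom_ext fun i => by
        rw [AlgHom.comp_apply, hg, HCompl.mapAlg_of, counitLeftAlg_twisted (hεk i) (hεg i)]
    rw [← counitLeftAlg_toLinearMap]
    exact AlgHom.congr_fun h x
  counit_right x := by
    have h : (HCompl.mapAlg (counitRightAlg ε)).comp Δ = HCompl.of _ :=
      PresentedAlg.algHom_ext fun i => by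
        rw [AlgHom.comp_apply, hg, HCompl.mapAlg_of, counitRightAlg_twisted (hεl i) (hεg i)]
    rw [← counitRightAlg_toLinearMap]
    exact AlgHom.congr_fun h x
  antipode_left := PresentedAlg.antipode_left hS1 hSm fun i => by
    rw [hg, HCompl.map_of, mulMap_antipode_left_twisted (hSl i) (hSg i),
      unitCounit_eq_zero (hεg i)]
  antipode_right := PresentedAlg.antipode_right hS1 hSm fun i => by
    rw [hg, HCompl.map_of, mulMap_antipode_right_twisted (hSk i) (hSg i),
      unitCounit_eq_zero (hεg i)]

end Construction

/-! ## Power series with coefficients in `U(gl(2))` -/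

/-- Power series with coefficients in a real algebra form an algebra over `ℝ⟦ħ⟧`. -/
abbrev powerSeriesAlgebra (B : Type) [Ring B] [Algebra ℝ B] : Algebra HRing (PowerSeries B) :=
  RingHom.toAlgebra' (PowerSeries.map (algebraMap ℝ B)) (by
    intro c x
    ext n
    rw [PowerSeries.coeff_mul, PowerSeries.coeff_mul, ← Finset.Nat.sum_antidiagonal_swap]
    refine Finset.sum_congr rfl fun p _ => ?_
    simp only [PowerSeries.coeff_map, Prod.fst_swap, Prod.snd_swap]
    exact Algebra.commutes _ _)

theorem powerSeriesAlgebra_X_smul {B : Type} [Ring B] [Algebra ℝ B] (f : PowerSeries B) :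
    letI := powerSeriesAlgebra B
    ħ • f = PowerSeries.X * f := by
  let _ := powerSeriesAlgebra B
  rw [Algebra.smul_def]
  congr 1
  exact PowerSeries.map_X _

/-- The algebra `U(gl(2))⟦ħ⟧`. -/
def UglSeries : Type := PowerSeries (UniversalEnvelopingAlgebra ℝ GL2)

namespace UglSeries

instance : Ring UglSeries := inferInstanceAs (Ring (PowerSeries _))

instance : Algebra HRing UglSeries := powerSeriesAlgebra (UniversalEnvelopingAlgebra ℝ GL2)

instance : HComplete UglSeries :=
  letI := powerSeriesAlgebra (UniversalEnvelopingAlgebra ℝ GL2)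
  hComplete_powerSeries powerSeriesAlgebra_X_smul

instance : HTorsionFree UglSeries :=
  letI := powerSeriesAlgebra (UniversalEnvelopingAlgebra ℝ GL2)
  hTorsionFree_powerSeries powerSeriesAlgebra_X_smul

/-- Constant power series. -/
def C : UniversalEnvelopingAlgebra ℝ GL2 →+* UglSeries := PowerSeries.C

/-- The reduction at `ħ = 0`. -/
def const : UglSeries →+* UniversalEnvelopingAlgebra ℝ GL2 :=
  PowerSeries.constantCoeff (R := UniversalEnvelopingAlgebra ℝ GL2)

theorem const_C (x : UniversalEnvelopingAlgebra ℝ GL2) : const (C x) = x :=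
  PowerSeries.constantCoeff_C x

theorem const_algebraMap (c : HRing) : const (algebraMap HRing UglSeries c) =
    algebraMap ℝ _ (PowerSeries.constantCoeff c) := by
  change PowerSeries.constantCoeff (PowerSeries.map _ c) = _
  rw [← PowerSeries.coeff_zero_eq_constantCoeff_apply, PowerSeries.coeff_map,
    PowerSeries.coeff_zero_eq_constantCoeff_apply]

theorem const_smul (c : HRing) (x : UglSeries) :
    const (c • x) = PowerSeries.constantCoeff c • const x := by
  rw [Algebra.smul_def, map_mul, const_algebraMap, ← Algebra.smul_def]

theorem C_smul (t : ℝ) (x : UniversalEnvelopingAlgebra ℝ GL2) :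
    C (t • x) = (PowerSeries.C t : HRing) • C x := by
  rw [Algebra.smul_def, Algebra.smul_def, map_mul]
  congr 1
  exact (PowerSeries.map_C _ _).symm

end UglSeries

/-! ## Constant terms of the relations -/

section ConstantTerms

variable {T : Type} [Ring T] [Algebra HRing T] [HComplete T] {ι : Type}

theorem evalSeries_eq_add (v : ι → T) (f : FreeSeries ι) :
    ∃ y : T, evalSeries v f = evalFree v (PowerSeries.constantCoeff f) + ħ • y := by
  refine ⟨hSum fun n => evalFree v (PowerSeries.coeff (n + 1) f), ?_⟩
  rw [evalSeries_apply, hSum_succ, PowerSeries.coeff_zero_eq_constantCoeff_apply]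

theorem FreeSeries.constantCoeff_smul (c : HRing) (f : FreeSeries ι) :
    PowerSeries.constantCoeff (c • f) =
      PowerSeries.constantCoeff c • PowerSeries.constantCoeff f := by
  rw [Algebra.smul_def, map_mul, Algebra.smul_def]
  congr 1

theorem constantCoeff_real_smul {B : Type} [Ring B] [Algebra ℝ B] (c : ℝ) (f : PowerSeries B) :
    PowerSeries.constantCoeff (c • f) = c • PowerSeries.constantCoeff f := by
  rw [← PowerSeries.coeff_zero_eq_constantCoeff_apply, PowerSeries.coeff_smul,
    PowerSeries.coeff_zero_eq_constantCoeff_apply]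

theorem constantCoeff_hDiv {B : Type} [Ring B] (f : PowerSeries B) :
    PowerSeries.constantCoeff (hDiv f) = PowerSeries.coeff 1 f := by
  rw [← PowerSeries.coeff_zero_eq_constantCoeff_apply, hDiv, PowerSeries.coeff_mk]

theorem constantCoeff_hExp {B : Type} [Ring B] [Algebra ℝ B] (t : ℝ) (x : B) :
    PowerSeries.constantCoeff (hExp t x) = 1 := by
  rw [← PowerSeries.coeff_zero_eq_constantCoeff_apply, hExp, PowerSeries.coeff_mk]
  simp

theorem coeff_one_hSinh {B : Type} [Ring B] [Algebra ℝ B] (t : ℝ) (x : B) :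
    PowerSeries.coeff 1 (hSinh t x) = t • x := by
  simp only [hSinh, hExp, PowerSeries.coeff_smul, map_sub, PowerSeries.coeff_mk, pow_one,
    Nat.factorial_one, Nat.cast_one, div_one, neg_smul, sub_neg_eq_add, ← two_smul ℝ (t • x),
    ← mul_smul]
  congr 1
  ring

theorem constantCoeff_qHalf {a : ℝ} (ha : a ≠ 0) (J : ι) :
    PowerSeries.constantCoeff (qHalf a J) = FreeAlgebra.ι ℝ J := by
  rw [qHalf, constantCoeff_real_smul, constantCoeff_hDiv, coeff_one_hSinh, ← mul_smul]
  field_simp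
  exact one_smul _ _

theorem constantCoeff_qFull {a : ℝ} (ha : a ≠ 0) (J : ι) :
    PowerSeries.constantCoeff (qFull a J) = FreeAlgebra.ι ℝ J := by
  rw [qFull, constantCoeff_real_smul, constantCoeff_hDiv, coeff_one_hSinh, ← mul_smul]
  field_simp
  exact one_smul _ _

theorem constantCoeff_qScalar {a : ℝ} (ha : a ≠ 0) :
    PowerSeries.constantCoeff (qScalar a) = 1 / 2 := by
  rw [qScalar, constantCoeff_real_smul, constantCoeff_hDiv]
  simp [hExp, PowerSeries.coeff_one]
  field_simp

theorem constantCoeff_fgen (i : ι) : PowerSeries.constantCoeff (fgen i) = FreeAlgebra.ι ℝ i :=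
  PowerSeries.constantCoeff_C _

theorem constantCoeff_casimirSeries {ap a : ℝ} (ha : a ≠ 0) (J P M : ι) :
    PowerSeries.constantCoeff (casimirSeries ap a J P M) =
      FreeAlgebra.ι ℝ J ^ 2 + (ap / a) • (FreeAlgebra.ι ℝ J * FreeAlgebra.ι ℝ P +
        FreeAlgebra.ι ℝ P * FreeAlgebra.ι ℝ J) + (ap ^ 2 / a ^ 2) • FreeAlgebra.ι ℝ P ^ 2 +
      (2 : ℝ) • (FreeAlgebra.ι ℝ P * FreeAlgebra.ι ℝ M + FreeAlgebra.ι ℝ M * FreeAlgebra.ι ℝ P) := by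
  have h1 : PowerSeries.coeff 2 (hCosh a (FreeAlgebra.ι ℝ J) - 1) =
      (a ^ 2 / 2) • FreeAlgebra.ι ℝ J ^ 2 := by
    simp only [hCosh, hExp, PowerSeries.coeff_smul, map_sub, map_add, PowerSeries.coeff_mk,
      PowerSeries.coeff_one, OfNat.ofNat_ne_zero, if_false, sub_zero, Nat.factorial_two, neg_sq,
      ← two_smul ℝ ((a ^ 2 / ((2 : ℕ) : ℝ)) • FreeAlgebra.ι ℝ J ^ 2), ← mul_smul]
    congr 1
    push_cast
    ring
  have hc0 : PowerSeries.constantCoeff (hCosh a (1 : ℝ)) = 1 := by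
    have := constantCoeff_hCosh_sub_one a (1 : ℝ)
    rwa [map_sub, map_one, sub_eq_zero] at this
  have ht1 : PowerSeries.coeff 1 (hTanh a) = a := by
    rw [hTanh, PowerSeries.coeff_mul, Finset.Nat.antidiagonal_succ]
    simp [constantCoeff_hSinh, coeff_one_hSinh, hc0]
  have h2 : PowerSeries.constantCoeff ((2 / a) • (hDiv (hTanh a))⁻¹ : HRing) = 2 / a * a⁻¹ := by
    rw [constantCoeff_real_smul, PowerSeries.constantCoeff_inv, constantCoeff_hDiv, ht1,
      smul_eq_mul]
  rw [casimirSeries, map_add, map_add, map_add, FreeSeries.constantCoeff_smul, h2,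
    constantCoeff_hDiv, hDiv, PowerSeries.coeff_mk, h1]
  simp only [constantCoeff_real_smul, map_add, map_mul, map_pow, constantCoeff_fgen,
    constantCoeff_qHalf ha, ← mul_smul]
  -- The constant term of 2ħ/(a tanh(aħ)) is 2/a², and (cosh(aħJ) - 1)/ħ² starts with (a²/2)J².
  have h3 : 2 / a * a⁻¹ * (a ^ 2 / 2) = 1 := by field_simp
  rw [h3, one_smul]

end ConstantTerms

/-! ## The lift of the reduction map to `U(gl(2))⟦ħ⟧` -/

section Reduction

variable {ap a : ℝ}

theorem ugl_comm (x y : GL2) : ugl x * ugl y - ugl y * ugl x = ugl (x * y - y * x) := by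
  have h := LieHom.map_lie (UniversalEnvelopingAlgebra.ι ℝ : GL2 →ₗ⁅ℝ⁆ _) x y
  rw [LieRing.of_associative_ring_bracket, LieRing.of_associative_ring_bracket] at h
  exact h.symm

theorem C_ugl_comm (x y : GL2) : UglSeries.C (ugl x) * UglSeries.C (ugl y) -
    UglSeries.C (ugl y) * UglSeries.C (ugl x) = UglSeries.C (ugl (x * y - y * x)) := by
  rw [← ugl_comm, map_sub, map_mul, map_mul]

/-- The reductions of the generators. -/
def uglGen (ap a : ℝ) : GlGen → UniversalEnvelopingAlgebra ℝ GL2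
  | GlGen.J3 => ugl (GL2.J3 - (ap / a) • GL2.Jp)
  | GlGen.Jp => ugl GL2.Jp
  | GlGen.Jm => ugl GL2.Jm
  | GlGen.I => ugl GL2.I

/-- The sl(2)-triple in gl(2) corresponding to the shifted generators is deformed by
`exists_isDJTriple`, and the change of generator is then undone. This gives images that satisfy the
quantum relations and have the prescribed reductions. -/
theorem exists_lift_uglGen (ap : ℝ) {a : ℝ} (ha : a ≠ 0) : ∃ v : GlGen → UglSeries,
    (∀ r ∈ glRels ap a, evalSeries v r = 0) ∧ ∀ i, UglSeries.const (v i) = uglGen ap a i := by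
  set r : ℝ := ap / a with hr
  -- This is the value of the shifted generator at ħ = 0, where s becomes J₃' = J₃ - rJ₊.
  set f₀ : GL2 := GL2.Jm + (r / 2) • (GL2.J3 - r • GL2.Jp) + (r ^ 2 / 4) • GL2.Jp with hf₀
  set h := UglSeries.C (ugl (GL2.J3 - r • GL2.Jp)) with hh
  set e := UglSeries.C (ugl GL2.Jp) with he
  set f := UglSeries.C (ugl f₀) with hf
  set i := UglSeries.C (ugl GL2.I) with hi
  have hC : ∀ (t : ℝ) (x : GL2), UglSeries.C (ugl (t • x)) =
      (PowerSeries.C t : HRing) • UglSeries.C (ugl x) := fun t x => by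
    rw [← UglSeries.C_smul, ugl, ugl, map_smul]
  have hhe : h * e - e * h = (2 : HRing) • e := by
    rw [hh, he, C_ugl_comm, ← map_ofNat (PowerSeries.C : ℝ →+* HRing), ← hC]
    congr 2
    ext i j
    fin_cases i <;> fin_cases j <;> simp [GL2.J3, GL2.Jp] <;>
      norm_num
  have hhf : h * f - f * h = -((2 : HRing) • f) := by
    rw [hh, hf, C_ugl_comm, ← neg_smul, ← map_ofNat (PowerSeries.C : ℝ →+* HRing), ← map_neg, ← hC]
    congr 2
    ext i j
    fin_cases i <;> fin_cases j <;>
      simp [hf₀, GL2.J3, GL2.Jp, GL2.Jm] <;> ring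
  have hef : e * f - f * e = h := by
    rw [he, hf, C_ugl_comm, hh]
    congr 2
    ext i j
    fin_cases i <;> fin_cases j <;>
      simp [hf₀, GL2.J3, GL2.Jp, GL2.Jm] <;> ring
  have hI : ∀ x : GL2, Commute i (UglSeries.C (ugl x)) := fun x => by
    have h1 : (GL2.I : GL2) = 1 := by
      ext i j
      fin_cases i <;> fin_cases j <;> simp [GL2.I]
    refine sub_eq_zero.1 ?_
    rw [hi, C_ugl_comm, h1, one_mul, mul_one, sub_self, ugl, map_zero, map_zero]
  obtain ⟨n, s, w, hn, hnw, hcomm⟩ := exists_isDJTriple ha hhe hhf hef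
  -- The series s involves a single generator, so it can be evaluated at h before images of the
  -- other generators are fixed.
  obtain ⟨y, hy⟩ := evalSeries_eq_add (fun _ : Unit => h) (qHalf a ())
  have hhalf := evalSeries_qHalf (fun _ : Unit => h) ha ()
  rw [constantCoeff_qHalf ha, evalFree_ι] at hy
  generalize evalSeries (fun _ : Unit => h) (qHalf a ()) = σ at hy hhalf
  set c : HRing := PowerSeries.C (1 / 2) * PowerSeries.C r with hc
  refine ⟨fun g => match g with
    | GlGen.J3 => h
    | GlGen.Jp => e
    | GlGen.Jm => n - c • σ - c ^ 2 • e
    | GlGen.I => i, ?_, ?_⟩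
  · have hQ : IsQTriple ap a h e (n - c • σ - c ^ 2 • e) σ s :=
      hn.isQTriple ha hhalf (shiftGen_eq_iff.2 rfl)
    rintro q (hq | ⟨g, rfl⟩)
    · exact hQ.slRels ha _ _ _ _ q hq
    · simp only [qComm, map_sub, map_mul, evalSeries_fgen]
      refine sub_eq_zero.2 ?_
      have hiσ : Commute i σ := (commute_half ha hhalf (hI _).symm).symm
      cases g with
      | J3 => exact hI _
      | Jp => exact hI _
      | Jm =>
        have h1 : Commute i (n - c • σ) :=
          (hcomm i (hI _) (hI _) (hI _)).sub_right (hiσ.smul_right c)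
        exact h1.sub_right ((hI _).smul_right (c ^ 2))
      | I => rfl
  · rintro (_ | _ | _ | _)
    · exact UglSeries.const_C _
    · exact UglSeries.const_C _
    · change UglSeries.const (n - c • σ - c ^ 2 • e) = ugl GL2.Jm
      have hX : ∀ w : UglSeries, UglSeries.const (ħ • w) = 0 := fun w => by
        rw [UglSeries.const_smul, PowerSeries.constantCoeff_X, zero_smul]
      have hJm : GL2.Jm = f₀ - ((1 / 2) * r) • (GL2.J3 - r • GL2.Jp) -
          ((1 / 2) * r) ^ 2 • GL2.Jp := by
        rw [hf₀]
        module
      rw [map_sub, map_sub, UglSeries.const_smul, UglSeries.const_smul, hnw, hy, map_add, map_add,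
        hX, hX, add_zero, add_zero, UglSeries.const_C, UglSeries.const_C, UglSeries.const_C, hc,
        map_pow, map_mul, PowerSeries.constantCoeff_C, PowerSeries.constantCoeff_C]
      conv_rhs => rw [hJm]
      simp only [ugl, map_sub, map_smul]
    · exact UglSeries.const_C _

end Reduction

/-! ### The quantum algebra modulo ħ as a quotient of U(gl(2)) -/

section Kernel

attribute [local instance 2000] Semiring.toNatAlgebra Ring.toIntAlgebra

/-- The universal property of `U(gl(2))`, in terms of a basis of `gl(2)`. -/
theorem exists_ringHom_ugl {R : Type} [Ring R] [Algebra HRing R] {j p m i : R}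
    (jp : j * p - p * j = (2 : HRing) • p) (jm : j * m - m * j = -((2 : HRing) • m))
    (pm : p * m - m * p = j) (ij : i * j - j * i = 0) (ip : i * p - p * i = 0)
    (im : i * m - m * i = 0) :
    ∃ θ : UniversalEnvelopingAlgebra ℝ GL2 →+* R,
      (∀ t : ℝ, θ (algebraMap ℝ _ t) = algebraMap HRing R (PowerSeries.C t)) ∧
      θ (ugl GL2.J3) = j ∧ θ (ugl GL2.Jp) = p ∧ θ (ugl GL2.Jm) = m ∧ θ (ugl GL2.I) = i := by
  let _ : Algebra ℝ R := Algebra.compHom R (PowerSeries.C : ℝ →+* HRing)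
  have hsmul : ∀ (t : ℝ) (x : R), t • x = (PowerSeries.C t : HRing) • x := fun _ _ => rfl
  let L : GL2 →ₗ⁅ℝ⁆ R :=
    { toFun := fun x => (PowerSeries.C ((x 0 0 - x 1 1) / 2) : HRing) • j +
        (PowerSeries.C (x 0 1) : HRing) • p + (PowerSeries.C (x 1 0) : HRing) • m +
        (PowerSeries.C ((x 0 0 + x 1 1) / 2) : HRing) • i
      map_add' := by
        intro x y
        have h1 : ((x + y) 0 0 - (x + y) 1 1) / 2 = (x 0 0 - x 1 1) / 2 + (y 0 0 - y 1 1) / 2 := by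
          simp only [Matrix.add_apply]
          ring
        have h2 : ((x + y) 0 0 + (x + y) 1 1) / 2 = (x 0 0 + x 1 1) / 2 + (y 0 0 + y 1 1) / 2 := by
          simp only [Matrix.add_apply]
          ring
        rw [h1, h2, Matrix.add_apply, Matrix.add_apply, map_add, map_add, map_add, map_add]
        module
      map_smul' := by
        intro t x
        have h1 : ((t • x) 0 0 - (t • x) 1 1) / 2 = t * ((x 0 0 - x 1 1) / 2) := by
          simp only [Matrix.smul_apply, smul_eq_mul]
          ring
        have h2 : ((t • x) 0 0 + (t • x) 1 1) / 2 = t * ((x 0 0 + x 1 1) / 2) := by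
          simp only [Matrix.smul_apply, smul_eq_mul]
          ring
        rw [h1, h2, Matrix.smul_apply, Matrix.smul_apply, smul_eq_mul, smul_eq_mul, map_mul,
          map_mul, map_mul, map_mul, RingHom.id_apply, hsmul]
        module
      map_lie' := by
        intro x y
        have h1 : (⁅x, y⁆ 0 0 - ⁅x, y⁆ 1 1) / 2 = x 0 1 * y 1 0 - x 1 0 * y 0 1 := by
          simp only [LieRing.of_associative_ring_bracket, Matrix.sub_apply, Matrix.mul_apply,
            Fin.sum_univ_two]
          ring
        have h2 : (⁅x, y⁆ 0 0 + ⁅x, y⁆ 1 1) / 2 = 0 := by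
          simp only [LieRing.of_associative_ring_bracket, Matrix.sub_apply, Matrix.mul_apply,
            Fin.sum_univ_two]
          ring
        have h3 : ⁅x, y⁆ 0 1 =
            2 * ((x 0 0 - x 1 1) / 2 * y 0 1 - x 0 1 * ((y 0 0 - y 1 1) / 2)) := by
          simp only [LieRing.of_associative_ring_bracket, Matrix.sub_apply, Matrix.mul_apply,
            Fin.sum_univ_two]
          ring
        have h4 : ⁅x, y⁆ 1 0 =
            2 * (x 1 0 * ((y 0 0 - y 1 1) / 2) - (x 0 0 - x 1 1) / 2 * y 1 0) := by
          simp only [LieRing.of_associative_ring_bracket, Matrix.sub_apply, Matrix.mul_apply,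
            Fin.sum_univ_two]
          ring
        rw [h1, h2, h3, h4, LieRing.of_associative_ring_bracket]
        simp only [map_mul, map_sub, map_ofNat, map_zero, zero_smul, add_zero]
        generalize (PowerSeries.C ((x 0 0 - x 1 1) / 2) : HRing) = x3
        generalize (PowerSeries.C ((y 0 0 - y 1 1) / 2) : HRing) = y3
        generalize (PowerSeries.C ((x 0 0 + x 1 1) / 2) : HRing) = xi
        generalize (PowerSeries.C ((y 0 0 + y 1 1) / 2) : HRing) = yi
        generalize (PowerSeries.C (x 0 1) : HRing) = xp
        generalize (PowerSeries.C (y 0 1) : HRing) = yp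
        generalize (PowerSeries.C (x 1 0) : HRing) = xm
        generalize (PowerSeries.C (y 1 0) : HRing) = ym
        simp only [mul_add, add_mul, smul_mul_assoc, mul_smul_comm]
        linear_combination (norm := module) (-(x3 * yp - xp * y3)) • jp - (x3 * ym - xm * y3) • jm -
          (xp * ym - xm * yp) • pm - (xi * y3 - x3 * yi) • ij - (xi * yp - xp * yi) • ip -
          (xi * ym - xm * yi) • im }
  refine ⟨(UniversalEnvelopingAlgebra.lift ℝ L).toRingHom,
    fun t => (UniversalEnvelopingAlgebra.lift ℝ L).commutes t, ?_, ?_, ?_, ?_⟩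
  · refine (UniversalEnvelopingAlgebra.lift_ι_apply ℝ L GL2.J3).trans ?_
    change (PowerSeries.C ((GL2.J3 0 0 - GL2.J3 1 1) / 2) : HRing) • j +
        (PowerSeries.C (GL2.J3 0 1) : HRing) • p + (PowerSeries.C (GL2.J3 1 0) : HRing) • m +
        (PowerSeries.C ((GL2.J3 0 0 + GL2.J3 1 1) / 2) : HRing) • i = j
    simp [GL2.J3]
  · refine (UniversalEnvelopingAlgebra.lift_ι_apply ℝ L GL2.Jp).trans ?_
    change (PowerSeries.C ((GL2.Jp 0 0 - GL2.Jp 1 1) / 2) : HRing) • j +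
        (PowerSeries.C (GL2.Jp 0 1) : HRing) • p + (PowerSeries.C (GL2.Jp 1 0) : HRing) • m +
        (PowerSeries.C ((GL2.Jp 0 0 + GL2.Jp 1 1) / 2) : HRing) • i = p
    simp [GL2.Jp]
  · refine (UniversalEnvelopingAlgebra.lift_ι_apply ℝ L GL2.Jm).trans ?_
    change (PowerSeries.C ((GL2.Jm 0 0 - GL2.Jm 1 1) / 2) : HRing) • j +
        (PowerSeries.C (GL2.Jm 0 1) : HRing) • p + (PowerSeries.C (GL2.Jm 1 0) : HRing) • m +
        (PowerSeries.C ((GL2.Jm 0 0 + GL2.Jm 1 1) / 2) : HRing) • i = m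
    simp [GL2.Jm]
  · refine (UniversalEnvelopingAlgebra.lift_ι_apply ℝ L GL2.I).trans ?_
    change (PowerSeries.C ((GL2.I 0 0 - GL2.I 1 1) / 2) : HRing) • j +
        (PowerSeries.C (GL2.I 0 1) : HRing) • p + (PowerSeries.C (GL2.I 1 0) : HRing) • m +
        (PowerSeries.C ((GL2.I 0 0 + GL2.I 1 1) / 2) : HRing) • i = i
    simp [GL2.I]

variable {ap a : ℝ}

theorem const_evalSeries {ι : Type} (v : ι → UglSeries) (f : FreeSeries ι) :
    UglSeries.const (evalSeries v f) =
      FreeAlgebra.lift ℝ (fun i => UglSeries.const (v i)) (PowerSeries.constantCoeff f) := by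
  obtain ⟨y, hy⟩ := evalSeries_eq_add v f
  rw [hy, map_add, UglSeries.const_smul, PowerSeries.constantCoeff_X, zero_smul, add_zero]
  generalize PowerSeries.constantCoeff f = x
  induction x using FreeAlgebra.induction with
  | grade0 r => rw [evalFree_algebraMap, UglSeries.const_algebraMap, AlgHom.commutes,
      PowerSeries.constantCoeff_C]
  | grade1 i => rw [evalFree_ι, FreeAlgebra.lift_ι_apply]
  | mul x y hx hy => rw [map_mul, map_mul, map_mul, hx, hy]
  | add x y hx hy => rw [map_add, map_add, map_add, hx, hy]

/-- In the presented algebra, the constant terms of the relations vanish modulo `ħ`. -/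
theorem hMk_evalFree_rel {ι : Type} {rels : Set (FreeSeries ι)} {f : FreeSeries ι} (h : f ∈ rels) :
    hMk (PresentedAlg rels) 1 (evalFree (PresentedAlg.gen rels) (PowerSeries.constantCoeff f)) =
      0 := by
  obtain ⟨y, hy⟩ := evalSeries_eq_add (PresentedAlg.gen rels) f
  rw [← PresentedAlg.mk_eq_evalSeries, PresentedAlg.mk_rel h, eq_comm, ← eq_neg_iff_add_eq_zero]
    at hy
  rw [hy]
  exact Ideal.Quotient.eq_zero_iff_mem.2 ⟨-y, by rw [pow_one, smul_neg]⟩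

theorem hMk_one_smul_eq_zero {B : Type} [Ring B] [Algebra HRing B] (x : B) :
    hMk B 1 (ħ • x) = 0 :=
  Ideal.Quotient.eq_zero_iff_mem.2 ⟨x, by rw [pow_one]⟩

/-- The hypotheses are the relations at ħ = 0. Replacing j by j + rp, which plays the role of J₃,
turns them into the standard relations of gl(2). -/
theorem exists_ringHom_uglGen {R : Type} [Ring R] [Algebra HRing R] {j p m i : R} (r : ℝ)
    (jp : j * p - p * j = (2 : HRing) • p)
    (jm : j * m - m * j = -((2 : HRing) • m) - (PowerSeries.C r : HRing) • j -
      (PowerSeries.C r ^ 2 : HRing) • p)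
    (pm : p * m - m * p = j + (PowerSeries.C r : HRing) • p) (ij : i * j - j * i = 0)
    (ip : i * p - p * i = 0) (im : i * m - m * i = 0) :
    ∃ θ : UniversalEnvelopingAlgebra ℝ GL2 →+* R,
      (∀ t : ℝ, θ (algebraMap ℝ _ t) = algebraMap HRing R (PowerSeries.C t)) ∧
      θ (ugl (GL2.J3 - r • GL2.Jp)) = j ∧ θ (ugl GL2.Jp) = p ∧ θ (ugl GL2.Jm) = m ∧
      θ (ugl GL2.I) = i := by
  obtain ⟨θ, hθ, h3, hp, hm, hi⟩ := exists_ringHom_ugl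
    (j := j + (PowerSeries.C r : HRing) • p) (p := p) (m := m) (i := i)
    (by
      simp only [add_mul, mul_add, smul_mul_assoc, mul_smul_comm]
      linear_combination (norm := module) jp)
    (by
      simp only [add_mul, mul_add, smul_mul_assoc, mul_smul_comm]
      linear_combination (norm := module) jm + (PowerSeries.C r : HRing) • pm) pm
    (by
      simp only [add_mul, mul_add, smul_mul_assoc, mul_smul_comm]
      linear_combination (norm := module) ij + (PowerSeries.C r : HRing) • ip) ip im
  refine ⟨θ, hθ, ?_, hp, hm, hi⟩
  have h1 : ugl (GL2.J3 - r • GL2.Jp) = ugl GL2.J3 - r • ugl GL2.Jp := by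
    simp only [ugl, map_sub, map_smul]
  rw [h1, map_sub, h3, Algebra.smul_def r, map_mul, hθ, hp, ← Algebra.smul_def,
    add_sub_cancel_right]

/-- Modulo `ħ`, the quantum algebra is a quotient of `U(gl(2))`. -/
theorem exists_ringHom_hMk_one (ap : ℝ) {a : ℝ} (ha : a ≠ 0) :
    ∃ θ : UniversalEnvelopingAlgebra ℝ GL2 →+* QGl ap a ⧸ hIdeal (QGl ap a) 1,
      (∀ t : ℝ, θ (algebraMap ℝ _ t) = algebraMap HRing _ (PowerSeries.C t)) ∧
      ∀ i, θ (uglGen ap a i) = hMk (QGl ap a) 1 (QGl.gen ap a i) := by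
  have hrel : ∀ {f}, f ∈ glRels ap a → hMk (QGl ap a) 1
      (evalFree (PresentedAlg.gen (glRels ap a)) (PowerSeries.constantCoeff f)) = 0 :=
    fun h => hMk_evalFree_rel h
  have h1 := hrel (Or.inl (Or.inl rfl))
  have h2 := hrel (Or.inl (Or.inr (Or.inl rfl)))
  have h3 := hrel (Or.inl (Or.inr (Or.inr rfl)))
  have hI : ∀ i : GlGen, _ := fun i => hrel (Or.inr ⟨i, rfl⟩)
  simp only [qComm, map_sub, map_mul, map_add, map_neg, constantCoeff_fgen, constantCoeff_real_smul,
    FreeSeries.constantCoeff_smul, constantCoeff_qHalf ha, constantCoeff_qFull ha,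
    constantCoeff_qScalar ha, constantCoeff_hExp, one_mul, mul_one, evalFree_ι, evalFree_smul,
    map_smul] at h1 h2 h3 hI
  have hgen : ∀ i, hMk (QGl ap a) 1 (PresentedAlg.gen (glRels ap a) i) =
    hMk (QGl ap a) 1 (QGl.gen ap a i) := fun _ => rfl
  simp only [hgen] at h1 h2 h3 hI
  have hI3 := hI GlGen.J3
  have hIp := hI GlGen.Jp
  have hIm := hI GlGen.Jm
  clear hI hrel
  -- At ħ = 0 the exponentials are 1 and the scalar (eᵃ - 1)/(2a) is 1/2, so the two summands of the
  -- a₊-term add up to one copy of J₊.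
  have hhalf : (PowerSeries.C (1 / 2) : HRing) • hMk (QGl ap a) 1 (QGl.gen ap a GlGen.Jp) +
      (PowerSeries.C (1 / 2) : HRing) • hMk (QGl ap a) 1 (QGl.gen ap a GlGen.Jp) =
      hMk (QGl ap a) 1 (QGl.gen ap a GlGen.Jp) := by
    rw [← add_smul, ← two_mul, two_mul_C_half, one_smul]
  rw [smul_add, hhalf] at h3
  rw [← div_pow, map_pow] at h2
  rw [map_ofNat] at h1 h2
  obtain ⟨θ, hθ, h4, h5, h6, h7⟩ := exists_ringHom_uglGen (ap / a) (sub_eq_zero.1 h1)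
    (sub_eq_zero.1 h2) (sub_eq_zero.1 h3) hI3 hIp hIm
  refine ⟨θ, hθ, ?_⟩
  rintro (_ | _ | _ | _)
  exacts [h4, h5, h6, h7]

end Kernel

/-! ## The quantum algebra is topologically free -/

section Free

variable {ap a : ℝ}

/-- The reduction map of the quantum algebra, with its lift to `U(gl(2))⟦ħ⟧`. -/
theorem QGl.exists_lift (ap : ℝ) {a : ℝ} (ha : a ≠ 0) : ∃ ψ : QGl ap a →ₐ[HRing] UglSeries,
    (∀ i, UglSeries.const (ψ (QGl.gen ap a i)) = uglGen ap a i) ∧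
    (∀ f, UglSeries.const (ψ (PresentedAlg.mk _ f)) =
      FreeAlgebra.lift ℝ (uglGen ap a) (PowerSeries.constantCoeff f)) ∧
    (∀ x, UglSeries.const (ψ x) = 0 → ∃ y, x = ħ • y) := by
  obtain ⟨v, hv, hc⟩ := exists_lift_uglGen ap ha
  have hmk : ∀ f, UglSeries.const (PresentedAlg.lift v hv (PresentedAlg.mk _ f)) =
      FreeAlgebra.lift ℝ (uglGen ap a) (PowerSeries.constantCoeff f) := fun f => by
    rw [PresentedAlg.lift_mk, const_evalSeries]
    congr 2
    exact funext hc
  refine ⟨PresentedAlg.lift v hv, fun i => ?_, hmk, fun x hx => ?_⟩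
  · rw [← hc]
    exact congrArg _ (PresentedAlg.lift_gen v hv i)
  · obtain ⟨θ, hθ, hg⟩ := exists_ringHom_hMk_one ap ha
    obtain ⟨f, rfl⟩ := PresentedAlg.mk_surjective x
    rw [hmk] at hx
    obtain ⟨y, hy⟩ := evalSeries_eq_add (PresentedAlg.gen (glRels ap a)) f
    -- θ composed with the reduction is the quotient map modulo ħ. Therefore an element that reduces
    -- to zero is a multiple of ħ.
    have h1 : ∀ x : FreeAlgebra ℝ GlGen, θ (FreeAlgebra.lift ℝ (uglGen ap a) x) =
        hMk (QGl ap a) 1 (evalFree (PresentedAlg.gen (glRels ap a)) x) := by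
      intro x
      induction x using FreeAlgebra.induction with
      | grade0 r => rw [AlgHom.commutes, hθ, evalFree_algebraMap, AlgHom.commutes]
      | grade1 i =>
        rw [FreeAlgebra.lift_ι_apply, hg, evalFree_ι]
        rfl
      | mul x y hx hy => rw [map_mul, map_mul, map_mul, map_mul, hx, hy]
      | add x y hx hy => rw [map_add, map_add, map_add, map_add, hx, hy]
    have h2 : hMk (QGl ap a) 1 (PresentedAlg.mk _ f) = 0 := by
      rw [PresentedAlg.mk_eq_evalSeries, hy, map_add, ← h1, hx, map_zero, hMk_one_smul_eq_zero,
        add_zero]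
    obtain ⟨z, hz⟩ := Ideal.Quotient.eq_zero_iff_mem.1 h2
    exact ⟨z, by rw [← hz, pow_one]⟩

/-- The lift to U(gl(2))⟦ħ⟧ is injective: an element of its kernel is ħ times another element of its
kernel, hence divisible by every ħⁿ, hence zero. -/
theorem QGl.hTorsionFree (ap : ℝ) {a : ℝ} (ha : a ≠ 0) : HTorsionFree (QGl ap a) := by
  obtain ⟨ψ, -, -, hker⟩ := QGl.exists_lift ap ha
  refine HTorsionFree.of_injective ψ.toLinearMap ((injective_iff_map_eq_zero _).2 fun x hx => ?_)
  refine HComplete.sep x fun n => ?_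
  have key : ∀ n : ℕ, ∃ y, ψ y = 0 ∧ x = ħ ^ n • y := by
    intro n
    induction n with
    | zero => exact ⟨x, hx, by rw [pow_zero, one_smul]⟩
    | succ n ih =>
      obtain ⟨y, hy, rfl⟩ := ih
      obtain ⟨z, rfl⟩ := hker y (by rw [hy, map_zero])
      refine ⟨z, HTorsionFree.eq_zero _ ?_, by rw [← mul_smul, ← pow_succ]⟩
      rw [← map_smul, hy]
  obtain ⟨y, -, hy⟩ := key n
  exact ⟨y, hy⟩

/-- Complete algebras in the sense of convergence of series are adically complete. -/
theorem HComplete.isAdicComplete {T : Type} [Ring T] [Algebra HRing T] [HComplete T] :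
    IsAdicComplete (Ideal.span {(PowerSeries.X : HRing)}) T := by
  have hmem : ∀ (n : ℕ) (x : T),
      x ∈ (Ideal.span {(PowerSeries.X : HRing)} ^ n • ⊤ : Submodule HRing T) ↔
        ∃ y, x = ħ ^ n • y := by
    intro n x
    rw [Ideal.span_singleton_pow, Submodule.ideal_span_singleton_smul,
      Submodule.mem_smul_pointwise_iff_exists]
    constructor
    · rintro ⟨y, -, rfl⟩
      exact ⟨y, rfl⟩
    · rintro ⟨y, rfl⟩
      exact ⟨y, trivial, rfl⟩
  refine { haus' := fun x hx => HComplete.sep x fun n => ?_, prec' := fun f hf => ?_ }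
  · have := hx n
    rwa [SModEq.zero, hmem] at this
  · have h1 : ∀ n, ∃ y, f (n + 1) - f n = ħ ^ n • y := fun n => by
      have := hf (Nat.le_succ n)
      rw [SModEq.comm, SModEq.sub_mem, hmem] at this
      exact this
    choose g hg using h1
    refine ⟨f 0 + hSum g, fun n => ?_⟩
    obtain ⟨y, hy⟩ := hSum_spec g n
    rw [SModEq.comm, SModEq.sub_mem, hmem]
    refine ⟨y, ?_⟩
    rw [hy]
    simp only [← hg]
    rw [Finset.sum_range_sub]
    abel

end Free

/-! ## The quantum `sl(2)` inside the quantum `gl(2)` -/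

section Subalgebra

variable {T : Type} [Ring T] [Algebra HRing T] [HComplete T] {ι κ : Type} {ap a : ℝ}

theorem evalSeries_qHalf_congr {v : ι → T} {w : κ → T} {J : ι} {J' : κ} (h : v J = w J') :
    evalSeries v (qHalf a J) = evalSeries w (qHalf a J') := by
  rw [evalSeries_apply, evalSeries_apply]
  congr 1
  funext n
  simp only [qHalf, hDiv, hSinh, hExp, PowerSeries.coeff_smul, PowerSeries.coeff_mk, map_sub,
    evalFree_smul, map_pow, evalFree_ι, h]

theorem evalSeries_qFull_congr {v : ι → T} {w : κ → T} {J : ι} {J' : κ} (h : v J = w J') :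
    evalSeries v (qFull a J) = evalSeries w (qFull a J') := by
  rw [evalSeries_apply, evalSeries_apply]
  congr 1
  funext n
  simp only [qFull, hDiv, hSinh, hExp, PowerSeries.coeff_smul, PowerSeries.coeff_mk, map_sub,
    evalFree_smul, map_pow, evalFree_ι, h]

/-- Whether the relations hold depends only on the values of the three generators. -/
theorem slRels_congr {v : ι → T} {w : κ → T} {J P M : ι} {J' P' M' : κ} (hJ : v J = w J')
    (hP : v P = w P') (hM : v M = w M') (h : ∀ r ∈ slRels ap a J P M, evalSeries v r = 0) :
    ∀ r ∈ slRels ap a J' P' M', evalSeries w r = 0 := by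
  rintro r (rfl | rfl | rfl)
  · rw [evalSeries_jp, ← hJ, ← hP, ← evalSeries_jp]
    exact h _ (Or.inl rfl)
  · rw [evalSeries_jm, ← hJ, ← hP, ← hM, ← evalSeries_qHalf_congr hJ, ← evalSeries_jm]
    exact h _ (Or.inr (Or.inl rfl))
  · rw [evalSeries_pm, ← hJ, ← hP, ← hM, ← evalSeries_qFull_congr hJ, ← evalSeries_pm]
    exact h _ (Or.inr (Or.inr rfl))

theorem evalSeries_gen_eq_zero {rels : Set (FreeSeries ι)} {r : FreeSeries ι} (h : r ∈ rels) :
    evalSeries (PresentedAlg.gen rels) r = 0 := by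
  rw [← PresentedAlg.mk_eq_evalSeries, PresentedAlg.mk_rel h]

/-- The inclusion of the generators. -/
def SlGen.toGl : SlGen → GlGen
  | SlGen.J3 => GlGen.J3
  | SlGen.Jp => GlGen.Jp
  | SlGen.Jm => GlGen.Jm

/-- The inclusion of the quantum `sl(2)` into the quantum `gl(2)`. -/
def QSl.incl (ap a : ℝ) : QSl ap a →ₐ[HRing] QGl ap a :=
  PresentedAlg.lift (fun i => QGl.gen ap a i.toGl)
    (slRels_congr (v := QGl.gen ap a) (J := GlGen.J3) (P := GlGen.Jp) (M := GlGen.Jm) rfl rfl rfl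
      fun _ h => evalSeries_gen_eq_zero (Or.inl h))

theorem QSl.incl_gen (ap a : ℝ) (i : SlGen) : QSl.incl ap a (QSl.gen ap a i) = QGl.gen ap a i.toGl :=
  PresentedAlg.lift_gen _ _ i

/-- The retraction of the quantum `gl(2)` onto the quantum `sl(2)`, with `I ↦ 0`. -/
def QGl.retract (ap a : ℝ) : QGl ap a →ₐ[HRing] QSl ap a :=
  PresentedAlg.lift (fun g => match g with
    | GlGen.J3 => QSl.gen ap a SlGen.J3
    | GlGen.Jp => QSl.gen ap a SlGen.Jp
    | GlGen.Jm => QSl.gen ap a SlGen.Jm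
    | GlGen.I => 0) (by
    rintro r (hr | ⟨g, rfl⟩)
    · exact slRels_congr (v := QSl.gen ap a) (J := SlGen.J3) (P := SlGen.Jp) (M := SlGen.Jm)
        (J' := GlGen.J3) (P' := GlGen.Jp) (M' := GlGen.Jm)
        rfl rfl rfl (fun _ h => evalSeries_gen_eq_zero h) r hr
    · simp only [qComm, map_sub, map_mul, evalSeries_fgen]
      rw [zero_mul, mul_zero, sub_zero])

/-- Makes the inclusion of the quantum sl(2) injective, so that torsion-freeness passes to it from
the quantum gl(2). -/
theorem QGl.retract_incl (ap a : ℝ) (x : QSl ap a) : QGl.retract ap a (QSl.incl ap a x) = x := by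
  have h : (QGl.retract ap a).comp (QSl.incl ap a) = AlgHom.id HRing _ := by
    refine PresentedAlg.algHom_ext fun i => ?_
    refine (congrArg (QGl.retract ap a) (QSl.incl_gen ap a i)).trans ?_
    refine (PresentedAlg.lift_gen _ _ _).trans ?_
    cases i <;> rfl
  exact AlgHom.congr_fun h x

theorem QSl.hTorsionFree (ap : ℝ) (ha : a ≠ 0) : HTorsionFree (QSl ap a) :=
  have := QGl.hTorsionFree ap ha
  HTorsionFree.of_injective (QSl.incl ap a).toLinearMap
    (Function.LeftInverse.injective (QGl.retract_incl ap a))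

end Subalgebra

/-! ## The Hopf algebra structures -/

section HopfStructures

variable {T : Type} [Ring T] [Algebra HRing T] [HComplete T]
  {T' : Type} [Ring T'] [Algebra HRing T'] [HComplete T'] {ι : Type} {ap a : ℝ}

theorem tExp_of_zero (t : ℝ) : tExp t (0 : T) = 1 := by
  have h := tExp_smul t 0 (0 : T)
  rwa [smul_zero, mul_zero, tExp_zero] at h

theorem IsQTriple.map {j p m s f : T} (h : IsQTriple ap a j p m s f) (g : T →ₐ[HRing] T') :
    IsQTriple ap a (g j) (g p) (g m) (g s) (g f) where
  half := by rw [← map_smul, h.half, map_sub, map_tExp, map_tExp]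
  full := by rw [← map_smul, h.full, map_sub, map_tExp, map_tExp]
  jp := by rw [← map_mul, ← map_mul, ← map_sub, h.jp, map_smul]
  jm := by
    rw [← map_mul, ← map_mul, ← map_sub, h.jm, map_sub, map_sub, map_neg, map_smul, map_smul,
      map_smul]
  pm := by
    rw [← map_mul, ← map_mul, ← map_sub, h.pm, map_add, map_smul, map_smul, map_add, map_mul,
      map_mul, map_tExp, map_tExp]

/-- Over the scalars, this is the well-definedness of the counit. -/
theorem isQTriple_zero (ap a : ℝ) : IsQTriple ap a (0 : T) 0 0 0 0 where
  half := by simp [tExp_of_zero]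
  full := by simp [tExp_of_zero]
  jp := by simp
  jm := by simp
  pm := by simp

variable {A : Type} [Ring A] [Algebra HRing A]

variable (A) in
/-- `a ↦ a ⊗ 1`. -/
def tensorLeft : A →ₐ[HRing] HCompl (A ⊗[HRing] A) :=
  (HCompl.of (A ⊗[HRing] A)).comp Algebra.TensorProduct.includeLeft

variable (A) in
/-- `a ↦ 1 ⊗ a`. -/
def tensorRight : A →ₐ[HRing] HCompl (A ⊗[HRing] A) :=
  (HCompl.of (A ⊗[HRing] A)).comp Algebra.TensorProduct.includeRight

theorem tensorLeft_mul_tensorRight (x y : A) :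
    tensorLeft A x * tensorRight A y = HCompl.of _ (x ⊗ₜ y) := by
  change HCompl.of _ (x ⊗ₜ 1) * HCompl.of _ (1 ⊗ₜ y) = _
  rw [← map_mul, Algebra.TensorProduct.tmul_mul_tmul, mul_one, one_mul]

theorem commute_tensor (x y : A) : Commute (tensorLeft A x) (tensorRight A y) := by
  rw [Commute, SemiconjBy, tensorLeft_mul_tensorRight]
  change _ = HCompl.of _ (1 ⊗ₜ y) * HCompl.of _ (x ⊗ₜ 1)
  rw [← map_mul, Algebra.TensorProduct.tmul_mul_tmul, mul_one, one_mul]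

theorem of_twisted (k l x : A) : HCompl.of (A ⊗[HRing] A) (k ⊗ₜ x + x ⊗ₜ l) =
    tensorLeft A k * tensorRight A x + tensorLeft A x * tensorRight A l := by
  rw [map_add, tensorLeft_mul_tensorRight, tensorLeft_mul_tensorRight]

theorem of_primitive (x : A) : HCompl.of (A ⊗[HRing] A) (1 ⊗ₜ x + x ⊗ₜ 1) =
    tensorLeft A x + tensorRight A x := by
  rw [of_twisted, map_one, map_one, one_mul, mul_one, add_comm]

/-- The coproduct of the deformed relations. -/
theorem IsQTriple.of_coproduct [HComplete A] [HTorsionFree A] (ha : a ≠ 0) {j p m s f : A}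
    (h : IsQTriple ap a j p m s f) :
    ∃ s' f', IsQTriple ap a (HCompl.of (A ⊗[HRing] A) (1 ⊗ₜ j + j ⊗ₜ 1))
      (HCompl.of (A ⊗[HRing] A) (tExp (a / 2) j ⊗ₜ p + p ⊗ₜ tExp (-(a / 2)) j))
      (HCompl.of (A ⊗[HRing] A) (tExp (a / 2) j ⊗ₜ m + m ⊗ₜ tExp (-(a / 2)) j)) s' f' := by
  rw [of_primitive, of_twisted, of_twisted, map_tExp, map_tExp]
  exact ⟨_, _, (h.map (tensorLeft A)).coproduct ha (h.map (tensorRight A)) (commute_tensor _ _)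
    (commute_tensor _ _) (commute_tensor _ _) (commute_tensor _ _) (commute_tensor _ _)
    (commute_tensor _ _) (commute_tensor _ _) (commute_tensor _ _)⟩

theorem tExp_of_primitive [HComplete A] (t : ℝ) (x : A) :
    tExp t (HCompl.of (A ⊗[HRing] A) (1 ⊗ₜ x + x ⊗ₜ 1)) =
      HCompl.of _ (tExp t x ⊗ₜ tExp t x) := by
  rw [of_primitive, tExp_add (commute_tensor x x), ← tensorLeft_mul_tensorRight, map_tExp, map_tExp]

/-- The value of the coproduct on a generator, which is primitive or twisted by `e^{±aħj/2}`. -/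
def comulGen [HComplete A] (a : ℝ) (j : A) (tw : Bool) (x : A) : HCompl (A ⊗[HRing] A) :=
  HCompl.of _ ((if tw then tExp (a / 2) j else 1) ⊗ₜ x + x ⊗ₜ (if tw then tExp (-(a / 2)) j else 1))

/-- The Hopf algebra structure of a presented algebra in which each generator is either primitive
or twisted by `e^{±aħj/2}`, where the generator `j` is primitive. -/
theorem exists_topHopf {rels : Set (FreeSeries ι)} (a : ℝ) (J : ι) (tw : ι → Bool)
    (hJ : tw J = false)
    (hΔ : ∀ r ∈ rels, evalSeries (fun i => comulGen a (PresentedAlg.gen rels J) (tw i)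
      (PresentedAlg.gen rels i)) r = 0)
    (hε : ∀ r ∈ rels, evalSeries (fun _ : ι => (0 : HRing)) r = 0)
    (hS : ∀ r ∈ rels, evalSeries (fun i => MulOpposite.op (-PresentedAlg.gen rels i)) r = 0)
    (hcomm : ∀ i, tw i = false → Commute (PresentedAlg.gen rels J) (PresentedAlg.gen rels i)) :
    ∃ H : TopHopf (PresentedAlg rels), (∀ i, H.comul (PresentedAlg.gen rels i) =
      comulGen a (PresentedAlg.gen rels J) (tw i) (PresentedAlg.gen rels i)) ∧
      ∀ i, H.counit (PresentedAlg.gen rels i) = 0 := by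
  set j := PresentedAlg.gen rels J with hj
  have hΔg : ∀ i, PresentedAlg.lift _ hΔ (PresentedAlg.gen rels i) =
    comulGen a j (tw i) (PresentedAlg.gen rels i) := PresentedAlg.lift_gen _ hΔ
  have hεg : ∀ i, PresentedAlg.lift _ hε (PresentedAlg.gen rels i) = 0 :=
    PresentedAlg.lift_gen _ hε
  have hSg : ∀ i, PresentedAlg.lift _ hS (PresentedAlg.gen rels i) =
    MulOpposite.op (-PresentedAlg.gen rels i) := PresentedAlg.lift_gen _ hS
  generalize PresentedAlg.lift _ hΔ = Δ at hΔg
  generalize PresentedAlg.lift _ hε = ε at hεg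
  generalize PresentedAlg.lift _ hS = S₀ at hSg
  have hΔE : ∀ t, Δ (tExp t j) = HCompl.of _ (tExp t j ⊗ₜ tExp t j) := fun t => by
    rw [map_tExp, hj, hΔg, hJ, ← tExp_of_primitive]
    rfl
  have hεE : ∀ t, ε (tExp t j) = 1 := fun t => by rw [map_tExp, hj, hεg, tExp_of_zero]
  have hinv : tExp (-(a / 2)) j * tExp (a / 2) j = 1 := by
    rw [tExp_mul_tExp, neg_add_cancel, tExp_zero]
  have hinv' : tExp (a / 2) j * tExp (-(a / 2)) j = 1 := by
    rw [tExp_mul_tExp, add_neg_cancel, tExp_zero]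
  -- The antihomomorphism with x ↦ -x on generators, followed by conjugation, so that S(x) =
  -- -e^{-aj/2} x e^{aj/2} on generators. For a twisted generator this is -S(k) x S(l); a primitive
  -- one commutes with j, so the conjugation is invisible.
  let S : PresentedAlg rels →ₗ[HRing] PresentedAlg rels :=
    LinearMap.mulLeft HRing (tExp (-(a / 2)) j) ∘ₗ LinearMap.mulRight HRing (tExp (a / 2) j) ∘ₗ
      (MulOpposite.opLinearEquiv HRing).symm.toLinearMap ∘ₗ S₀.toLinearMap
  have hSapp : ∀ x, S x = tExp (-(a / 2)) j * ((S₀ x).unop * tExp (a / 2) j) := fun _ => rfl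
  have hSE : ∀ t, S (tExp t j) = tExp (-t) j := fun t => by
    rw [hSapp, map_tExp, hj, hSg, tExp_op, MulOpposite.unop_op, tExp_neg, ← hj, tExp_mul_tExp,
      tExp_mul_tExp]
    congr 1
    ring
  have hS1 : S 1 = 1 := by rw [hSapp, map_one, MulOpposite.unop_one, one_mul, hinv]
  let k : ι → PresentedAlg rels := fun i => if tw i then tExp (a / 2) j else 1
  let l : ι → PresentedAlg rels := fun i => if tw i then tExp (-(a / 2)) j else 1
  refine ⟨TopHopf.ofGenerators Δ ε S k l ?_ ?_ hΔg ?_ ?_ hεg hS1 ?_ ?_ ?_ ?_, hΔg, hεg⟩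
  · intro i
    change Δ (if tw i then _ else 1) = HCompl.of _ ((if tw i then _ else 1) ⊗ₜ if tw i then _ else 1)
    cases tw i
    · exact (map_one Δ).trans (map_one (HCompl.of _)).symm
    · exact hΔE _
  · intro i
    change Δ (if tw i then _ else 1) = HCompl.of _ ((if tw i then _ else 1) ⊗ₜ if tw i then _ else 1)
    cases tw i
    · exact (map_one Δ).trans (map_one (HCompl.of _)).symm
    · exact hΔE _
  · intro i
    change ε (if tw i then _ else 1) = 1
    cases tw i
    · exact map_one ε
    · exact hεE _
  · intro i
    change ε (if tw i then _ else 1) = 1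
    cases tw i
    · exact map_one ε
    · exact hεE _
  · intro x y
    rw [hSapp, hSapp, hSapp, map_mul, MulOpposite.unop_mul]
    simp only [mul_assoc]
    rw [← mul_assoc (tExp (a / 2) j), hinv', one_mul]
  · intro i
    change (if tw i then _ else 1) * S (if tw i then _ else 1) = 1
    cases tw i
    · exact (one_mul _).trans hS1
    · exact (congrArg _ (hSE _)).trans hinv'
  · intro i
    change S (if tw i then _ else 1) * (if tw i then _ else 1) = 1
    cases tw i
    · exact (mul_one _).trans hS1
    · refine (congrArg (· * _) (hSE _)).trans ?_
      change tExp (- -(a / 2)) j * tExp (-(a / 2)) j = 1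
      rw [neg_neg, hinv']
  · intro i
    change S _ = -(S (if tw i then _ else 1) * _ * S (if tw i then _ else 1))
    have h1 : S (PresentedAlg.gen rels i) =
        -(tExp (-(a / 2)) j * PresentedAlg.gen rels i * tExp (a / 2) j) := by
      rw [hSapp, hSg, MulOpposite.unop_op, neg_mul, mul_neg, mul_assoc]
    rw [h1]
    cases h : tw i
    · rw [if_neg Bool.false_ne_true, if_neg Bool.false_ne_true, hS1, one_mul, mul_one,
        (tExp_commute (hcomm i h) _).eq, mul_assoc, hinv, mul_one]
    · rw [if_pos rfl, if_pos rfl, hSE, hSE, neg_neg]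

end HopfStructures

/-! ### Hopf structures on the three algebras, and centrality of the Casimir -/

section Structures

variable {ap a : ℝ}

/-- The generators whose coproduct is twisted. -/
def GlGen.twisted : GlGen → Bool
  | GlGen.J3 => false
  | GlGen.Jp => true
  | GlGen.Jm => true
  | GlGen.I => false

/-- The generators whose coproduct is twisted. -/
def SlGen.twisted : SlGen → Bool
  | SlGen.J3 => false
  | SlGen.Jp => true
  | SlGen.Jm => true

theorem evalSeries_qComm {T : Type} [Ring T] [Algebra HRing T] [HComplete T] {ι : Type} {v : ι → T}
    {x y : ι} (h : Commute (v x) (v y)) : evalSeries v (qComm (fgen x) (fgen y)) = 0 := by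
  rw [qComm, map_sub, map_mul, map_mul, evalSeries_fgen, evalSeries_fgen, h.eq, sub_self]

theorem mk_hExp {ι : Type} (rels : Set (FreeSeries ι)) (t : ℝ) (i : ι) :
    PresentedAlg.mk rels (hExp t (FreeAlgebra.ι ℝ i)) = tExp t (PresentedAlg.gen rels i) := by
  rw [PresentedAlg.mk_eq_evalSeries, evalSeries_hExp, evalFree_ι]

theorem PresentedAlg.isQTriple {ι : Type} {rels : Set (FreeSeries ι)} (ha : a ≠ 0) {J P M : ι}
    (h : slRels ap a J P M ⊆ rels) :
    IsQTriple ap a (PresentedAlg.gen rels J) (PresentedAlg.gen rels P) (PresentedAlg.gen rels M)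
      (evalSeries (PresentedAlg.gen rels) (qHalf a J))
      (evalSeries (PresentedAlg.gen rels) (qFull a J)) :=
  isQTriple_of_slRels ha _ J P M fun _ hr => evalSeries_gen_eq_zero (h hr)

/-- The three maps that define the Hopf structure respect the deformed relations. -/
theorem PresentedAlg.slRels_hopf {ι : Type} {rels : Set (FreeSeries ι)}
    [HTorsionFree (PresentedAlg rels)] (ha : a ≠ 0) {J P M : ι}
    (h : slRels ap a J P M ⊆ rels) (tw : ι → Bool) (hJ : tw J = false) (hP : tw P = true)
    (hM : tw M = true) {r : FreeSeries ι} (hr : r ∈ slRels ap a J P M) :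
    evalSeries (fun i => comulGen a (PresentedAlg.gen rels J) (tw i)
      (PresentedAlg.gen rels i)) r = 0 ∧
    evalSeries (fun _ : ι => (0 : HRing)) r = 0 ∧
    evalSeries (fun i => MulOpposite.op (-PresentedAlg.gen rels i)) r = 0 := by
  have hq := PresentedAlg.isQTriple ha h
  refine ⟨?_, (isQTriple_zero ap a).slRels ha _ J P M r hr, hq.neg_op.slRels ha _ J P M r hr⟩
  obtain ⟨s, f, hsf⟩ := hq.of_coproduct ha
  refine IsQTriple.slRels ha _ J P M (s := s) (f := f) ?_ r hr
  rw [hJ, hP, hM]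
  exact hsf

theorem QGl.commute_I (ap a : ℝ) (i : GlGen) :
    Commute (QGl.gen ap a GlGen.I) (QGl.gen ap a i) := by
  have h : evalSeries (QGl.gen ap a) (qComm (fgen GlGen.I) (fgen i)) = 0 :=
    evalSeries_gen_eq_zero (Or.inr ⟨i, rfl⟩)
  rw [qComm, map_sub, map_mul, map_mul, evalSeries_fgen, evalSeries_fgen] at h
  exact sub_eq_zero.1 h

theorem QGl.I_mem_center (ap a : ℝ) :
    QGl.gen ap a GlGen.I ∈ Subalgebra.center HRing (QGl ap a) :=
  PresentedAlg.mem_center_of_commute_gen fun i => (QGl.commute_I ap a i).symm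

theorem commute_comulGen {A : Type} [Ring A] [Algebra HRing A] [HComplete A] {x : A}
    (hx : ∀ y, Commute x y) (j y : A) (tw : Bool) :
    Commute (comulGen a j false x) (comulGen a j tw y) := by
  rw [comulGen, comulGen, if_neg Bool.false_ne_true, if_neg Bool.false_ne_true, of_primitive,
    of_twisted]
  have hl : ∀ z, Commute (tensorLeft A x) (tensorLeft A z) := fun z => (hx z).map _
  have hr : ∀ z, Commute (tensorRight A x) (tensorRight A z) := fun z => (hx z).map _
  exact (((hl _).mul_right (commute_tensor _ _)).add_right
    ((hl _).mul_right (commute_tensor _ _))).add_left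
    ((((commute_tensor _ _).symm).mul_right (hr _)).add_right
      (((commute_tensor _ _).symm).mul_right (hr _)))

theorem exists_isGlHopf (ap : ℝ) (ha : a ≠ 0) : ∃ H : TopHopf (QGl ap a), IsGlHopf ap a H := by
  have := QGl.hTorsionFree ap ha
  have hI : ∀ y, Commute (QGl.gen ap a GlGen.I) y := fun y =>
    ((Subalgebra.mem_center_iff.1 (QGl.I_mem_center ap a)) y).symm
  have key := fun r (hr : r ∈ slRels ap a GlGen.J3 GlGen.Jp GlGen.Jm) =>
    PresentedAlg.slRels_hopf (rels := glRels ap a) ha Set.subset_union_left GlGen.twisted rfl rfl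
      rfl hr
  obtain ⟨H, hH, hc⟩ := exists_topHopf (rels := glRels ap a) a GlGen.J3 GlGen.twisted rfl
    (by
      rintro r (hr | ⟨x, rfl⟩)
      · exact (key r hr).1
      · exact evalSeries_qComm (commute_comulGen hI _ _ _))
    (by
      rintro r (hr | ⟨x, rfl⟩)
      · exact (key r hr).2.1
      · exact evalSeries_qComm (Commute.all _ _))
    (by
      rintro r (hr | ⟨x, rfl⟩)
      · exact (key r hr).2.2
      · exact evalSeries_qComm ((hI _).neg_left.neg_right.op))
    (by
      rintro (_ | _ | _ | _) h
      · exact Commute.refl _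
      · cases h
      · cases h
      · exact (hI _).symm)
  exact ⟨H, hH GlGen.J3, hH GlGen.I,
    (hH GlGen.Jp).trans (by rw [QGl.expJ, QGl.expJ, mk_hExp, mk_hExp]; rfl),
    (hH GlGen.Jm).trans (by rw [QGl.expJ, QGl.expJ, mk_hExp, mk_hExp]; rfl), hc⟩

theorem exists_isSlHopf (ap : ℝ) (ha : a ≠ 0) : ∃ H : TopHopf (QSl ap a), IsSlHopf ap a H := by
  have := QSl.hTorsionFree ap ha
  have key := fun r (hr : r ∈ slRels ap a SlGen.J3 SlGen.Jp SlGen.Jm) =>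
    PresentedAlg.slRels_hopf ha subset_rfl SlGen.twisted rfl rfl rfl hr
  obtain ⟨H, hH, hc⟩ := exists_topHopf (rels := slRels ap a SlGen.J3 SlGen.Jp SlGen.Jm) a SlGen.J3
    SlGen.twisted rfl (fun r hr => (key r hr).1) (fun r hr => (key r hr).2.1)
    (fun r hr => (key r hr).2.2)
    (by
      rintro (_ | _ | _) h
      · exact Commute.refl _
      · cases h
      · cases h)
  exact ⟨H, hH SlGen.J3,
    (hH SlGen.Jp).trans (by rw [QSl.expJ, QSl.expJ, mk_hExp, mk_hExp]; rfl),
    (hH SlGen.Jm).trans (by rw [QSl.expJ, QSl.expJ, mk_hExp, mk_hExp]; rfl), hc⟩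

theorem exists_u1Hopf : ∃ H : TopHopf QU1, H.IsPrimitive QU1.gen ∧ H.counit QU1.gen = 0 := by
  -- The parameter 0 is immaterial, since no generator is twisted.
  obtain ⟨H, hH, hc⟩ := exists_topHopf (rels := (∅ : Set (FreeSeries Unit))) 0 ()
    (fun _ => false) rfl (fun _ h => h.elim) (fun _ h => h.elim) (fun _ h => h.elim)
    (fun _ _ => Commute.refl _)
  exact ⟨H, hH (), hc ()⟩

theorem QGl.casimir_mem_center (ap : ℝ) (ha : a ≠ 0) :
    QGl.casimir ap a ∈ Subalgebra.center HRing (QGl ap a) := by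
  have := QGl.hTorsionFree ap ha
  obtain ⟨hJ, hP, hM⟩ := commute_evalSeries_casimir ha (QGl.gen ap a) GlGen.J3 GlGen.Jp GlGen.Jm
    fun _ h => evalSeries_gen_eq_zero (Or.inl h)
  rw [QGl.casimir, PresentedAlg.mk_eq_evalSeries]
  refine PresentedAlg.mem_center_of_commute_gen fun i => ?_
  cases i
  · exact hJ.symm
  · exact hP.symm
  · exact hM.symm
  · exact (Subalgebra.mem_center_iff.1 (QGl.I_mem_center ap a) _).symm

end Structures

/-! ## The splitting of the quantum `gl(2)` -/

section Splitting

variable {ap a : ℝ}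

/-- The inclusion of `U(u(1))⟦ħ⟧` into the quantum `gl(2)`. -/
def QU1.incl (ap a : ℝ) : QU1 →ₐ[HRing] QGl ap a :=
  PresentedAlg.lift (rels := ∅) (fun _ => QGl.gen ap a GlGen.I) fun _ h => h.elim

theorem QU1.incl_gen (ap a : ℝ) : QU1.incl ap a QU1.gen = QGl.gen ap a GlGen.I :=
  PresentedAlg.lift_gen (rels := ∅) _ _ ()

theorem QGl.commute_incl (ap a : ℝ) (x : QSl ap a) (y : QU1) :
    Commute (QSl.incl ap a x) (QU1.incl ap a y) := by
  have hI : QSl.incl ap a x * QGl.gen ap a GlGen.I = QGl.gen ap a GlGen.I * QSl.incl ap a x :=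
    Subalgebra.mem_center_iff.1 (QGl.I_mem_center ap a) _
  generalize QSl.incl ap a x = z at hI
  have h : LinearMap.mulLeft HRing z ∘ₗ (QU1.incl ap a).toLinearMap =
      LinearMap.mulRight HRing z ∘ₗ (QU1.incl ap a).toLinearMap := by
    refine PresentedAlg.linearMap_ext ?_ (fun _ => ?_) fun x y hx hy => ?_
    · change z * QU1.incl ap a 1 = QU1.incl ap a 1 * z
      rw [map_one, one_mul, mul_one]
    · change z * QU1.incl ap a QU1.gen = QU1.incl ap a QU1.gen * z
      rw [QU1.incl_gen, hI]
    · change z * QU1.incl ap a x = QU1.incl ap a x * z at hx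
      change z * QU1.incl ap a y = QU1.incl ap a y * z at hy
      change z * QU1.incl ap a (x * y) = QU1.incl ap a (x * y) * z
      rw [map_mul, ← mul_assoc, hx, mul_assoc, hy, mul_assoc]
  exact LinearMap.congr_fun h y

/-- The multiplication map from the completed tensor product to the quantum `gl(2)`. -/
def QGl.ofTensor (ap a : ℝ) : HCompl (QSl ap a ⊗[HRing] QU1) →ₐ[HRing] QGl ap a :=
  (HCompl.ofEquiv (B := QGl ap a)).symm.toAlgHom.comp
    (HCompl.mapAlg (Algebra.TensorProduct.lift (QSl.incl ap a) (QU1.incl ap a)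
      (QGl.commute_incl ap a)))

theorem QGl.ofTensor_of (x : QSl ap a) (y : QU1) :
    QGl.ofTensor ap a (HCompl.of _ (x ⊗ₜ y)) = QSl.incl ap a x * QU1.incl ap a y := by
  refine (congrArg (HCompl.ofEquiv (B := QGl ap a)).symm (HCompl.mapAlg_of _ _)).trans ?_
  exact (HCompl.ofEquiv (B := QGl ap a)).symm_apply_apply _

/-- The images of the generators in the completed tensor product. -/
def tensorGen (ap a : ℝ) : GlGen → HCompl (QSl ap a ⊗[HRing] QU1)
  | GlGen.J3 => HCompl.of _ (QSl.gen ap a SlGen.J3 ⊗ₜ 1)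
  | GlGen.Jp => HCompl.of _ (QSl.gen ap a SlGen.Jp ⊗ₜ 1)
  | GlGen.Jm => HCompl.of _ (QSl.gen ap a SlGen.Jm ⊗ₜ 1)
  | GlGen.I => HCompl.of _ (1 ⊗ₜ QU1.gen)

theorem evalSeries_tensorGen (ap a : ℝ) :
    ∀ r ∈ glRels ap a, evalSeries (tensorGen ap a) r = 0 := by
  rintro r (hr | ⟨x, rfl⟩)
  · have h : ∀ r ∈ slRels ap a SlGen.J3 SlGen.Jp SlGen.Jm,
        evalSeries (fun i => ((HCompl.of (QSl ap a ⊗[HRing] QU1)).comp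
          Algebra.TensorProduct.includeLeft) (QSl.gen ap a i)) r = 0 := by
      intro r hr
      refine (PresentedAlg.map_mk ((HCompl.of (QSl ap a ⊗[HRing] QU1)).comp
        Algebra.TensorProduct.includeLeft) r).symm.trans ?_
      rw [PresentedAlg.mk_rel hr, map_zero]
    exact slRels_congr (J := SlGen.J3) (P := SlGen.Jp) (M := SlGen.Jm) (J' := GlGen.J3)
      (P' := GlGen.Jp) (M' := GlGen.Jm) rfl rfl rfl h r hr
  · refine evalSeries_qComm ?_
    have h : ∀ y : QSl ap a, Commute (HCompl.of (QSl ap a ⊗[HRing] QU1) (1 ⊗ₜ QU1.gen))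
        (HCompl.of _ (y ⊗ₜ 1)) := by
      intro y
      rw [Commute, SemiconjBy, ← map_mul, ← map_mul, Algebra.TensorProduct.tmul_mul_tmul,
        Algebra.TensorProduct.tmul_mul_tmul, one_mul, mul_one, mul_one, one_mul]
    cases x
    · exact h _
    · exact h _
    · exact h _
    · exact Commute.refl _

/-- The inverse of the multiplication map. -/
def QGl.toTensor (ap a : ℝ) : QGl ap a →ₐ[HRing] HCompl (QSl ap a ⊗[HRing] QU1) :=
  PresentedAlg.lift (tensorGen ap a) (evalSeries_tensorGen ap a)

theorem QGl.toTensor_gen (ap a : ℝ) (i : GlGen) :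
    QGl.toTensor ap a (QGl.gen ap a i) = tensorGen ap a i :=
  PresentedAlg.lift_gen _ _ i

theorem QGl.ofTensor_tensorGen (ap a : ℝ) (i : GlGen) :
    QGl.ofTensor ap a (tensorGen ap a i) = QGl.gen ap a i := by
  cases i
  · exact (QGl.ofTensor_of _ _).trans (by rw [map_one, mul_one, QSl.incl_gen]; rfl)
  · exact (QGl.ofTensor_of _ _).trans (by rw [map_one, mul_one, QSl.incl_gen]; rfl)
  · exact (QGl.ofTensor_of _ _).trans (by rw [map_one, mul_one, QSl.incl_gen]; rfl)
  · exact (QGl.ofTensor_of _ _).trans (by rw [map_one, one_mul, QU1.incl_gen])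

theorem QGl.ofTensor_comp_toTensor (ap a : ℝ) :
    (QGl.ofTensor ap a).comp (QGl.toTensor ap a) = AlgHom.id HRing _ :=
  PresentedAlg.algHom_ext fun i =>
    (congrArg (QGl.ofTensor ap a) (QGl.toTensor_gen ap a i)).trans (QGl.ofTensor_tensorGen ap a i)

theorem QGl.toTensor_incl_left (x : QSl ap a) :
    QGl.toTensor ap a (QSl.incl ap a x) = HCompl.of _ (x ⊗ₜ 1) := by
  have h : (QGl.toTensor ap a).comp (QSl.incl ap a) =
      (HCompl.of (QSl ap a ⊗[HRing] QU1)).comp Algebra.TensorProduct.includeLeft := by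
    refine PresentedAlg.algHom_ext fun i => ?_
    refine (congrArg (QGl.toTensor ap a) (QSl.incl_gen ap a i)).trans ?_
    refine (QGl.toTensor_gen ap a _).trans ?_
    cases i <;> rfl
  exact AlgHom.congr_fun h x

theorem QGl.toTensor_incl_right (y : QU1) :
    QGl.toTensor ap a (QU1.incl ap a y) = HCompl.of _ (1 ⊗ₜ y) := by
  have h : (QGl.toTensor ap a).comp (QU1.incl ap a) =
      (HCompl.of (QSl ap a ⊗[HRing] QU1)).comp Algebra.TensorProduct.includeRight := by
    refine PresentedAlg.algHom_ext fun i => ?_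
    refine (congrArg (QGl.toTensor ap a) (QU1.incl_gen ap a)).trans ?_
    exact QGl.toTensor_gen ap a _
  exact AlgHom.congr_fun h y

theorem HCompl.algHom_ext_tensor {A B C : Type} [Ring A] [Algebra HRing A] [Ring B]
    [Algebra HRing B] [Ring C] [Algebra HRing C] {f g : HCompl (A ⊗[HRing] B) →ₐ[HRing] HCompl C}
    (h : ∀ x y, f (HCompl.of _ (x ⊗ₜ y)) = g (HCompl.of _ (x ⊗ₜ y))) : f = g := by
  have h1 : f.toLinearMap ∘ₗ (HCompl.of _).toLinearMap = g.toLinearMap ∘ₗ (HCompl.of _).toLinearMap :=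
    TensorProduct.ext' h
  exact AlgHom.toLinearMap_injective (HCompl.linearMap_ext fun t => LinearMap.congr_fun h1 t)

theorem QGl.toTensor_comp_ofTensor (ap a : ℝ) :
    (QGl.toTensor ap a).comp (QGl.ofTensor ap a) = AlgHom.id HRing _ := by
  refine HCompl.algHom_ext_tensor fun x y => ?_
  refine (congrArg (QGl.toTensor ap a) (QGl.ofTensor_of x y)).trans ?_
  refine (map_mul (QGl.toTensor ap a) _ _).trans ?_
  rw [QGl.toTensor_incl_left, QGl.toTensor_incl_right]
  refine (map_mul (HCompl.of (QSl ap a ⊗[HRing] QU1)) _ _).symm.trans ?_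
  rw [Algebra.TensorProduct.tmul_mul_tmul, one_mul, mul_one]
  rfl

/-- The isomorphism of the completed tensor product with the quantum `gl(2)`. -/
def QGl.tensorEquiv (ap a : ℝ) : HCompl (QSl ap a ⊗[HRing] QU1) ≃ₐ[HRing] QGl ap a :=
  AlgEquiv.ofAlgHom (QGl.ofTensor ap a) (QGl.toTensor ap a) (QGl.ofTensor_comp_toTensor ap a)
    (QGl.toTensor_comp_ofTensor ap a)

theorem TopHopf.isHom_of_gen {ι : Type} {rels : Set (FreeSeries ι)} {B : Type} [Ring B]
    [Algebra HRing B] (HA : TopHopf (PresentedAlg rels)) (HB : TopHopf B)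
    (f : PresentedAlg rels →ₐ[HRing] B)
    (hΔ : ∀ i, HB.comul (f (PresentedAlg.gen rels i)) =
      HCompl.map (TensorProduct.map f.toLinearMap f.toLinearMap)
        (HA.comul (PresentedAlg.gen rels i)))
    (hε : ∀ i, HB.counit (f (PresentedAlg.gen rels i)) = HA.counit (PresentedAlg.gen rels i)) :
    HA.IsHom HB f where
  comul := by
    have h : HB.comul.comp f =
        (HCompl.mapAlg (Algebra.TensorProduct.map f f)).comp HA.comul :=
      PresentedAlg.algHom_ext hΔ
    exact AlgHom.congr_fun h
  counit := by
    have h : HB.counit.comp f = HA.counit := PresentedAlg.algHom_ext hε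
    exact AlgHom.congr_fun h

theorem TopHopf.IsTwisted.map_eq {A B : Type} [Ring A] [Algebra HRing A] [Ring B]
    [Algebra HRing B] {HA : TopHopf A} {HB : TopHopf B} {f : A →ₐ[HRing] B} {k l x : A}
    {k' l' x' : B} (h : HA.IsTwisted k l x) (h' : HB.IsTwisted k' l' x') (hk : f k = k')
    (hl : f l = l') (hx : f x = x') :
    HB.comul (f x) = HCompl.map (TensorProduct.map f.toLinearMap f.toLinearMap) (HA.comul x) := by
  subst hk hl hx
  refine h'.trans ?_
  rw [show HA.comul x = _ from h, HCompl.map_of]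
  exact congrArg (HCompl.of _) (map_add (TensorProduct.map f.toLinearMap f.toLinearMap)
    (k ⊗ₜ x) (x ⊗ₜ l)).symm

theorem QSl.incl_expJ (ap a t : ℝ) : QSl.incl ap a (QSl.expJ ap a t) = QGl.expJ ap a t := by
  rw [QSl.expJ, QGl.expJ, mk_hExp, mk_hExp, map_tExp]
  exact congrArg (tExp t) (QSl.incl_gen ap a SlGen.J3)

theorem isHopfSplitting {H : TopHopf (QGl ap a)} {Hs : TopHopf (QSl ap a)} {Hu : TopHopf QU1}
    (h : IsGlHopf ap a H) (hs : IsSlHopf ap a Hs) (hu : Hu.IsPrimitive QU1.gen)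
    (hu' : Hu.counit QU1.gen = 0) : IsHopfSplitting ap a H Hs Hu (QGl.tensorEquiv ap a) where
  J3 := QGl.ofTensor_tensorGen ap a GlGen.J3
  Jp := QGl.ofTensor_tensorGen ap a GlGen.Jp
  Jm := QGl.ofTensor_tensorGen ap a GlGen.Jm
  I := QGl.ofTensor_tensorGen ap a GlGen.I
  hom_sl := by
    have he : ((QGl.tensorEquiv ap a).toAlgHom.comp (HCompl.of (QSl ap a ⊗[HRing] QU1))).comp
        Algebra.TensorProduct.includeLeft = QSl.incl ap a := by
      ext x
      exact (QGl.ofTensor_of _ _).trans (by rw [map_one, mul_one])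
    rw [he]
    refine TopHopf.isHom_of_gen Hs H (QSl.incl ap a) (fun i => ?_) fun i => ?_
    · cases i
      · exact TopHopf.IsTwisted.map_eq hs.comul_J3 h.comul_J3 (map_one _) (map_one _)
          (QSl.incl_gen ap a SlGen.J3)
      · exact TopHopf.IsTwisted.map_eq hs.comul_Jp h.comul_Jp (QSl.incl_expJ ap a _)
          (QSl.incl_expJ ap a _) (QSl.incl_gen ap a SlGen.Jp)
      · exact TopHopf.IsTwisted.map_eq hs.comul_Jm h.comul_Jm (QSl.incl_expJ ap a _)
          (QSl.incl_expJ ap a _) (QSl.incl_gen ap a SlGen.Jm)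
    · refine (congrArg H.counit (QSl.incl_gen ap a i)).trans ?_
      exact (h.counit _).trans (hs.counit i).symm
  hom_u1 := by
    have he : ((QGl.tensorEquiv ap a).toAlgHom.comp (HCompl.of (QSl ap a ⊗[HRing] QU1))).comp
        Algebra.TensorProduct.includeRight = QU1.incl ap a := by
      ext x
      exact (QGl.ofTensor_of _ _).trans (by rw [map_one, one_mul])
    rw [he]
    refine TopHopf.isHom_of_gen Hu H (QU1.incl ap a) (fun _ => ?_) fun _ => ?_
    · exact TopHopf.IsTwisted.map_eq hu h.comul_I (map_one _) (map_one _) (QU1.incl_gen ap a)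
    · refine (congrArg H.counit (QU1.incl_gen ap a)).trans ?_
      exact (h.counit _).trans hu'.symm

end Splitting

/-! ## The quantization of `gl(2)` -/

section Generators

/-- Ring homomorphisms over evaluation at `ħ = 0` that agree on the generators are equal. -/
theorem PresentedAlg.ringHom_ext {ι : Type} {rels : Set (FreeSeries ι)} {V : Type} [Ring V]
    [Algebra ℝ V] {F G : PresentedAlg rels →+* V}
    (hF : ∀ (c : HRing) x, F (c • x) = PowerSeries.constantCoeff c • F x)
    (hG : ∀ (c : HRing) x, G (c • x) = PowerSeries.constantCoeff c • G x)
    (h : ∀ i, F (PresentedAlg.gen rels i) = G (PresentedAlg.gen rels i)) : F = G := by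
  refine RingHom.ext fun x => ?_
  obtain ⟨f, rfl⟩ := PresentedAlg.mk_surjective x
  obtain ⟨y, hy⟩ := PresentedAlg.exists_eq_mk_C_add (rels := rels) f
  rw [hy, map_add, map_add, hF, hG, PowerSeries.constantCoeff_X, zero_smul, zero_smul, add_zero,
    add_zero]
  generalize PowerSeries.constantCoeff f = z
  induction z using FreeAlgebra.induction with
  | grade0 r =>
    have h2 : PowerSeries.C (algebraMap ℝ (FreeAlgebra ℝ ι) r) =
        algebraMap HRing (FreeSeries ι) (PowerSeries.C r) :=
      (PowerSeries.map_C (algebraMap ℝ (FreeAlgebra ℝ ι)) r).symm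
    rw [h2, AlgHom.commutes, Algebra.algebraMap_eq_smul_one, hF, hG, map_one, map_one]
  | grade1 i => exact h i
  | mul x y hx hy => rw [map_mul, map_mul, map_mul, map_mul, hx, hy]
  | add x y hx hy => rw [map_add, map_add, map_add, map_add, hx, hy]

end Generators

/-! ### Reduction of the tensor square and first-order antisymmetry of the coproduct -/

section TensorReduction

variable {A : Type} [Ring A] [Algebra HRing A] {U : Type} [Ring U] [Algebra ℝ U] (π : A →+* U)
  (hπ : ∀ (c : HRing) (x : A), π (c • x) = PowerSeries.constantCoeff c • π x)

/-- The reduction at `ħ = 0` of the tensor square. -/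
def redTensor : A ⊗[HRing] A →+* U ⊗[ℝ] U where
  toFun := TensorProduct.map (redLin π hπ) (redLin π hπ)
  map_zero' := map_zero _
  map_add' := map_add _
  map_one' := by
    rw [Algebra.TensorProduct.one_def, TensorProduct.map_tmul]
    exact congrArg₂ (· ⊗ₜ ·) (map_one π) (map_one π)
  map_mul' s t := by
    induction s with
    | zero => rw [zero_mul, map_zero, zero_mul]
    | add x y hx hy => rw [add_mul, map_add, map_add, hx, hy, add_mul]
    | tmul x y =>
      induction t with
      | zero => rw [mul_zero, map_zero, mul_zero]
      | add z w hz hw => rw [mul_add, map_add, map_add, hz, hw, mul_add]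
      | tmul z w =>
        rw [Algebra.TensorProduct.tmul_mul_tmul, TensorProduct.map_tmul, TensorProduct.map_tmul,
          TensorProduct.map_tmul, Algebra.TensorProduct.tmul_mul_tmul]
        exact congrArg₂ (· ⊗ₜ ·) (map_mul π _ _) (map_mul π _ _)

theorem redTensor_tmul (x y : A) : redTensor π hπ (x ⊗ₜ y) = π x ⊗ₜ π y := rfl

theorem redTensor_smul (c : HRing) (t : A ⊗[HRing] A) :
    redTensor π hπ (c • t) = PowerSeries.constantCoeff c • redTensor π hπ t :=
  (TensorProduct.map (redLin π hπ) (redLin π hπ)).map_smulₛₗ c t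

theorem redTensor_X_smul (t : A ⊗[HRing] A) : redTensor π hπ (ħ • t) = 0 := by
  rw [redTensor_smul, PowerSeries.constantCoeff_X, zero_smul]

theorem redTensor_comm (t : A ⊗[HRing] A) : redTensor π hπ (TensorProduct.comm HRing A A t) =
    TensorProduct.comm ℝ U U (redTensor π hπ t) := by
  induction t with
  | zero => simp only [map_zero]
  | add x y hx hy => simp only [map_add, hx, hy]
  | tmul x y => rfl

/-- The reduction at `ħ = 0`, on the tensor square modulo `ħ`. -/
def redQuot : (A ⊗[HRing] A) ⧸ hIdeal (A ⊗[HRing] A) 1 →+* U ⊗[ℝ] U :=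
  Ideal.Quotient.lift (hIdeal (A ⊗[HRing] A) 1) (redTensor π hπ) (by
    rintro _ ⟨y, rfl⟩
    rw [pow_one, redTensor_X_smul])

/-- The reduction at `ħ = 0` of the completed tensor square. -/
def redCompl : HCompl (A ⊗[HRing] A) →+* U ⊗[ℝ] U :=
  (redQuot π hπ).comp ((Pi.evalRingHom _ 1).comp (HCompl (A ⊗[HRing] A)).subtype)

theorem redCompl_eq {z : HCompl (A ⊗[HRing] A)} {t : A ⊗[HRing] A} (h : z.1 1 = hMk _ 1 t) :
    redCompl π hπ z = redTensor π hπ t := by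
  change redQuot π hπ (z.1 1) = _
  rw [h]
  rfl

theorem redCompl_of (t : A ⊗[HRing] A) : redCompl π hπ (HCompl.of _ t) = redTensor π hπ t :=
  redCompl_eq π hπ rfl

theorem redCompl_smul (c : HRing) (z : HCompl (A ⊗[HRing] A)) :
    redCompl π hπ (c • z) = PowerSeries.constantCoeff c • redCompl π hπ z := by
  obtain ⟨t, ht⟩ := hMk_surjective 1 (z.1 1)
  rw [redCompl_eq π hπ ht.symm, ← redTensor_smul]
  refine redCompl_eq π hπ ?_
  rw [map_smul, ht]
  rfl

variable {π hπ}

/-- The antisymmetrization of the coproduct of `x`, divided by `ħ`, reduces to `d`. -/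
def HasCocommutator (π : A →+* U)
    (hπ : ∀ (c : HRing) (x : A), π (c • x) = PowerSeries.constantCoeff c • π x)
    (H : TopHopf A) (x : A) (d : U ⊗[ℝ] U) : Prop :=
  ∃ t s : A ⊗[HRing] A, (H.comul x).1 2 = hMk _ 2 t ∧
    t - TensorProduct.comm HRing A A t = ħ • s ∧ redTensor π hπ s = d

variable {H : TopHopf A}

theorem HasCocommutator.add {x y : A} {d e : U ⊗[ℝ] U} (hx : HasCocommutator π hπ H x d)
    (hy : HasCocommutator π hπ H y e) : HasCocommutator π hπ H (x + y) (d + e) := by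
  obtain ⟨t, s, h1, h2, h3⟩ := hx
  obtain ⟨t', s', h1', h2', h3'⟩ := hy
  refine ⟨t + t', s + s', ?_, ?_, ?_⟩
  · rw [map_add, map_add, ← h1, ← h1']
    rfl
  · rw [map_add, smul_add, ← h2, ← h2']
    abel
  · rw [map_add, h3, h3']

theorem HasCocommutator.smul {x : A} {d : U ⊗[ℝ] U} (hx : HasCocommutator π hπ H x d) (c : ℝ) :
    HasCocommutator π hπ H ((PowerSeries.C c : HRing) • x) (c • d) := by
  obtain ⟨t, s, h1, h2, h3⟩ := hx
  refine ⟨(PowerSeries.C c : HRing) • t, (PowerSeries.C c : HRing) • s, ?_, ?_, ?_⟩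
  · rw [map_smul, map_smul, ← h1]
    rfl
  · rw [map_smul, ← smul_sub, h2, smul_comm]
  · rw [redTensor_smul, h3, PowerSeries.constantCoeff_C]

theorem HasCocommutator.of_primitive {x : A} (hx : H.IsPrimitive x) :
    HasCocommutator π hπ H x 0 := by
  refine ⟨1 ⊗ₜ x + x ⊗ₜ 1, 0, ?_, ?_, map_zero _⟩
  · rw [show H.comul x = _ from hx]
    rfl
  · rw [map_add, TensorProduct.comm_tmul, TensorProduct.comm_tmul, add_comm (x ⊗ₜ[HRing] (1 : A)),
      sub_self, smul_zero]

/-- The antisymmetrization of k ⊗ x + x ⊗ l is (k - l) ∧ x. With k - l = ħcs, the factor ħ can be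
removed explicitly. -/
theorem HasCocommutator.of_twisted {k l x s : A} {c : ℝ} (hx : H.IsTwisted k l x)
    (h : (ħ * PowerSeries.C c) • s = k - l) :
    HasCocommutator π hπ H x (c • (π s ⊗ₜ π x - π x ⊗ₜ π s)) := by
  refine ⟨k ⊗ₜ x + x ⊗ₜ l, (PowerSeries.C c : HRing) • (s ⊗ₜ x - x ⊗ₜ s), ?_, ?_, ?_⟩
  · rw [show H.comul x = _ from hx]
    rfl
  · rw [map_add, TensorProduct.comm_tmul, TensorProduct.comm_tmul, ← mul_smul, smul_sub,
      TensorProduct.smul_tmul', ← TensorProduct.tmul_smul, h, TensorProduct.sub_tmul,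
      TensorProduct.tmul_sub]
    abel
  · rw [redTensor_smul, map_sub, PowerSeries.constantCoeff_C]
    rfl

/-- Here division by ħ leaves the antisymmetrization of Δ(x) itself, whose reduction vanishes when
the reduced coproduct of x is symmetric. -/
theorem HasCocommutator.X_smul (x : A)
    (h : TensorProduct.comm ℝ U U (redCompl π hπ (H.comul x)) = redCompl π hπ (H.comul x)) :
    HasCocommutator π hπ H (ħ • x) 0 := by
  obtain ⟨t, ht⟩ := hMk_surjective 2 ((H.comul x).1 2)
  have ht' : (H.comul x).1 1 = hMk _ 1 t := by
    rw [← (H.comul x).2 1, ← ht]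
    rfl
  rw [redCompl_eq π hπ ht', ← redTensor_comm] at h
  refine ⟨ħ • t, t - TensorProduct.comm HRing A A t, ?_, ?_, ?_⟩
  · rw [map_smul, map_smul, ht]
    rfl
  · rw [map_smul, smul_sub]
  · rw [map_sub, h, sub_self]

/-- Frees the statement from the chosen representative of Δ(x): two of them differ by a multiple of
ħ², which does not affect the antisymmetrization modulo ħ². -/
theorem HasCocommutator.exists_of_rep {x : A} {d : U ⊗[ℝ] U} (hx : HasCocommutator π hπ H x d)
    {t : A ⊗[HRing] A} (ht : (H.comul x).1 2 = hMk _ 2 t) : ∃ s : A ⊗[HRing] A,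
      hMk _ 2 (t - TensorProduct.comm HRing A A t) = hMk _ 2 (ħ • s) ∧ redTensor π hπ s = d := by
  obtain ⟨t', s, h1, h2, h3⟩ := hx
  refine ⟨s, ?_, h3⟩
  obtain ⟨u, hu⟩ := Ideal.Quotient.eq.1 (ht.symm.trans h1 : hMk _ 2 t = hMk _ 2 t')
  refine Ideal.Quotient.eq.2 ⟨u - TensorProduct.comm HRing A A u, ?_⟩
  rw [← h2, smul_sub, hu, ← map_smul, hu, map_sub]
  abel

end TensorReduction

/-! ### Bialgebra structure and generation of U(g) -/

theorem ueaComul_ι {g : Type} [LieRing g] [LieAlgebra ℝ g] (x : g) :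
    ueaComul g (UniversalEnvelopingAlgebra.ι ℝ x) = 1 ⊗ₜ UniversalEnvelopingAlgebra.ι ℝ x +
      UniversalEnvelopingAlgebra.ι ℝ x ⊗ₜ 1 :=
  UniversalEnvelopingAlgebra.lift_ι_apply _ _ _

theorem ueaCounit_ι {g : Type} [LieRing g] [LieAlgebra ℝ g] (x : g) :
    ueaCounit g (UniversalEnvelopingAlgebra.ι ℝ x) = 0 :=
  UniversalEnvelopingAlgebra.lift_ι_apply _ _ _

/-- `U(g)` is cocommutative. -/
theorem comm_ueaComul {g : Type} [LieRing g] [LieAlgebra ℝ g] (x : UniversalEnvelopingAlgebra ℝ g) :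
    TensorProduct.comm ℝ _ _ (ueaComul g x) = ueaComul g x := by
  have h : (Algebra.TensorProduct.comm ℝ _ _).toAlgHom.comp (ueaComul g) = ueaComul g := by
    refine UniversalEnvelopingAlgebra.hom_ext ℝ (LieHom.ext fun y => ?_)
    change Algebra.TensorProduct.comm ℝ _ _ (ueaComul g (UniversalEnvelopingAlgebra.ι ℝ y)) =
      ueaComul g (UniversalEnvelopingAlgebra.ι ℝ y)
    rw [ueaComul_ι, map_add, Algebra.TensorProduct.comm_tmul, Algebra.TensorProduct.comm_tmul,
      add_comm]
  exact AlgHom.congr_fun h x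

/-- A subalgebra of `U(g)` that contains `g` is everything. -/
theorem mem_of_forall_ι_mem {g : Type} [LieRing g] [LieAlgebra ℝ g]
    {S : Subalgebra ℝ (UniversalEnvelopingAlgebra ℝ g)}
    (h : ∀ x : g, UniversalEnvelopingAlgebra.ι ℝ x ∈ S) (u : UniversalEnvelopingAlgebra ℝ g) :
    u ∈ S := by
  let f : g →ₗ⁅ℝ⁆ S :=
    { toFun := fun x => ⟨UniversalEnvelopingAlgebra.ι ℝ x, h x⟩
      map_add' := fun x y => Subtype.ext (map_add _ x y)
      map_smul' := fun c x => Subtype.ext (map_smul _ c x)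
      map_lie' := fun {x y} => Subtype.ext (LieHom.map_lie _ x y) }
  have hf : S.val.comp (UniversalEnvelopingAlgebra.lift ℝ f) = AlgHom.id ℝ _ := by
    refine UniversalEnvelopingAlgebra.hom_ext ℝ (LieHom.ext fun y => ?_)
    exact congrArg Subtype.val (UniversalEnvelopingAlgebra.lift_ι_apply ℝ f y)
  rw [← AlgHom.id_apply (R := ℝ) u, ← hf]
  exact (UniversalEnvelopingAlgebra.lift ℝ f u).2

/-! ## The reduction of the quantum `gl(2)` -/

section QuantumGl

variable {ap a : ℝ}

namespace GL2

theorem wedge_smul_sub (r : ℝ) (x y z : GL2) :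
    wedge (x - r • y) z = wedge x z - r • wedge y z := by
  simp only [wedge, TensorProduct.sub_tmul, TensorProduct.tmul_sub, TensorProduct.tmul_smul,
    TensorProduct.smul_tmul', smul_sub]
  abel

theorem wedge_self (x : GL2) : wedge x x = 0 := sub_self _

theorem eq_sum (y : GL2) (r : ℝ) : y = ((y 0 0 - y 1 1) / 2) • (J3 - r • Jp) +
    (y 0 1 + r * ((y 0 0 - y 1 1) / 2)) • Jp + y 1 0 • Jm + ((y 0 0 + y 1 1) / 2) • I := by
  ext i j
  fin_cases i <;> fin_cases j <;> simp [J3, Jp, Jm, I] <;> ring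

/-- In the basis J₃', J₊, J₋, I the cocommutator kills J₃' and I and sends J₊, J₋ to a J₃' ∧ J₊, a
J₃' ∧ J₋. This is why J₃' is primitive and governs the twist. -/
theorem cocommIPlus_apply (ha : a ≠ 0) (y : GL2) : cocommIPlus ap 0 0 a y =
    (y 0 1 + ap / a * ((y 0 0 - y 1 1) / 2)) • a • wedge (J3 - (ap / a) • Jp) Jp +
      y 1 0 • a • wedge (J3 - (ap / a) • Jp) Jm := by
  have h : ap = a * (ap / a) := by field_simp
  generalize ap / a = r at h
  subst h
  rw [wedge_smul_sub, wedge_smul_sub, wedge_self]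
  simp only [cocommIPlus, cocomm, LinearMap.add_apply, LinearMap.smulRight_apply,
    LinearMap.smul_apply, LinearMap.sub_apply, Matrix.entryLinearMap_apply, zero_mul, mul_zero,
    neg_zero, zero_div, zero_smul, smul_eq_mul]
  module

end GL2

theorem map_wedge (x y : GL2) :
    TensorProduct.map (UniversalEnvelopingAlgebra.ι ℝ : GL2 →ₗ⁅ℝ⁆ _).toLinearMap
      (UniversalEnvelopingAlgebra.ι ℝ : GL2 →ₗ⁅ℝ⁆ _).toLinearMap (GL2.wedge x y) =
      ugl x ⊗ₜ ugl y - ugl y ⊗ₜ ugl x :=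
  map_sub _ _ _

theorem ugl_eq_sum (ap a : ℝ) (y : GL2) : ugl y =
    ((y 0 0 - y 1 1) / 2) • uglGen ap a GlGen.J3 +
      (y 0 1 + ap / a * ((y 0 0 - y 1 1) / 2)) • uglGen ap a GlGen.Jp +
      y 1 0 • uglGen ap a GlGen.Jm + ((y 0 0 + y 1 1) / 2) • uglGen ap a GlGen.I := by
  conv_lhs => rw [GL2.eq_sum y (ap / a)]
  simp only [ugl, uglGen, map_add, map_smul]

theorem ueaComul_uglGen (i : GlGen) : ueaComul GL2 (uglGen ap a i) =
    1 ⊗ₜ uglGen ap a i + uglGen ap a i ⊗ₜ 1 := by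
  cases i <;> exact ueaComul_ι _

theorem ueaCounit_uglGen (i : GlGen) : ueaCounit GL2 (uglGen ap a i) = 0 := by
  cases i <;> exact ueaCounit_ι _

/-- At ħ = 0 the terms without J₋ combine to (J₃' + rJ₊)² = J₃². -/
theorem lift_uglGen_casimir (ha : a ≠ 0) : FreeAlgebra.lift ℝ (uglGen ap a)
    (PowerSeries.constantCoeff (casimirSeries ap a GlGen.J3 GlGen.Jp GlGen.Jm)) =
      ugl GL2.J3 ^ 2 + 2 * (ugl GL2.Jp * ugl GL2.Jm) + 2 * (ugl GL2.Jm * ugl GL2.Jp) := by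
  have h : uglGen ap a GlGen.J3 = ugl GL2.J3 - (ap / a) • ugl GL2.Jp := by
    simp only [ugl, uglGen, map_sub, map_smul]
  rw [constantCoeff_casimirSeries ha]
  simp only [map_add, map_smul, map_mul, map_pow, FreeAlgebra.lift_ι_apply, h]
  change (ugl GL2.J3 - (ap / a) • ugl GL2.Jp) ^ 2 + (ap / a) • ((ugl GL2.J3 - (ap / a) • ugl GL2.Jp) *
    ugl GL2.Jp + ugl GL2.Jp * (ugl GL2.J3 - (ap / a) • ugl GL2.Jp)) +
    (ap ^ 2 / a ^ 2) • ugl GL2.Jp ^ 2 + (2 : ℝ) • (ugl GL2.Jp * ugl GL2.Jm + ugl GL2.Jm * ugl GL2.Jp) = _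
  rw [← div_pow]
  generalize ap / a = r
  simp only [pow_two, sub_mul, mul_sub, smul_mul_assoc, mul_smul_comm, smul_sub, smul_add, two_mul]
  module

/-- A Hopf structure with the prescribed coproduct is a quantization of `(gl(2), δ)` through any
reduction map with kernel `ħ • QGl` and the prescribed values on the generators. -/
theorem isQuantization (ha : a ≠ 0) {H : TopHopf (QGl ap a)} (h : IsGlHopf ap a H)
    {π : QGl ap a →+* UniversalEnvelopingAlgebra ℝ GL2}
    (hπ : ∀ (c : HRing) x, π (c • x) = PowerSeries.constantCoeff c • π x)
    (hgen : ∀ i, π (QGl.gen ap a i) = uglGen ap a i)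
    (hmk : ∀ f, π (PresentedAlg.mk _ f) =
      FreeAlgebra.lift ℝ (uglGen ap a) (PowerSeries.constantCoeff f))
    (hker : ∀ x, π x = 0 → ∃ y, x = ħ • y) : IsQuantization H (GL2.cocommIPlus ap 0 0 a) π := by
  have hX : ∀ x, π (ħ • x) = 0 := fun x => by
    rw [hπ, PowerSeries.constantCoeff_X, zero_smul]
  have hhalf : ∀ i, π (PresentedAlg.mk (glRels ap a) (qHalf a i)) = uglGen ap a i := fun i => by
    rw [hmk, constantCoeff_qHalf ha, FreeAlgebra.lift_ι_apply]
  have hexp : ∀ t, π (QGl.expJ ap a t) = 1 := fun t => by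
    rw [QGl.expJ, hmk, constantCoeff_hExp, map_one]
  have htw : ∀ {k l x}, H.IsTwisted k l x → π k = 1 → π l = 1 →
      redCompl π hπ (H.comul x) = 1 ⊗ₜ π x + π x ⊗ₜ 1 := fun {k l x} hx hk hl => by
    rw [show H.comul x = _ from hx, redCompl_of, map_add, redTensor_tmul, redTensor_tmul, hk, hl]
  -- Both sides are ring homomorphisms over evaluation at ħ = 0, so generators suffice; there the
  -- exponentials reduce to 1 and every generator becomes primitive.
  have hΔ : (redCompl π hπ).comp H.comul.toRingHom = (ueaComul GL2).toRingHom.comp π := by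
    refine PresentedAlg.ringHom_ext (fun c x => ?_) (fun c x => ?_) fun i => ?_
    · change redCompl π hπ (H.comul (c • x)) = _ • redCompl π hπ (H.comul x)
      rw [map_smul, redCompl_smul]
    · change ueaComul GL2 (π (c • x)) = _ • ueaComul GL2 (π x)
      rw [hπ, map_smul]
    · change redCompl π hπ (H.comul (QGl.gen ap a i)) = ueaComul GL2 (π (QGl.gen ap a i))
      rw [hgen, ueaComul_uglGen, ← hgen]
      cases i
      · exact htw h.comul_J3 (map_one π) (map_one π)
      · exact htw h.comul_Jp (hexp _) (hexp _)
      · exact htw h.comul_Jm (hexp _) (hexp _)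
      · exact htw h.comul_I (map_one π) (map_one π)
  have hΔ' : ∀ x, redCompl π hπ (H.comul x) = ueaComul GL2 (π x) := RingHom.congr_fun hΔ
  have hε : (PowerSeries.constantCoeff : HRing →+* ℝ).comp H.counit.toRingHom =
      (ueaCounit GL2).toRingHom.comp π := by
    refine PresentedAlg.ringHom_ext (fun c x => ?_) (fun c x => ?_) fun i => ?_
    · change PowerSeries.constantCoeff (H.counit (c • x)) = _ • PowerSeries.constantCoeff _
      rw [map_smul, smul_eq_mul, map_mul]
      rfl
    · change ueaCounit GL2 (π (c • x)) = _ • ueaCounit GL2 (π x)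
      rw [hπ, map_smul]
    · change PowerSeries.constantCoeff (H.counit (QGl.gen ap a i)) =
        ueaCounit GL2 (π (QGl.gen ap a i))
      rw [hgen, ueaCounit_uglGen, h.counit, map_zero]
  have hQ : (ħ * PowerSeries.C a) • PresentedAlg.mk (glRels ap a) (qHalf a GlGen.J3) =
      QGl.expJ ap a (a / 2) - QGl.expJ ap a (-(a / 2)) := by
    rw [QGl.expJ, QGl.expJ, mk_hExp, mk_hExp, PresentedAlg.mk_eq_evalSeries]
    exact (PresentedAlg.isQTriple ha (Set.subset_union_left (s := slRels ap a GlGen.J3 GlGen.Jp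
      GlGen.Jm))).half
  refine ⟨HComplete.isAdicComplete, (QGl.hTorsionFree ap ha).eq_zero, hπ, fun u => ?_,
    fun x => ⟨hker x, ?_⟩, fun x t ht => ?_, fun x => (RingHom.congr_fun hε x).symm,
    fun x y t hx ht => ?_⟩
  · let S : Subalgebra ℝ (UniversalEnvelopingAlgebra ℝ GL2) :=
      { π.range with
        algebraMap_mem' := fun c => ⟨algebraMap HRing _ (PowerSeries.C c), by
          rw [Algebra.algebraMap_eq_smul_one, hπ, map_one, PowerSeries.constantCoeff_C,
            Algebra.algebraMap_eq_smul_one]⟩ }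
    have hS : ∀ i, uglGen ap a i ∈ S := fun i => ⟨_, hgen i⟩
    refine mem_of_forall_ι_mem (S := S) (fun y => ?_) u
    change ugl y ∈ S
    rw [ugl_eq_sum ap a y]
    exact add_mem (add_mem (add_mem (S.smul_mem (hS _) _) (S.smul_mem (hS _) _))
      (S.smul_mem (hS _) _)) (S.smul_mem (hS _) _)
  · rintro ⟨y, rfl⟩
    exact hX y
  · rw [← hΔ', redCompl_eq π hπ ht]
    rfl
  · let c : GlGen → ℝ := fun i => match i with
      | GlGen.J3 => (y 0 0 - y 1 1) / 2
      | GlGen.Jp => y 0 1 + ap / a * ((y 0 0 - y 1 1) / 2)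
      | GlGen.Jm => y 1 0
      | GlGen.I => (y 0 0 + y 1 1) / 2
    let g : GlGen → QGl ap a := fun i => (PowerSeries.C (c i) : HRing) • QGl.gen ap a i
    have hg : ∀ i, π (g i) = c i • uglGen ap a i := fun i => by
      rw [hπ, hgen, PowerSeries.constantCoeff_C]
    -- By the description of the kernel, x is the combination of generators lifting y, plus some ħz.
    -- The cocommutator is then computed termwise, and only J₊ and J₋ contribute.
    obtain ⟨z, hz⟩ := hker (x - (g GlGen.J3 + g GlGen.Jp + g GlGen.Jm + g GlGen.I)) (by
      rw [map_sub, map_add, map_add, map_add, hg GlGen.J3, hg GlGen.Jp, hg GlGen.Jm, hg GlGen.I, hx,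
        sub_eq_zero]
      exact ugl_eq_sum ap a y)
    rw [sub_eq_iff_eq_add'] at hz
    have key := (((((HasCocommutator.of_primitive h.comul_J3).smul (c GlGen.J3)).add
      ((HasCocommutator.of_twisted h.comul_Jp hQ).smul (c GlGen.Jp))).add
      ((HasCocommutator.of_twisted h.comul_Jm hQ).smul (c GlGen.Jm))).add
      ((HasCocommutator.of_primitive h.comul_I).smul (c GlGen.I))).add
      (HasCocommutator.X_smul (hπ := hπ) z (by rw [hΔ', comm_ueaComul]))
    replace key := hz.symm ▸ key
    obtain ⟨s, hs, hd⟩ := key.exists_of_rep ht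
    refine ⟨s, hs, hd.trans ?_⟩
    rw [GL2.cocommIPlus_apply ha, hhalf, hgen, hgen, map_add, map_smul, map_smul, map_smul,
      map_smul, map_wedge, map_wedge, smul_zero, smul_zero, zero_add, add_zero, add_zero]
    rfl

theorem exists_reduction (ap : ℝ) (ha : a ≠ 0) {H : TopHopf (QGl ap a)} (h : IsGlHopf ap a H) :
    ∃ π : QGl ap a →+* UniversalEnvelopingAlgebra ℝ GL2,
      IsGlReduction ap a π ∧ IsQuantization H (GL2.cocommIPlus ap 0 0 a) π ∧
      π (QGl.casimir ap a) = ugl GL2.J3 ^ 2 + 2 * (ugl GL2.Jp * ugl GL2.Jm) +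
        2 * (ugl GL2.Jm * ugl GL2.Jp) := by
  obtain ⟨ψ, hgen, hmk, hker⟩ := QGl.exists_lift ap ha
  refine ⟨UglSeries.const.comp ψ.toRingHom, ⟨hgen _, hgen _, hgen _, hgen _⟩,
    isQuantization ha h (fun c x => ?_) hgen hmk hker, (hmk _).trans (lift_uglGen_casimir ha)⟩
  change UglSeries.const (ψ (c • x)) = _ • UglSeries.const (ψ x)
  rw [map_smul, UglSeries.const_smul]

end QuantumGl

theorem mainTheorem4 (ap a : ℝ) (hap : ap ≠ 0) (ha : a ≠ 0) :
    ∃ (H : TopHopf (QGl ap a)) (Hs : TopHopf (QSl ap a)) (Hu : TopHopf QU1),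
      IsGlHopf ap a H ∧ IsSlHopf ap a Hs ∧ Hu.IsPrimitive QU1.gen ∧
      (∃ π : QGl ap a →+* UniversalEnvelopingAlgebra ℝ GL2,
        IsGlReduction ap a π ∧ IsQuantization H (GL2.cocommIPlus ap 0 0 a) π ∧
        π (QGl.casimir ap a) = ugl GL2.J3 ^ 2 + 2 * (ugl GL2.Jp * ugl GL2.Jm) +
          2 * (ugl GL2.Jm * ugl GL2.Jp)) ∧
      (∃ Φ : HCompl (QSl ap a ⊗[HRing] QU1) ≃ₐ[HRing] QGl ap a,
        IsHopfSplitting ap a H Hs Hu Φ) ∧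
      QGl.casimir ap a ∈ Subalgebra.center HRing (QGl ap a) := by
  obtain ⟨H, hH⟩ := exists_isGlHopf ap ha
  obtain ⟨Hs, hHs⟩ := exists_isSlHopf ap ha
  obtain ⟨Hu, hHu, hHu'⟩ := exists_u1Hopf
  exact ⟨H, Hs, Hu, hH, hHs, hHu, exists_reduction ap ha hH,
    ⟨QGl.tensorEquiv ap a, isHopfSplitting hH hHs hHu hHu'⟩, QGl.casimir_mem_center ap ha⟩

end
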